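/- Let $\Omega\subset\mathbb R^2$ be a (nonempty, open) convex polygon, $T>0$, $0<q_0$, $q_1\in\mathbb R$, and $\mathcal Q=\{q\in H^1(\Omega): q_0\le q\le q_1 \text{ a.e.}\}$. Write $\|\cdot\|$ for the $L^2(\Omega)$ norm and $\|\cdot\|_1=(\|\cdot\|^2+\|\nabla\cdot\|^2)^{1/2}$ for the $H^1(\Omega)$ norm. Let $q\in\mathcal Q$, $b=(b_1,b_2)$ with $b_1,b_2\in H^1(\Omega)$, $c\in L^\infty(\Omega)$ with $c\ge 0$ a.e., $f\in L^2(\Omega)$, $u_0\in L^2(\Omega)$, and let $u\in C([0,T];L^2(\Omega))\cap L^2(0,T;H^1_0(\Omega))$ be the weak solution of $$u_t-\nabla\cdot(q\nabla u)+\nabla\cdot(bu)+cu=f\ \text{ in }(0,T]\times\Omega,\qquad u=0\ \text{ on }[0,T]\times\partial\Omega,\qquad u(0)=u_0 .$$ Fix a (conforming, finite) triangulation $\mathcal T_h$ of $\Omega$ and $k\ge 1$, let $V_h$ be the space of continuous functions on $\overline\Omega$ that are polynomials of degree at most $k$ on each triangle, and let $I_h:L^2(\Omega)\to V_h$ be the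 $L^2(\Omega)$-orthogonal projection. For $\mu>0$ and $\tilde q\in\mathcal Q$ let $v_{\tilde q}\in C([0,T];L^2(\Omega))\cap L^2(0,T;H^1_0(\Omega))$ be the weak solution of $$v_t-\nabla\cdot(\tilde q\nabla v)+\nabla\cdot(bv)+cv=f+\mu I_h(u-v)\ \text{ in }(0,T]\times\Omega,\qquad v=0\ \text{ on }[0,T]\times\partial\Omega,\qquad v(0)=0,$$ and define the approximated gradient $$\nabla_{q,\mathrm{aprox}}J(\tilde q)=\frac1\mu\,\nabla v_{\tilde q}(T)\cdot\nabla I_h\bigl(u(T)-v_{\tilde q}(T)\bigr).$$ **Proposition.** The map $\tilde q\mapsto\nabla_{q,\mathrm{aprox}}J(\tilde q)$ is well defined from $\mathcal Q$ to $L^2(\Omega)$ (that is, $v_{\tilde q}(T)\in H^1(\Omega)$, $I_h(u(T)-v_{\tilde q}(T))\in H^1(\Omega)$, and the product of the gradients lies in $L^2(\Omega)$), and it is Lipschitz continuous on $H^1$-bounded subsets of $\mathcal Q$, in particular locally Lipschitz continuous, from $H^1(\Omega)$ to $L^2(\Omega)$. More precisely, for all $M$ and $R$ there is a constant $C>0$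 (depending on $M$, $R$ and the fixed data $\Omega,T,q_0,q_1,\mathcal T_h,k,q,b,c,f,u_0$, but not on $\mu$, $\tilde q_1$, $\tilde q_2$) such that for all $0<\mu\le M$ and all $\tilde q_1,\tilde q_2\in\mathcal Q$ with $\|\tilde q_1\|_1\le R$ and $\|\tilde q_2\|_1\le R$, $$\bigl\|\nabla_{q,\mathrm{aprox}}J(\tilde q_1)-\nabla_{q,\mathrm{aprox}}J(\tilde q_2)\bigr\|\le\frac{C}{q_0\,\mu}\,\|\tilde q_1-\tilde q_2\|_1 .$$ -/

import Mathlib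

open MeasureTheory Set
open scoped ContDiff Gradient

noncomputable section

/-- The Euclidean plane. -/
abbrev Plane : Type := EuclideanSpace ℝ (Fin 2)

/-- `Ω` is (the interior of) a non-degenerate convex polygon: the nonempty interior of the convex
hull of finitely many points of the plane. -/
def IsConvexPolygon (Ω : Set Plane) : Prop :=
  Ω.Nonempty ∧ ∃ S : Finset Plane, Ω = interior (convexHull ℝ (S : Set Plane))

/-- `L²(Ω)` (real valued). -/
abbrev L2 (Ω : Set Plane) : Type := Lp ℝ 2 (volume.restrict Ω)

/-- `L²(Ω; ℝ²)`. -/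
abbrev L2Vec (Ω : Set Plane) : Type := Lp Plane 2 (volume.restrict Ω)

/-- Pairs (function, vector field) in `L²(Ω) × L²(Ω; ℝ²)`, with the Hilbert norm
`‖(v, g)‖² = ‖v‖² + ‖g‖²`. -/
abbrev GradPair (Ω : Set Plane) : Type := WithLp 2 (L2 Ω × L2Vec Ω)

/-- The test functions `C_c^∞(Ω)`. -/
def IsTestFunction (Ω : Set Plane) (φ : Plane → ℝ) : Prop :=
  ContDiff ℝ ∞ φ ∧ HasCompactSupport φ ∧ tsupport φ ⊆ Ω

theorem IsTestFunction.memLp {Ω : Set Plane} {φ : Plane → ℝ} (h : IsTestFunction Ω φ) :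
    MemLp φ 2 (volume.restrict Ω) :=
  (h.1.continuous.memLp_of_hasCompactSupport h.2.1).restrict Ω

theorem IsTestFunction.memLp_gradient {Ω : Set Plane} {φ : Plane → ℝ} (h : IsTestFunction Ω φ) :
    MemLp (∇ φ) 2 (volume.restrict Ω) := by
  have hc : Continuous (∇ φ) :=
    (InnerProductSpace.toDual ℝ Plane).symm.continuous.comp
      (h.1.continuous_fderiv (by simp))
  have hs : HasCompactSupport (∇ φ) := by
    have := (h.2.1.fderiv (𝕜 := ℝ)).comp_left
      (g := (InnerProductSpace.toDual ℝ Plane).symm) (map_zero _)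
    exact this
  exact (hc.memLp_of_hasCompactSupport hs).restrict Ω

/-- The Sobolev space `H¹(Ω)`: its elements are the pairs `(v, ∇v)` where `v ∈ L²(Ω)` has the weak
gradient `∇v ∈ L²(Ω; ℝ²)`. The norm inherited from `GradPair Ω` is the usual norm
`‖v‖₁ = (‖v‖² + ‖∇v‖²)^(1/2)`. -/
def H1 (Ω : Set Plane) : Submodule ℝ (GradPair Ω) where
  carrier := {p | ∀ φ : Plane → ℝ, IsTestFunction Ω φ →
    ∫ x in Ω, p.fst x • ∇ φ x = - ∫ x in Ω, φ x • p.snd x}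
  zero_mem' := by
    intro φ hφ
    have h1 : ∫ x in Ω, ((0 : GradPair Ω).fst x) • ∇ φ x = 0 := by
      rw [← integral_zero Plane Plane (μ := volume.restrict Ω)]
      refine integral_congr_ae ?_
      filter_upwards [Lp.coeFn_zero ℝ 2 (volume.restrict Ω)] with x hx
      change (0 : L2 Ω) x • ∇ φ x = 0
      rw [hx, Pi.zero_apply, zero_smul]
    have h2 : ∫ x in Ω, φ x • ((0 : GradPair Ω).snd x) = 0 := by
      rw [← integral_zero Plane Plane (μ := volume.restrict Ω)]
      refine integral_congr_ae ?_
      filter_upwards [Lp.coeFn_zero Plane 2 (volume.restrict Ω)] with x hx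
      change φ x • (0 : L2Vec Ω) x = 0
      rw [hx, Pi.zero_apply, smul_zero]
    rw [h1, h2, neg_zero]
  add_mem' := by
    intro p r hp hr φ hφ
    have i1 (s : GradPair Ω) : Integrable (fun x => s.fst x • ∇ φ x) (volume.restrict Ω) :=
      memLp_one_iff_integrable.1 (hφ.memLp_gradient.smul (Lp.memLp s.fst))
    have i2 (s : GradPair Ω) : Integrable (fun x => φ x • s.snd x) (volume.restrict Ω) :=
      memLp_one_iff_integrable.1 ((Lp.memLp s.snd).smul hφ.memLp)
    have h1 : ∫ x in Ω, (p + r).fst x • ∇ φ x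
        = ∫ x in Ω, (p.fst x • ∇ φ x + r.fst x • ∇ φ x) := by
      refine integral_congr_ae ?_
      filter_upwards [Lp.coeFn_add p.fst r.fst] with x hx
      rw [WithLp.add_fst, hx, Pi.add_apply, add_smul]
    have h2 : ∫ x in Ω, φ x • (p + r).snd x
        = ∫ x in Ω, (φ x • p.snd x + φ x • r.snd x) := by
      refine integral_congr_ae ?_
      filter_upwards [Lp.coeFn_add p.snd r.snd] with x hx
      rw [WithLp.add_snd, hx, Pi.add_apply, smul_add]
    rw [h1, h2, integral_add (i1 p) (i1 r), integral_add (i2 p) (i2 r), hp φ hφ, hr φ hφ, neg_add]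
  smul_mem' := by
    intro a p hp φ hφ
    have h1 : ∫ x in Ω, (a • p).fst x • ∇ φ x = ∫ x in Ω, a • (p.fst x • ∇ φ x) := by
      refine integral_congr_ae ?_
      filter_upwards [Lp.coeFn_smul a p.fst] with x hx
      rw [WithLp.smul_fst, hx, Pi.smul_apply, smul_assoc]
    have h2 : ∫ x in Ω, φ x • (a • p).snd x = ∫ x in Ω, a • (φ x • p.snd x) := by
      refine integral_congr_ae ?_
      filter_upwards [Lp.coeFn_smul a p.snd] with x hx
      rw [WithLp.smul_snd, hx, Pi.smul_apply, smul_comm]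
    rw [h1, h2, integral_smul, integral_smul, hp φ hφ, smul_neg]

/-- The space `H¹₀(Ω)`: the closure of `C_c^∞(Ω)` in the `H¹` norm. -/
def H10 (Ω : Set Plane) : Submodule ℝ (GradPair Ω) :=
  (Submodule.span ℝ {p : GradPair Ω | ∃ φ : Plane → ℝ, IsTestFunction Ω φ ∧
    p.fst =ᵐ[volume.restrict Ω] φ ∧ p.snd =ᵐ[volume.restrict Ω] ∇ φ}).topologicalClosure

/-- The admissible diffusion coefficients `𝒬 = {q ∈ H¹(Ω) : q₀ ≤ q ≤ q₁ a.e.}`. -/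
def admissible (Ω : Set Plane) (q₀ q₁ : ℝ) : Set (H1 Ω) :=
  {q | ∀ᵐ x ∂volume.restrict Ω, q₀ ≤ q.1.fst x ∧ q.1.fst x ≤ q₁}

/-- A triangulation of `Ω`: a finite (conforming) simplicial complex whose cells cover exactly the
closure of `Ω`. -/
structure Triangulation (Ω : Set Plane) extends Geometry.SimplicialComplex ℝ Plane where
  finite_faces : toSimplicialComplex.faces.Finite
  space_eq : toSimplicialComplex.space = closure Ω

/-- The Lagrange finite element space of order `k` on the triangulation `𝒯`, as a subspace of
`L²(Ω)`: the continuous functions on the closure of `Ω` that are a polynomial of total degree at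
most `k` on every cell. -/
def lagrangeSpace {Ω : Set Plane} (𝒯 : Triangulation Ω) (k : ℕ) : Submodule ℝ (L2 Ω) where
  carrier := {w | ∃ g : Plane → ℝ, ContinuousOn g (closure Ω) ∧
    (∀ s ∈ 𝒯.faces, ∃ P : MvPolynomial (Fin 2) ℝ, P.totalDegree ≤ k ∧
      ∀ x ∈ convexHull ℝ (s : Set Plane), g x = MvPolynomial.eval (fun i => x i) P) ∧
    w =ᵐ[volume.restrict Ω] g}
  zero_mem' :=
    ⟨0, continuousOn_const, fun _ _ => ⟨0, by simp, fun _ _ => by simp⟩, Lp.coeFn_zero _ _ _⟩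
  add_mem' := by
    rintro v w ⟨g, hg, hgP, hvg⟩ ⟨g', hg', hgP', hwg⟩
    refine ⟨g + g', hg.add hg', fun s hs => ?_, (Lp.coeFn_add v w).trans (hvg.add hwg)⟩
    obtain ⟨P, hP, hPx⟩ := hgP s hs
    obtain ⟨P', hP', hPx'⟩ := hgP' s hs
    exact ⟨P + P', (MvPolynomial.totalDegree_add _ _).trans (max_le hP hP'),
      fun x hx => by simp [hPx x hx, hPx' x hx]⟩
  smul_mem' := by
    rintro a v ⟨g, hg, hgP, hvg⟩
    refine ⟨a • g, hg.const_smul a, fun s hs => ?_, (Lp.coeFn_smul a v).trans (hvg.const_smul a)⟩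
    obtain ⟨P, hP, hPx⟩ := hgP s hs
    exact ⟨a • P, (MvPolynomial.totalDegree_smul_le a P).trans hP,
      fun x hx => by simp [hPx x hx, MvPolynomial.smul_eval]⟩

/-- The Lagrange space is finite dimensional; hence the orthogonal projection onto it exists. -/
instance lagrangeSpace_finiteDimensional {Ω : Set Plane} (𝒯 : Triangulation Ω) (k : ℕ) :
    FiniteDimensional ℝ (lagrangeSpace 𝒯 k) := by
  classical
  have : Finite 𝒯.faces := 𝒯.finite_faces.to_subtype
  let F := 𝒯.faces → MvPolynomial.restrictTotalDegree (Fin 2) ℝ k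
  let W : Submodule ℝ (F × L2 Ω) :=
    { carrier := {p | ∀ᵐ x ∂volume.restrict Ω, ∀ s : 𝒯.faces,
        x ∈ convexHull ℝ ((s : Finset Plane) : Set Plane) →
          p.2 x = MvPolynomial.eval (fun i => x i) (p.1 s).1}
      zero_mem' := by
        filter_upwards [Lp.coeFn_zero ℝ 2 (volume.restrict Ω)] with x hx s _
        change (0 : L2 Ω) x = MvPolynomial.eval (fun i => x i) (0 : MvPolynomial (Fin 2) ℝ)
        rw [hx, Pi.zero_apply, map_zero]
      add_mem' := by
        intro p r hp hr
        filter_upwards [hp, hr, Lp.coeFn_add p.2 r.2] with x h1 h2 hx s hs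
        change (p.2 + r.2 : L2 Ω) x = MvPolynomial.eval (fun i => x i) ((p.1 s).1 + (r.1 s).1)
        rw [hx, Pi.add_apply, h1 s hs, h2 s hs, map_add]
      smul_mem' := by
        intro a p hp
        filter_upwards [hp, Lp.coeFn_smul a p.2] with x h1 hx s hs
        change (a • p.2 : L2 Ω) x = MvPolynomial.eval (fun i => x i) (a • (p.1 s).1)
        rw [hx, Pi.smul_apply, h1 s hs, MvPolynomial.smul_eval, smul_eq_mul] }
  have hinj : Function.Injective ((LinearMap.fst ℝ F (L2 Ω)).comp W.subtype) := by
    refine (injective_iff_map_eq_zero _).2 ?_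
    rintro ⟨⟨P, w⟩, hw⟩ hP
    have hP0 : P = 0 := hP
    subst hP0
    have hw0 : w = 0 := by
      refine (Lp.eq_zero_iff_ae_eq_zero).2 ?_
      have hw' : ∀ᵐ x ∂volume.restrict Ω, ∀ s : 𝒯.faces,
        x ∈ convexHull ℝ ((s : Finset Plane) : Set Plane) →
          w x = MvPolynomial.eval (fun i => x i) ((0 : F) s).1 := hw
      have hΩ : ∀ᵐ x ∂volume.restrict Ω, x ∈ closure Ω := by
        rw [ae_iff]
        have hm : MeasurableSet {x : Plane | ¬ x ∈ closure Ω} :=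
          (isClosed_closure.measurableSet).compl
        rw [Measure.restrict_apply hm]
        convert measure_empty (μ := (volume : Measure Plane))
        ext x
        simp only [mem_inter_iff, mem_ofPred_eq, mem_empty_iff_false, iff_false, not_and]
        exact fun h h' => h (subset_closure h')
      filter_upwards [hw', hΩ] with x hx hxΩ
      rw [← 𝒯.space_eq, Geometry.SimplicialComplex.mem_space_iff] at hxΩ
      obtain ⟨s, hs, hxs⟩ := hxΩ
      exact (hx ⟨s, hs⟩ hxs).trans (map_zero (MvPolynomial.eval (fun i => x i)))
    subst hw0
    rfl
  have : FiniteDimensional ℝ W := FiniteDimensional.of_injective _ hinj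
  have hle : lagrangeSpace 𝒯 k ≤ W.map (LinearMap.snd ℝ F (L2 Ω)) := by
    rintro w ⟨g, -, hgP, hwg⟩
    choose P hPd hPx using hgP
    refine ⟨(fun s => ⟨P s.1 s.2, (MvPolynomial.mem_restrictTotalDegree _ _ _).2 (hPd s.1 s.2)⟩, w),
      ?_, rfl⟩
    filter_upwards [hwg] with x hx s hs
    rw [hx]
    exact hPx s.1 s.2 x hs
  exact Submodule.finiteDimensional_of_le hle

/-- The `L²(Ω)`-orthogonal projection `I_h` onto the Lagrange finite element space. -/
def meshProj {Ω : Set Plane} (𝒯 : Triangulation Ω) (k : ℕ) : L2 Ω →L[ℝ] L2 Ω :=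
  (lagrangeSpace 𝒯 k).starProjection

/-- The bilinear form of the operator `v ↦ -∇·(q ∇v) + ∇·(b v) + c v`:
`∫_Ω q ∇v·∇φ - v b·∇φ + c v φ`. -/
def ellipticForm {Ω : Set Plane} (q : H1 Ω) (b : Fin 2 → H1 Ω)
    (c : Lp ℝ ⊤ (volume.restrict Ω)) (v φ : GradPair Ω) : ℝ :=
  ∫ x in Ω, (q.1.fst x * inner ℝ (v.snd x) (φ.snd x)
    - v.fst x * (∑ j, (b j).1.fst x * φ.snd x j)
    + c x * v.fst x * φ.fst x)

/-- `v` is the weak solution on `[0, T]` of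
`v_t - ∇·(q ∇v) + ∇·(b v) + c v = g` in `(0, T] × Ω`, `v = 0` on `[0, T] × ∂Ω`, `v(0) = v₀`:
`v ∈ C([0, T]; L²(Ω)) ∩ L²(0, T; H¹₀(Ω))`, and the equation holds in `H⁻¹(Ω)`, integrated in
time. -/
structure IsWeakSolution {Ω : Set Plane} (T : ℝ) (q : H1 Ω) (b : Fin 2 → H1 Ω)
    (c : Lp ℝ ⊤ (volume.restrict Ω)) (g : ℝ → L2 Ω) (v₀ : L2 Ω) (v : ℝ → L2 Ω) : Prop where
  continuousOn : ContinuousOn v (Icc 0 T)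
  initial : v 0 = v₀
  weak : ∃ V : ℝ → GradPair Ω, MemLp V 2 (volume.restrict (Ioc 0 T)) ∧
    (∀ᵐ t ∂volume.restrict (Ioc 0 T), V t ∈ H10 Ω ∧ (V t).fst = v t) ∧
    ∀ φ ∈ H10 Ω, ∀ t ∈ Icc 0 T,
      inner ℝ (v t) φ.fst - inner ℝ v₀ φ.fst + ∫ s in (0 : ℝ)..t, ellipticForm q b c (V s) φ
        = ∫ s in (0 : ℝ)..t, inner ℝ (g s) φ.fst

/-- `v` is the weak solution of the data assimilation equation: right-hand side
`f + μ I_h (u - v)`, initial value `0`. -/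
def IsAssimilation {Ω : Set Plane} (T : ℝ) (𝒯 : Triangulation Ω) (k : ℕ) (μ : ℝ) (q : H1 Ω)
    (b : Fin 2 → H1 Ω) (c : Lp ℝ ⊤ (volume.restrict Ω)) (f : L2 Ω) (u v : ℝ → L2 Ω) : Prop :=
  IsWeakSolution T q b c (fun t => f + μ • meshProj 𝒯 k (u t - v t)) 0 v

/-- `G` is the approximated gradient `(1/μ) ∇v · ∇I_h(u - v)`, where `u`, `v` stand for the values
at the final time. The statement contains that `v` and `I_h(u - v)` lie in `H¹(Ω)` and that the
product of the gradients lies in `L²(Ω)`. As weak gradients are unique, so is `G`. -/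
def IsApproxGradient {Ω : Set Plane} (𝒯 : Triangulation Ω) (k : ℕ) (μ : ℝ) (u v G : L2 Ω) : Prop :=
  ∃ V W : H1 Ω, V.1.fst = v ∧ W.1.fst = meshProj 𝒯 k (u - v) ∧
    G =ᵐ[volume.restrict Ω] fun x => μ⁻¹ * inner ℝ (V.1.snd x) (W.1.snd x)

end

noncomputable section

/-! The heart of the matter is that the two assimilated solutions differ at time `T` by `O(‖q̃₁ -
q̃₂‖₁)` in the `H¹` norm. The passage to the approximated gradients is then bilinear algebra: on the
finite-dimensional Lagrange space the sup norm of the gradient is bounded by the `L²` norm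
(`exists_H1_of_mem_lagrangeSpace`), so each product of gradients is in `L²`
(`exists_approxGradient`).

The difference `w = v₁ - v₂` solves the equation with coefficient `q̃₁`, zero initial value and
source `φ ↦ ∫ (q̃₂ - q̃₁) ∇v₂ · ∇φ`. In the plane `H¹` does not embed in `L^∞`, so it is not obvious
that this source is bounded on `H¹₀` by `‖q̃₁ - q̃₂‖₁`. The estimate rests on the fact that, at a
fixed time, `v₂` solves a stationary problem whose source is in `L²` as soon as `∂ₜv₂` is.
Stampacchia truncation makes `v₂` bounded (`exists_sup_bound`). Testing the stationary equation with
`δ² v₂`, where `δ = q̃₁ - q̃₂`, then gives `‖δ ∇v₂‖ ≤ C ‖δ‖₁` (`exists_weighted_gradient_bound`).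
The transport coefficient is only in `H¹`; the inequality `W₀^{1,1} ⊂ L²` makes the transport term a
small perturbation of the diffusion (`exists_mul_small`), and Gårding's inequality holds uniformly
in the coefficient.

A bound at the single time `T` requires `∂ₜw(T)` in `L²`, hence time derivatives of the source. The
form does not depend on time, so time derivatives solve the same equation, and a time-weighted
energy estimate (`exists_smoothing_bound`) controls each further derivative after a short waiting
time, whatever the initial data. To make this rigorous, the weak solution is integrated in time,
which gives a continuous primitive with values in `H¹₀`, and the primitive is averaged in time,
which gives a smooth one. All bounds are independent of the averaging width
(`exists_regularized_bound`), and weak compactness removes it (`exists_lipschitz_bound`).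

The feedback `μ I_h v` is moved to the left-hand side, where it is nonnegative. The Gårding
constants therefore do not see `μ`, and the boundedness constants only need `μ ≤ M`. The factor
`1/μ` in the result is the one in the definition of the gradient. -/

theorem le_exp_mul_of_deriv_le {Φ Φ' : ℝ → ℝ} {κ m s t : ℝ} (hκ : 0 ≤ κ) (hm : 0 ≤ m) (hst : s ≤ t)
    (hΦ : ∀ x ∈ Icc s t, HasDerivAt Φ (Φ' x) x) (h : ∀ x ∈ Icc s t, Φ' x ≤ κ * Φ x + m) :
    Φ t ≤ Real.exp (κ * (t - s)) * (Φ s + m * (t - s)) := by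
  -- Integrating factor. The constant `m` is subtracted without a weight, which is allowed because
  -- the exponential factor is at most one.
  let F : ℝ → ℝ := fun x => Real.exp (-(κ * (x - s))) * Φ x - m * (x - s)
  have hF : ∀ x ∈ Icc s t, HasDerivAt F
      (-(κ * 1) * Real.exp (-(κ * (x - s))) * Φ x + Real.exp (-(κ * (x - s))) * Φ' x - m * 1) x := by
    intro x hx
    have h1 : HasDerivAt (fun x => x - s) 1 x := (hasDerivAt_id x).sub_const s
    have h2 := ((h1.const_mul κ).fun_neg).exp
    refine ((h2.fun_mul (hΦ x hx)).fun_sub (h1.const_mul m)).congr_deriv ?_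
    ring
  have hanti : AntitoneOn F (Icc s t) := by
    refine antitoneOn_of_hasDerivWithinAt_nonpos (convex_Icc s t)
      (fun x hx => (hF x hx).continuousAt.continuousWithinAt)
      (fun x hx => (hF x (interior_subset hx)).hasDerivWithinAt) fun x hx => ?_
    have hx' : x ∈ Icc s t := interior_subset hx
    have he : Real.exp (-(κ * (x - s))) ≤ 1 :=
      Real.exp_le_one_iff.2 (neg_nonpos.2 (mul_nonneg hκ (sub_nonneg.2 hx'.1)))
    have he0 := Real.exp_pos (-(κ * (x - s)))
    have h3 := mul_le_mul_of_nonneg_left (h x hx') he0.le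
    nlinarith [mul_le_mul_of_nonneg_right he hm]
  have h4 := hanti (left_mem_Icc.2 hst) (right_mem_Icc.2 hst) hst
  simp only [F, sub_self, mul_zero, neg_zero, Real.exp_zero, one_mul, sub_zero] at h4
  have h5 : Real.exp (κ * (t - s)) * Real.exp (-(κ * (t - s))) = 1 := by
    rw [← Real.exp_add]; simp
  have h6 := mul_le_mul_of_nonneg_left (sub_le_iff_le_add.1 h4) (Real.exp_pos (κ * (t - s))).le
  rwa [← mul_assoc, h5, one_mul] at h6

/-! ### A priori estimates for smooth solutions of abstract parabolic equations -/

section Evolution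

variable {V H : Type*} [NormedAddCommGroup V] [InnerProductSpace ℝ V]
  [NormedAddCommGroup H] [InnerProductSpace ℝ H]

/-- `y` solves `(ι y', ι φ) + A(y, φ) = G φ` at the times in `I`. -/
def SolvesOn (ι : V →L[ℝ] H) (A : V →L[ℝ] V →L[ℝ] ℝ) (y : ℝ → V) (G : ℝ → V →L[ℝ] ℝ)
    (I : Set ℝ) : Prop :=
  ∀ t ∈ I, ∀ φ, inner ℝ (ι (deriv y t)) (ι φ) + A (y t) φ = G t φ

/-- A bounded bilinear form satisfying Gårding's inequality with given constants. -/
structure IsGarding (ι : V →L[ℝ] H) (A : V →L[ℝ] V →L[ℝ] ℝ) (α κ K : ℝ) : Prop where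
  bound : ∀ v φ, |A v φ| ≤ K * ‖v‖ * ‖φ‖
  coercive : ∀ v, α * ‖v‖ ^ 2 ≤ A v v + κ * ‖ι v‖ ^ 2

/-- The form and `ι` do not depend on time, so the equation may be differentiated. Every estimate
below thus applies to time derivatives as well. -/
theorem SolvesOn.deriv {ι : V →L[ℝ] H} {A : V →L[ℝ] V →L[ℝ] ℝ} {y : ℝ → V} 
    {G G' : ℝ → V →L[ℝ] ℝ} {I : Set ℝ} (hI : IsOpen I) (hy : ContDiff ℝ ∞ y)
    (hG : ∀ t, HasDerivAt G (G' t) t) (h : SolvesOn ι A y G I) : SolvesOn ι A (deriv y) G' I := by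
  intro t ht φ
  have hy' : ContDiff ℝ ∞ (_root_.deriv y) := (contDiff_infty_iff_deriv.1 hy).2
  have d1 : HasDerivAt y (_root_.deriv y t) t := (hy.differentiable (by simp) t).hasDerivAt
  have d2 : HasDerivAt (_root_.deriv y) (_root_.deriv (_root_.deriv y) t) t :=
    (hy'.differentiable (by simp) t).hasDerivAt
  have e1 : HasDerivAt (fun s => inner ℝ (ι (_root_.deriv y s)) (ι φ) + A (y s) φ)
      (inner ℝ (ι (_root_.deriv (_root_.deriv y) t)) (ι φ) + A (_root_.deriv y t) φ) t := by
    have a1 := ((innerSL ℝ (ι φ)).comp ι).hasFDerivAt.comp_hasDerivAt t d2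
    have a2 := (A.flip φ).hasFDerivAt.comp_hasDerivAt t d1
    refine (HasDerivAt.congr_deriv (a1.add a2) ?_).congr_of_eventuallyEq (.of_forall fun s => ?_)
    · simp [real_inner_comm]
    · simp [real_inner_comm]
  have e2 : HasDerivAt (fun s => G s φ) (G' t φ) t :=
    (ContinuousLinearMap.apply ℝ ℝ φ).hasFDerivAt.comp_hasDerivAt t (hG t)
  refine e1.unique (e2.congr_of_eventuallyEq ?_)
  filter_upwards [hI.mem_nhds ht] with s hs using h s hs φ

theorem SolvesOn.hasDerivAt_norm_sq {ι : V →L[ℝ] H} {A : V →L[ℝ] V →L[ℝ] ℝ} {y : ℝ → V}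
    {G : ℝ → V →L[ℝ] ℝ} {I : Set ℝ} (hy : ContDiff ℝ ∞ y) (h : SolvesOn ι A y G I) {t : ℝ}
    (ht : t ∈ I) : HasDerivAt (fun s => ‖ι (y s)‖ ^ 2) (2 * (G t (y t) - A (y t) (y t))) t := by
  have d1 : HasDerivAt y (_root_.deriv y t) t := (hy.differentiable (by simp) t).hasDerivAt
  have d2 : HasDerivAt (fun s => ι (y s)) (ι (_root_.deriv y t)) t :=
    ι.hasFDerivAt.comp_hasDerivAt t d1
  convert d2.norm_sq using 1
  rw [← h t ht, real_inner_comm]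
  ring

/-- Coercivity provides `2α‖v‖²`; Young's inequality spends half of it on the load. The other half
is kept for the smoothing estimate. -/
theorem two_mul_sub_le {ι : V →L[ℝ] H} {A : V →L[ℝ] V →L[ℝ] ℝ} {α κ K g : ℝ} (hα : 0 < α)
    (hA : IsGarding ι A α κ K) {G : V →L[ℝ] ℝ} (hG : ‖G‖ ≤ g) (v : V) :
    2 * (G v - A v v) ≤ -(α * ‖v‖ ^ 2) + 2 * κ * ‖ι v‖ ^ 2 + g ^ 2 / α := by
  have h1 : G v ≤ g * ‖v‖ := (le_abs_self _).trans ((G.le_opNorm v).trans (by gcongr))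
  have h2 := hA.coercive v
  have h3 : 2 * (g * ‖v‖) ≤ α * ‖v‖ ^ 2 + g ^ 2 / α := by
    have : 0 ≤ (α * ‖v‖ - g) ^ 2 / α := by positivity
    have e : (α * ‖v‖ - g) ^ 2 / α = α * ‖v‖ ^ 2 + g ^ 2 / α - 2 * (g * ‖v‖) := by
      field_simp; ring
    linarith
  linarith

/-- Gronwall's inequality for `‖ι y‖²`, with the dissipation dropped. The constant sees the form
only through `α` and `κ`, so it is the same for all coefficients. -/
theorem exists_energy_bound (ι : V →L[ℝ] H) {α κ : ℝ} (hα : 0 < α) (hκ : 0 ≤ κ) (K : ℝ) {T : ℝ}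
    (hT : 0 ≤ T) :
    ∃ C, 0 < C ∧ ∀ (A : V →L[ℝ] V →L[ℝ] ℝ), IsGarding ι A α κ K → ∀ (y : ℝ → V)
      (G : ℝ → V →L[ℝ] ℝ) (I : Set ℝ) (s t g : ℝ), ContDiff ℝ ∞ y → SolvesOn ι A y G I →
      Icc s t ⊆ I → s ≤ t → t - s ≤ T → (∀ x ∈ Icc s t, ‖G x‖ ≤ g) →
      ‖ι (y t)‖ ≤ C * (‖ι (y s)‖ + g) := by
  refine ⟨Real.sqrt (Real.exp (2 * κ * T) * (1 + T / α)), by positivity, ?_⟩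
  intro A hA y G I s t g hy h hI hst htT hg
  have hg0 : 0 ≤ g := (norm_nonneg _).trans (hg s (left_mem_Icc.2 hst))
  have key := le_exp_mul_of_deriv_le (Φ := fun s => ‖ι (y s)‖ ^ 2) (κ := 2 * κ) (m := g ^ 2 / α)
    (by positivity) (by positivity) hst (fun x hx => h.hasDerivAt_norm_sq hy (hI hx)) fun x hx => by
      have := two_mul_sub_le hα hA (hg x hx) (y x)
      have : 0 ≤ α * ‖y x‖ ^ 2 := by positivity
      linarith
  rw [← Real.sqrt_sq (norm_nonneg (ι (y t))),
    ← Real.sqrt_sq (by positivity : 0 ≤ ‖ι (y s)‖ + g), ← Real.sqrt_mul (by positivity)]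
  refine Real.sqrt_le_sqrt (key.trans ?_)
  rw [mul_assoc (Real.exp _)]
  have h1 : g ^ 2 / α * (t - s) ≤ T / α * g ^ 2 := by
    rw [div_mul_eq_mul_div, div_mul_eq_mul_div]
    rw [mul_comm T]
    gcongr
  have h2 : 0 ≤ T / α := by positivity
  have h3 : 0 ≤ ‖ι (y s)‖ * g := by positivity
  have h4 : ‖ι (y s)‖ ^ 2 + g ^ 2 / α * (t - s) ≤ (1 + T / α) * (‖ι (y s)‖ + g) ^ 2 := by
    nlinarith [mul_nonneg h2 h3, mul_nonneg h2 (sq_nonneg ‖ι (y s)‖), sq_nonneg g]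
  have h0 : 0 ≤ t - s := sub_nonneg.2 hst
  have h5 : 0 ≤ ‖ι (y s)‖ ^ 2 + g ^ 2 / α * (t - s) := by positivity
  calc _ ≤ Real.exp (2 * κ * T) * (‖ι (y s)‖ ^ 2 + g ^ 2 / α * (t - s)) := by
        gcongr
    _ ≤ _ := by gcongr

/-- Smoothing in time: the time derivative at a later time is controlled by the `H` norm. -/
theorem exists_smoothing_bound (ι : V →L[ℝ] H) {α κ : ℝ} (hα : 0 < α) (hκ : 0 ≤ κ) (K : ℝ)
    {τ : ℝ} (hτ : 0 < τ) :
    ∃ C, 0 < C ∧ ∀ (A : V →L[ℝ] V →L[ℝ] ℝ), IsGarding ι A α κ K → ∀ (y : ℝ → V)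
      (G G' : ℝ → V →L[ℝ] ℝ) (I : Set ℝ) (s g : ℝ), IsOpen I → ContDiff ℝ ∞ y →
      (∀ t, HasDerivAt G (G' t) t) →
      SolvesOn ι A y G I → Icc s (s + τ) ⊆ I → (∀ x ∈ Icc s (s + τ), ‖G x‖ ≤ g) →
      (∀ x ∈ Icc s (s + τ), ‖G' x‖ ≤ g) →
      ‖ι (deriv y (s + τ))‖ ≤ C * (‖ι (y s)‖ + g) := by
  -- The weight is chosen so that `B α = 2 K² / α`, the coefficient of `‖y‖²` produced by Young's
  -- inequality in `b4`.
  set B : ℝ := 2 * K ^ 2 / α ^ 2 with hB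
  have hB0 : 0 ≤ B := by positivity
  set m : ℝ := 2 / α + τ ^ 2 / α + B / α with hm
  have hm0 : 0 ≤ m := by positivity
  refine ⟨Real.sqrt ((Real.exp (2 * κ * τ) * (B + m * τ)) / τ ^ 2) , by positivity, ?_⟩
  intro A hA y G G' I s g hI hy hG h hsub hg hg'
  have hst : s ≤ s + τ := by linarith
  have hy' : ContDiff ℝ ∞ (deriv y) := (contDiff_infty_iff_deriv.1 hy).2
  have h' := h.deriv hI hy hG
  have hg0 : 0 ≤ g := (norm_nonneg _).trans (hg s (left_mem_Icc.2 hst))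
  -- The weight `(t - s)²` removes the initial value of the derivative. Its own derivative creates
  -- the term `2(t - s)‖ι y'‖²`, which is absorbed by the dissipation of both summands of the
  -- functional. No symmetry of `A` is needed.
  have key := le_exp_mul_of_deriv_le
    (Φ := fun t => (t - s) ^ 2 * ‖ι (deriv y t)‖ ^ 2 + B * ‖ι (y t)‖ ^ 2)
    (Φ' := fun t => (2 * (t - s)) * ‖ι (deriv y t)‖ ^ 2 +
      (t - s) ^ 2 * (2 * (G' t (deriv y t) - A (deriv y t) (deriv y t)))
        + B * (2 * (G t (y t) - A (y t) (y t))))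
    (κ := 2 * κ) (m := m * g ^ 2)
    (by positivity) (by positivity) hst (fun x hx => by
      have a1 : HasDerivAt (fun t => (t - s) ^ 2) (2 * (x - s)) x := by
        have := ((hasDerivAt_id x).sub_const s).fun_pow 2
        simpa using this
      exact (a1.mul (h'.hasDerivAt_norm_sq hy' (hsub hx))).add
        ((h.hasDerivAt_norm_sq hy (hsub hx)).const_mul B)) fun x hx => by
      have b1 := two_mul_sub_le hα hA (hg x hx) (y x)
      have b2 := two_mul_sub_le hα hA (hg' x hx) (deriv y x)
      have hx0 : 0 ≤ x - s := sub_nonneg.2 hx.1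
      have hx1 : (x - s) ^ 2 ≤ τ ^ 2 := by
        have : x - s ≤ τ := by linarith [hx.2]
        gcongr
      -- The equation tested with `y'`.
      have b3 : ‖ι (deriv y x)‖ ^ 2 ≤ (g + K * ‖y x‖) * ‖deriv y x‖ := by
        have c1 := h x (hsub hx) (deriv y x)
        rw [real_inner_self_eq_norm_sq] at c1
        have c2 : G x (deriv y x) ≤ g * ‖deriv y x‖ :=
          (le_abs_self _).trans (((G x).le_opNorm _).trans
            (mul_le_mul_of_nonneg_right (hg x hx) (norm_nonneg _)))
        have c3 := (neg_le_abs _).trans (hA.bound (y x) (deriv y x))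
        linarith
      have b4 : 2 * (x - s) * ((g + K * ‖y x‖) * ‖deriv y x‖) ≤
          (x - s) ^ 2 * (α * ‖deriv y x‖ ^ 2) + (2 / α * g ^ 2 + B * (α * ‖y x‖ ^ 2)) := by
        have d1 : 0 ≤ (α * ((x - s) * ‖deriv y x‖) - (g + K * ‖y x‖)) ^ 2 / α := by positivity
        have d2 : (α * ((x - s) * ‖deriv y x‖) - (g + K * ‖y x‖)) ^ 2 / α
            = (x - s) ^ 2 * (α * ‖deriv y x‖ ^ 2)
              - 2 * (x - s) * ((g + K * ‖y x‖) * ‖deriv y x‖) + (g + K * ‖y x‖) ^ 2 / α := by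
          field_simp
          ring
        have d3 : (g + K * ‖y x‖) ^ 2 / α ≤ 2 / α * g ^ 2 + B * (α * ‖y x‖ ^ 2) := by
          have : 2 / α * g ^ 2 + B * (α * ‖y x‖ ^ 2) - (g + K * ‖y x‖) ^ 2 / α
              = (g - K * ‖y x‖) ^ 2 / α := by
            rw [hB]; field_simp; ring
          have : 0 ≤ (g - K * ‖y x‖) ^ 2 / α := by positivity
          linarith
        linarith
      have b5 := mul_le_mul_of_nonneg_left b3 (by positivity : 0 ≤ 2 * (x - s))
      have b6 := mul_le_mul_of_nonneg_left b2 (sq_nonneg (x - s))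
      have b7 := mul_le_mul_of_nonneg_left b1 hB0
      have b8 : (x - s) ^ 2 * (g ^ 2 / α) ≤ τ ^ 2 * (g ^ 2 / α) := by gcongr
      have e : m * g ^ 2 = 2 / α * g ^ 2 + τ ^ 2 * (g ^ 2 / α) + B * (g ^ 2 / α) := by
        rw [hm]; ring
      rw [e]
      linarith
  simp only [sub_self, add_sub_cancel_left] at key
  have key2 : τ ^ 2 * ‖ι (deriv y (s + τ))‖ ^ 2
      ≤ Real.exp (2 * κ * τ) * (B + m * τ) * (‖ι (y s)‖ + g) ^ 2 := by
    have c0 : 0 ≤ B * ‖ι (y (s + τ))‖ ^ 2 := by positivity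
    have c1 : B * ‖ι (y s)‖ ^ 2 + m * g ^ 2 * τ ≤ (B + m * τ) * (‖ι (y s)‖ + g) ^ 2 := by
      have : 0 ≤ m * τ := by positivity
      have : 0 ≤ ‖ι (y s)‖ * g := by positivity
      have e1 : ‖ι (y s)‖ ^ 2 ≤ (‖ι (y s)‖ + g) ^ 2 := by gcongr; linarith
      have e2 : g ^ 2 ≤ (‖ι (y s)‖ + g) ^ 2 := by
        gcongr; linarith [norm_nonneg (ι (y s))]
      calc B * ‖ι (y s)‖ ^ 2 + m * g ^ 2 * τ = B * ‖ι (y s)‖ ^ 2 + m * τ * g ^ 2 := by ring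
        _ ≤ B * (‖ι (y s)‖ + g) ^ 2 + m * τ * (‖ι (y s)‖ + g) ^ 2 := by gcongr
        _ = _ := by ring
    have c2 := mul_le_mul_of_nonneg_left c1 (Real.exp_pos (2 * κ * τ)).le
    rw [← mul_assoc] at c2
    refine le_trans (le_trans (le_add_of_nonneg_right c0) key) (le_trans (le_of_eq ?_) c2)
    ring
  rw [← Real.sqrt_sq (norm_nonneg (ι (deriv y (s + τ)))),
    ← Real.sqrt_sq (by positivity : 0 ≤ ‖ι (y s)‖ + g), ← Real.sqrt_mul (by positivity)]
  refine Real.sqrt_le_sqrt ?_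
  rw [div_mul_eq_mul_div, le_div_iff₀ (by positivity)]
  linarith

/-- Tested with `y t` itself, the equation is a coercive stationary problem in which `y'` counts as
data. Bounds in `H` on `y` and `y'` therefore become a bound in `V`. -/
theorem exists_form_bound (ι : V →L[ℝ] H) {α κ : ℝ} (hα : 0 < α) (hκ : 0 ≤ κ) (K : ℝ)
    (hι : ∀ v, ‖ι v‖ ≤ ‖v‖) :
    ∃ C, 0 < C ∧ ∀ (A : V →L[ℝ] V →L[ℝ] ℝ), IsGarding ι A α κ K → ∀ (y : ℝ → V)
      (G : ℝ → V →L[ℝ] ℝ) (I : Set ℝ) (t : ℝ), SolvesOn ι A y G I → t ∈ I →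
      ‖y t‖ ≤ C * (‖G t‖ + ‖ι (deriv y t)‖ + ‖ι (y t)‖) := by
  refine ⟨(1 + κ) / α, by positivity, ?_⟩
  intro A hA y G I t h ht
  have h1 := h t ht (y t)
  have h2 := hA.coercive (y t)
  have h3 : G t (y t) ≤ ‖G t‖ * ‖y t‖ := (le_abs_self _).trans ((G t).le_opNorm _)
  have h4 : -inner ℝ (ι (deriv y t)) (ι (y t)) ≤ ‖ι (deriv y t)‖ * ‖y t‖ :=
    (neg_le_abs _).trans ((abs_real_inner_le_norm _ _).trans
      (mul_le_mul_of_nonneg_left (hι _) (norm_nonneg _)))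
  have h5 : ‖ι (y t)‖ ^ 2 ≤ ‖ι (y t)‖ * ‖y t‖ := by
    rw [sq]; exact mul_le_mul_of_nonneg_left (hι _) (norm_nonneg _)
  rcases (norm_nonneg (y t)).eq_or_lt with h0 | h0
  · rw [← h0]; positivity
  have h6 : α * ‖y t‖ ^ 2 ≤ (‖G t‖ + ‖ι (deriv y t)‖ + κ * ‖ι (y t)‖) * ‖y t‖ := by
    nlinarith [mul_le_mul_of_nonneg_left h5 hκ]
  have h7 : α * ‖y t‖ ≤ ‖G t‖ + ‖ι (deriv y t)‖ + κ * ‖ι (y t)‖ := by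
    refine le_of_mul_le_mul_right ?_ h0
    linarith
  rw [div_mul_eq_mul_div, le_div_iff₀ hα]
  have a1 := norm_nonneg (G t)
  have a2 := norm_nonneg (ι (deriv y t))
  have a3 := norm_nonneg (ι (y t))
  nlinarith [mul_nonneg hκ a1, mul_nonneg hκ a2, mul_nonneg hκ a3]

/-- Bounded sets of a Hilbert space are weakly compact, `ι` is weakly continuous and the norm is
weakly lower semicontinuous. This transfers the bounds on time averages to the solution itself. -/
theorem exists_preimage_of_approx [CompleteSpace V] [CompleteSpace H] (ι : V →L[ℝ] H) {c : ℝ}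
    {v : H} (h : ∀ ε > 0, ∃ y, ‖y‖ ≤ c + ε ∧ ‖ι y - v‖ ≤ ε) : ∃ y, ι y = v ∧ ‖y‖ ≤ c := by
  choose! y hy using h
  let x : ℕ → V := fun n => y (1 / ((n : ℝ) + 1))
  have hpos (n : ℕ) : 0 < 1 / ((n : ℝ) + 1) := Nat.one_div_pos_of_nat
  have hx (n : ℕ) : ‖x n‖ ≤ c + 1 / ((n : ℝ) + 1) := (hy _ (hpos n)).1
  have hlim : Filter.Tendsto (fun n => ι (x n)) Filter.atTop (nhds v) := by
    rw [tendsto_iff_norm_sub_tendsto_zero]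
    exact squeeze_zero (fun _ => norm_nonneg _) (fun n => (hy _ (hpos n)).2)
      tendsto_one_div_add_atTop_nhds_zero_nat
  -- By Riesz representation the sequence lives in a weak-* compact ball of the dual; a cluster
  -- point suffices, no subsequence is extracted.
  let ℓ : ℕ → WeakDual ℝ V := fun n => StrongDual.toWeakDual (innerSL ℝ (x n))
  have hℓ (r : ℝ) (n : ℕ) (hn : ‖x n‖ ≤ r) :
      ℓ n ∈ WeakDual.toStrongDual ⁻¹' Metric.closedBall (0 : StrongDual ℝ V) r := by
    simpa [ℓ] using hn
  obtain ⟨L, -, hL⟩ := (WeakDual.isCompact_closedBall (𝕜 := ℝ) (0 : StrongDual ℝ V)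
    (c + 1)).exists_mapClusterPt (f := Filter.atTop) (u := ℓ)
    (Filter.tendsto_principal.2 (Filter.Eventually.of_forall fun n => hℓ _ n ((hx n).trans (by
      have : 1 / ((n : ℝ) + 1) ≤ 1 := by
        rw [div_le_one (by positivity)]; linarith [(Nat.cast_nonneg n : (0 : ℝ) ≤ n)]
      linarith))))
  let z : V := (InnerProductSpace.toDual ℝ V).symm (WeakDual.toStrongDual L)
  have hz (w : V) : inner ℝ z w = L w := by
    simp only [z, InnerProductSpace.toDual_symm_apply]; rfl
  refine ⟨z, ?_, ?_⟩
  · refine ext_inner_right ℝ fun w => ?_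
    rw [← ContinuousLinearMap.adjoint_inner_right, hz]
    have h1 : MapClusterPt (L (ContinuousLinearMap.adjoint ι w)) Filter.atTop
        (fun n => (ℓ n) (ContinuousLinearMap.adjoint ι w)) :=
      hL.continuousAt_comp (WeakDual.eval_continuous _).continuousAt
    have h2 : Filter.Tendsto (fun n => (ℓ n) (ContinuousLinearMap.adjoint ι w)) Filter.atTop
        (nhds (inner ℝ v w)) := by
      have : (fun n => (ℓ n) (ContinuousLinearMap.adjoint ι w)) = fun n => inner ℝ (ι (x n)) w := by
        ext n
        rw [← ContinuousLinearMap.adjoint_inner_right]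
        rfl
      rw [this]
      exact hlim.inner tendsto_const_nhds
    exact (eq_of_nhds_neBot (ClusterPt.mono h1 h2)).trans rfl
  · have hzn : ‖z‖ = ‖WeakDual.toStrongDual L‖ := by simp [z]
    rw [hzn]
    -- For each `ε` the sequence is eventually in the closed ball of radius `c + ε`, which is weak-*
    -- closed.
    refine le_of_forall_pos_le_add fun ε hε => ?_
    have hcl : IsClosed (WeakDual.toStrongDual ⁻¹' Metric.closedBall (0 : StrongDual ℝ V) (c + ε)) :=
      WeakDual.isClosed_closedBall _ _
    have : L ∈ WeakDual.toStrongDual ⁻¹' Metric.closedBall (0 : StrongDual ℝ V) (c + ε) := by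
      refine hcl.mem_of_mapClusterPt hL ?_
      obtain ⟨N, hN⟩ := exists_nat_one_div_lt hε
      filter_upwards [Filter.eventually_ge_atTop N] with n hn
      refine hℓ _ n ((hx n).trans ?_)
      have := Nat.one_div_le_one_div (α := ℝ) hn
      linarith
    simpa using this

end Evolution

/-! ### Averages in time with a smooth kernel -/

section TimeAverage

variable {E F : Type*} [NormedAddCommGroup E] [NormedSpace ℝ E] [NormedAddCommGroup F]
  [NormedSpace ℝ F]

/-- The average of `g` around `t` with the weight given by the bump function `ρ`. -/
def timeAvg (ρ : ContDiffBump (0 : ℝ)) (g : ℝ → E) (t : ℝ) : E :=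
  ∫ s, ρ.normed volume s • g (t - s)

theorem timeAvg_eq_convolution (ρ : ContDiffBump (0 : ℝ)) (g : ℝ → E) :
    timeAvg ρ g = convolution (ρ.normed volume) g (ContinuousLinearMap.lsmul ℝ ℝ) volume := rfl

theorem timeAvg_integrable (ρ : ContDiffBump (0 : ℝ)) {g : ℝ → E} (hg : Continuous g) (t : ℝ) :
    Integrable fun s => ρ.normed volume s • g (t - s) :=
  (ρ.continuous_normed.smul (hg.comp (continuous_const.sub continuous_id))).integrable_of_hasCompactSupport
    ρ.hasCompactSupport_normed.smul_right

theorem contDiff_timeAvg [CompleteSpace E] (ρ : ContDiffBump (0 : ℝ)) {g : ℝ → E}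
    (hg : Continuous g) : ContDiff ℝ ∞ (timeAvg ρ g) := by
  rw [timeAvg_eq_convolution]
  exact ρ.hasCompactSupport_normed.contDiff_convolution_left _ ρ.contDiff_normed
    hg.locallyIntegrable

theorem map_timeAvg [CompleteSpace E] [CompleteSpace F] (ρ : ContDiffBump (0 : ℝ)) {g : ℝ → E}
    (hg : Continuous g) (L : E →L[ℝ] F) (t : ℝ) :
    L (timeAvg ρ g t) = timeAvg ρ (fun s => L (g s)) t := by
  rw [timeAvg, ← L.integral_comp_comm (timeAvg_integrable ρ hg t)]
  simp [timeAvg]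

theorem timeAvg_congr (ρ : ContDiffBump (0 : ℝ)) {g g' : ℝ → E} {t : ℝ}
    (h : ∀ x ∈ Ioo (t - ρ.rOut) (t + ρ.rOut), g x = g' x) : timeAvg ρ g t = timeAvg ρ g' t := by
  refine integral_congr_ae (.of_forall fun s => ?_)
  by_cases hs : s ∈ Metric.ball (0 : ℝ) ρ.rOut
  · rw [Real.ball_eq_Ioo] at hs
    dsimp only
    rw [h _ ⟨by linarith [hs.2], by linarith [hs.1]⟩]
  · have : ρ.normed volume s = 0 := by
      rwa [← Function.notMem_support, ρ.support_normed_eq]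
    simp [this]

theorem timeAvg_add (ρ : ContDiffBump (0 : ℝ)) {g g' : ℝ → E} (hg : Continuous g)
    (hg' : Continuous g') (t : ℝ) :
    timeAvg ρ (fun s => g s + g' s) t = timeAvg ρ g t + timeAvg ρ g' t := by
  rw [timeAvg, timeAvg, timeAvg,
    ← integral_add (timeAvg_integrable ρ hg t) (timeAvg_integrable ρ hg' t)]
  simp

theorem timeAvg_const [CompleteSpace E] (ρ : ContDiffBump (0 : ℝ)) (w : E) (t : ℝ) :
    timeAvg ρ (fun _ => w) t = w := by
  rw [timeAvg, ρ.integral_normed_smul]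

theorem norm_timeAvg_sub_le [CompleteSpace E] (ρ : ContDiffBump (0 : ℝ)) {g : ℝ → E}
    (hg : Continuous g) {w : E} {η t : ℝ}
    (h : ∀ x ∈ Ioo (t - ρ.rOut) (t + ρ.rOut), ‖g x - w‖ ≤ η) : ‖timeAvg ρ g t - w‖ ≤ η := by
  have e : timeAvg ρ g t - w = ∫ s, ρ.normed volume s • (g (t - s) - w) := by
    have h1 := timeAvg_const ρ w t
    conv_lhs => rw [← h1]
    rw [timeAvg, timeAvg, ← integral_sub (timeAvg_integrable ρ hg t)
      (timeAvg_integrable ρ continuous_const t)]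
    simp only [smul_sub]
  rw [e]
  have h2 : ∫ s, ρ.normed volume s * η = η := by
    rw [integral_mul_const, ρ.integral_normed, one_mul]
  rw [← h2]
  refine norm_integral_le_of_norm_le (ρ.integrable_normed.mul_const η) (.of_forall fun s => ?_)
  rw [norm_smul, Real.norm_of_nonneg (ρ.nonneg_normed s)]
  by_cases hs : s ∈ Metric.ball (0 : ℝ) ρ.rOut
  · rw [Real.ball_eq_Ioo] at hs
    exact mul_le_mul_of_nonneg_left (h _ ⟨by linarith [hs.2], by linarith [hs.1]⟩)
      (ρ.nonneg_normed s)
  · have : ρ.normed volume s = 0 := by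
      rwa [← Function.notMem_support, ρ.support_normed_eq]
    simp [this]

theorem exists_timeAvg_close [CompleteSpace E] {g : ℝ → E} (hg : Continuous g) (a : ℝ) {η : ℝ}
    (hη : 0 < η) : ∃ r > 0, ∀ ρ : ContDiffBump (0 : ℝ), ρ.rOut ≤ r → ∀ t, |t - a| ≤ 2 * ρ.rOut →
      ‖timeAvg ρ g t - g a‖ ≤ η := by
  obtain ⟨r, hr, h⟩ := Metric.continuous_iff.1 hg a η hη
  -- The averaging window around `t` has radius `rOut` and `t` is within `2 rOut` of `a`, so all
  -- relevant points are within `3 rOut` of `a`.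
  refine ⟨r / 3, by positivity, fun ρ hρ t ht => norm_timeAvg_sub_le ρ hg fun x hx => ?_⟩
  rw [← dist_eq_norm]
  refine (h x ?_).le
  rw [Real.dist_eq, abs_lt]
  rw [abs_le] at ht
  constructor <;> linarith [hx.1, hx.2]

/-- Here the derivative falls on the function and not on the kernel. This identifies the derivative
of an averaged primitive with the average of the solution. -/
theorem hasDerivAt_timeAvg [CompleteSpace E] (ρ : ContDiffBump (0 : ℝ)) {g g' : ℝ → E}
    (hg : ∀ t, HasDerivAt g (g' t) t) (hg' : Continuous g') (t : ℝ) :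
    HasDerivAt (timeAvg ρ g) (timeAvg ρ g' t) t := by
  have hgc : Continuous g := continuous_iff_continuousAt.2 fun t => (hg t).continuousAt
  obtain ⟨B, hB⟩ := (isCompact_Icc (a := t - ρ.rOut - 1) (b := t + ρ.rOut + 1)).exists_bound_of_continuousOn
    hg'.continuousOn
  refine (hasDerivAt_integral_of_dominated_loc_of_deriv_le
    (F := fun x s => ρ.normed volume s • g (x - s))
    (F' := fun x s => ρ.normed volume s • g' (x - s))
    (bound := fun s => ρ.normed volume s * B) (s := Metric.ball t 1)
    (Metric.ball_mem_nhds t one_pos)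
    (.of_forall fun x => (timeAvg_integrable ρ hgc x).aestronglyMeasurable)
    (timeAvg_integrable ρ hgc t) (timeAvg_integrable ρ hg' t).aestronglyMeasurable
    (.of_forall fun s x hx => ?_) (ρ.integrable_normed.mul_const B)
    (.of_forall fun s x hx => ?_)).2
  · rw [norm_smul, Real.norm_of_nonneg (ρ.nonneg_normed s)]
    by_cases hs : s ∈ Metric.ball (0 : ℝ) ρ.rOut
    · rw [Real.ball_eq_Ioo] at hs hx
      exact mul_le_mul_of_nonneg_left (hB _ ⟨by linarith [hs.2, hx.1], by linarith [hs.1, hx.2]⟩)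
        (ρ.nonneg_normed s)
    · have : ρ.normed volume s = 0 := by
        rwa [← Function.notMem_support, ρ.support_normed_eq]
      simp [this]
  · have h1 : HasDerivAt (fun x => x - s) 1 x := (hasDerivAt_id x).sub_const s
    have h2 := (hg (x - s)).scomp x h1
    rw [one_smul] at h2
    exact h2.const_smul _

/-- Averaging an affine function only shifts time by the mean of the kernel; that the shift is at
most the radius is all that is needed later. -/
theorem timeAvg_affine [CompleteSpace E] (ρ : ContDiffBump (0 : ℝ)) (w f : E) :
    ∃ m : ℝ, |m| ≤ ρ.rOut ∧ ∀ t, timeAvg ρ (fun s => w + s • f) t = w + (t - m) • f := by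
  refine ⟨-timeAvg ρ (fun s => s) 0, ?_, fun t => ?_⟩
  · have := norm_timeAvg_sub_le ρ (g := fun s : ℝ => s) continuous_id (w := 0) (η := ρ.rOut) (t := 0)
      fun x hx => by
        rw [sub_zero, Real.norm_eq_abs, abs_le]
        constructor <;> linarith [hx.1, hx.2]
    simpa using this
  · have h1 : timeAvg ρ (fun s : ℝ => s) t = t + timeAvg ρ (fun s : ℝ => s) 0 := by
      have e : timeAvg ρ (fun s : ℝ => s) t = timeAvg ρ (fun s : ℝ => t + s) 0 := by
        simp [timeAvg, sub_eq_add_neg]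
      rw [e, timeAvg_add ρ (g' := fun s => s) continuous_const continuous_id, timeAvg_const]
    rw [timeAvg_add ρ continuous_const (by fun_prop), timeAvg_const, sub_neg_eq_add, ← h1]
    have h2 := map_timeAvg ρ (g := fun s : ℝ => s) continuous_id
      ((ContinuousLinearMap.lsmul ℝ ℝ).flip f) t
    simp only [ContinuousLinearMap.flip_apply, ContinuousLinearMap.lsmul_apply] at h2
    rw [← h2]

end TimeAverage

/-! ### The integrated equation and its averages -/

section Mollify

variable {V H : Type*} [NormedAddCommGroup V] [InnerProductSpace ℝ V]
  [NormedAddCommGroup H] [InnerProductSpace ℝ H]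

/-- The functional `φ ↦ (h, ι φ)` as a continuous linear function of `h`. -/
def loadFunctional (ι : V →L[ℝ] H) : H →L[ℝ] V →L[ℝ] ℝ :=
  ((ContinuousLinearMap.compL ℝ V H ℝ).flip ι).comp (innerSL ℝ)

@[simp]
theorem loadFunctional_apply (ι : V →L[ℝ] H) (h : H) (φ : V) :
    loadFunctional ι h φ = inner ℝ h (ι φ) := rfl

theorem norm_loadFunctional_le {ι : V →L[ℝ] H} (hι : ∀ v, ‖ι v‖ ≤ ‖v‖) (h : H) :
    ‖loadFunctional ι h‖ ≤ ‖h‖ :=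
  ContinuousLinearMap.opNorm_le_bound _ (norm_nonneg _) fun φ =>
    (abs_real_inner_le_norm _ _).trans (mul_le_mul_of_nonneg_left (hι φ) (norm_nonneg _))

/-- The time integrated form of the evolution equation on `[0, T]`: `Z` is the primitive of the
solution and `ζ` the solution itself as a continuous function with values in `H`. -/
structure IntegratedSolution (ι : V →L[ℝ] H) (A : V →L[ℝ] V →L[ℝ] ℝ) (T : ℝ) (Z : ℝ → V)
    (ζ r : ℝ → H) : Prop where
  continuous_primitive : Continuous Z
  continuous_solution : Continuous ζ
  continuous_rhs : Continuous r
  primitive_eq : ∀ t ∈ Icc 0 T, ι (Z t) = ∫ s in (0 : ℝ)..t, ζ s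
  equation : ∀ t ∈ Icc 0 T, ∀ φ, inner ℝ (ζ t) (ι φ) + A (Z t) φ = inner ℝ (r t) (ι φ)

variable [CompleteSpace V] [CompleteSpace H] {ι : V →L[ℝ] H} {A : V →L[ℝ] V →L[ℝ] ℝ} {T : ℝ}
  {Z : ℝ → V} {ζ r : ℝ → H}

/-- The averaging window has to stay inside `[0, T]`, where `ι Z` is the primitive of `ζ`; hence the
restriction on `t`. -/
theorem IntegratedSolution.map_deriv_timeAvg (h : IntegratedSolution ι A T Z ζ r)
    (ρ : ContDiffBump (0 : ℝ)) {t : ℝ} (ht : t ∈ Ioo ρ.rOut (T - ρ.rOut)) :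
    ι (deriv (timeAvg ρ Z) t) = timeAvg ρ ζ t := by
  have hY : HasDerivAt (timeAvg ρ Z) (deriv (timeAvg ρ Z) t) t :=
    ((contDiff_timeAvg ρ h.continuous_primitive).differentiable (by simp) t).hasDerivAt
  have h1 : HasDerivAt (fun s => ι (timeAvg ρ Z s)) (ι (deriv (timeAvg ρ Z) t)) t :=
    ι.hasFDerivAt.comp_hasDerivAt t hY
  have h2 := hasDerivAt_timeAvg ρ (g := fun t => ∫ s in (0 : ℝ)..t, ζ s) (g' := ζ)
    (fun t => h.continuous_solution.integral_hasStrictDerivAt 0 t |>.hasDerivAt)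
    h.continuous_solution t
  refine h1.unique (h2.congr_of_eventuallyEq ?_)
  filter_upwards [isOpen_Ioo.mem_nhds ht] with s hs
  rw [map_timeAvg ρ h.continuous_primitive]
  refine timeAvg_congr ρ fun x hx => h.primitive_eq x ⟨?_, ?_⟩ <;>
    linarith [hx.1, hx.2, hs.1, hs.2]

/-- The integrated equation holds at every time with a `Z` that is continuous in `V`. Its average is
smooth in `V`, and averaging commutes with all the linear maps involved. The derivative of the
average stands for the solution. -/
theorem IntegratedSolution.solvesOn_timeAvg (h : IntegratedSolution ι A T Z ζ r)
    (ρ : ContDiffBump (0 : ℝ)) :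
    SolvesOn ι A (timeAvg ρ Z) (fun t => loadFunctional ι (timeAvg ρ r t))
      (Ioo ρ.rOut (T - ρ.rOut)) := by
  intro t ht φ
  rw [h.map_deriv_timeAvg ρ ht, loadFunctional_apply, real_inner_comm, real_inner_comm (ι φ)]
  have e1 := map_timeAvg ρ h.continuous_solution (innerSL ℝ (ι φ)) t
  have e2 := map_timeAvg ρ h.continuous_primitive (A.flip φ) t
  have e3 := map_timeAvg ρ h.continuous_rhs (innerSL ℝ (ι φ)) t
  simp only [innerSL_apply_apply, ContinuousLinearMap.flip_apply] at e1 e2 e3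
  rw [e1, e2, e3, ← timeAvg_add ρ (by have := h.continuous_solution; fun_prop)
    (by have := h.continuous_primitive; fun_prop)]
  refine timeAvg_congr ρ fun x hx => ?_
  rw [real_inner_comm, real_inner_comm (r x)]
  refine h.equation x ⟨?_, ?_⟩ φ <;> linarith [hx.1, hx.2, ht.1, ht.2]

end Mollify

/-! ### Lipschitz dependence of the final value on the form -/

section LipschitzDependence

variable {V H : Type*} [NormedAddCommGroup V] [InnerProductSpace ℝ V]
  [NormedAddCommGroup H] [InnerProductSpace ℝ H] [CompleteSpace V] [CompleteSpace H]

theorem IntegratedSolution.norm_map_timeAvg_le {ι : V →L[ℝ] H} {A : V →L[ℝ] V →L[ℝ] ℝ} {T : ℝ}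
    {Z : ℝ → V} {ζ r : ℝ → H} (h : IntegratedSolution ι A T Z ζ r) (ρ : ContDiffBump (0 : ℝ)) {m : ℝ}
    (hm : ∀ t, ‖ζ t‖ ≤ m) {t : ℝ} (ht : t ∈ Ioo ρ.rOut (T - ρ.rOut)) :
    ‖ι (timeAvg ρ Z t)‖ ≤ m * T := by
  have hm0 : 0 ≤ m := (norm_nonneg _).trans (hm 0)
  rw [map_timeAvg ρ h.continuous_primitive]
  have hc : Continuous fun s => ι (Z s) := ι.continuous.comp h.continuous_primitive
  have := norm_timeAvg_sub_le ρ hc (w := 0) (η := m * T) (t := t) fun x hx => by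
    have hx0 : 0 ≤ x := by linarith [hx.1, ht.1]
    have hxT : x ≤ T := by linarith [hx.2, ht.2]
    rw [sub_zero, h.primitive_eq x ⟨hx0, hxT⟩]
    refine (intervalIntegral.norm_integral_le_of_norm_le_const fun s _ => hm s).trans ?_
    rw [sub_zero, abs_of_nonneg hx0]
    gcongr
  simpa using this

theorem IntegratedSolution.norm_map_deriv_timeAvg_le {ι : V →L[ℝ] H} {A : V →L[ℝ] V →L[ℝ] ℝ}
    {T : ℝ} {Z : ℝ → V} {ζ r : ℝ → H} (h : IntegratedSolution ι A T Z ζ r)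
    (ρ : ContDiffBump (0 : ℝ)) {m : ℝ}
    (hm : ∀ t, ‖ζ t‖ ≤ m) {t : ℝ} (ht : t ∈ Ioo ρ.rOut (T - ρ.rOut)) :
    ‖ι (deriv (timeAvg ρ Z) t)‖ ≤ m := by
  rw [h.map_deriv_timeAvg ρ ht]
  simpa using norm_timeAvg_sub_le ρ h.continuous_solution (w := 0) (η := m) (t := t)
    fun x _ => by simpa using hm x

/-- For small averaging width, the averages are close to the solution at the two end times. -/
theorem IntegratedSolution.exists_timeAvg_close {ι : V →L[ℝ] H} {A : V →L[ℝ] V →L[ℝ] ℝ}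
    {T : ℝ} (hT : 0 < T) {Z : ℝ → V} {ζ r : ℝ → H} (h : IntegratedSolution ι A T Z ζ r)
    (h0 : ζ 0 = 0) {ε : ℝ} (hε : 0 < ε) :
    ∃ r₀ > 0, ∀ ρ : ContDiffBump (0 : ℝ), ρ.rOut ≤ r₀ →
      ‖ι (timeAvg ρ Z (2 * ρ.rOut))‖ ≤ ε ∧ ‖ι (deriv (timeAvg ρ Z) (2 * ρ.rOut))‖ ≤ ε ∧
      ‖ι (deriv (timeAvg ρ Z) (T - 2 * ρ.rOut)) - ζ T‖ ≤ ε := by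
  obtain ⟨r₁, hr₁, h₁⟩ := _root_.exists_timeAvg_close
    (ι.continuous.comp h.continuous_primitive) 0 hε
  obtain ⟨r₂, hr₂, h₂⟩ := _root_.exists_timeAvg_close h.continuous_solution 0 hε
  obtain ⟨r₃, hr₃, h₃⟩ := _root_.exists_timeAvg_close h.continuous_solution T hε
  refine ⟨min (min r₁ r₂) (min r₃ (T / 8)), by positivity, fun ρ hρ => ?_⟩
  simp only [le_min_iff] at hρ
  obtain ⟨⟨k₁, k₂⟩, k₃, k₄⟩ := hρ
  have hp := ρ.rOut_pos
  refine ⟨?_, ?_, ?_⟩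
  · have := h₁ ρ k₁ (2 * ρ.rOut) (by rw [sub_zero, abs_of_pos (by positivity)])
    have e : ι (Z 0) = 0 := by
      rw [h.primitive_eq 0 ⟨le_rfl, hT.le⟩, intervalIntegral.integral_same]
    rw [Function.comp_apply, e, sub_zero] at this
    rwa [map_timeAvg ρ h.continuous_primitive]
  · have := h₂ ρ k₂ (2 * ρ.rOut) (by rw [sub_zero, abs_of_pos (by positivity)])
    rw [h0, sub_zero] at this
    rwa [h.map_deriv_timeAvg ρ ⟨by linarith, by linarith⟩]
  · have := h₃ ρ k₃ (T - 2 * ρ.rOut)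
      (by rw [sub_sub_cancel_left, abs_neg, abs_of_pos (by positivity)])
    rwa [h.map_deriv_timeAvg ρ ⟨by linarith, by linarith⟩]

set_option maxHeartbeats 1000000 in
-- The final value in `V` of the difference is bounded for solutions averaged in time. For the
-- averaged primitives `Y` (second solution) and `W` (difference), `Y'` and `W'` approximate the
-- quantities of interest, so `W'` has to be bounded in `V`. This needs `W''` in `H`, hence the
-- source `(A₂ - A₁) Y` with two derivatives, hence `Y'''` in `H`, hence `U'''` in `H` for the
-- observed `U`. The hypothesis on `A₂ - A₁` is required only at solutions of stationary problems
-- with load in `H`.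
theorem exists_regularized_bound (ι : V →L[ℝ] H) (hι : ∀ v, ‖ι v‖ ≤ ‖v‖) {α κ : ℝ} (hα : 0 < α)
    (hκ : 0 ≤ κ) (K : ℝ) {p m N T : ℝ} (hp : 0 ≤ p) (hm : 0 ≤ m) (hN : 0 ≤ N) (hT : 0 < T) :
    ∃ C, 0 < C ∧ ∀ (A₀ A₁ A₂ : V →L[ℝ] V →L[ℝ] ℝ) (P : H →L[ℝ] H) (f u₀ : H)
      (Z₀ Z₁ Z₂ : ℝ → V) (ζ₀ ζ₁ ζ₂ : ℝ → H) (d ε : ℝ),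
      IsGarding ι A₀ α κ K → IsGarding ι A₁ α κ K → IsGarding ι A₂ α κ K →
      (∀ h, ‖P h‖ ≤ p * ‖h‖) → ‖f‖ ≤ m →
      IntegratedSolution ι A₀ T Z₀ ζ₀ (fun t => u₀ + t • f) → (∀ t, ‖ζ₀ t‖ ≤ m) →
      IntegratedSolution ι A₁ T Z₁ ζ₁ (fun t => t • f + P (ι (Z₀ t))) → ζ₁ 0 = 0 →
      IntegratedSolution ι A₂ T Z₂ ζ₂ (fun t => t • f + P (ι (Z₀ t))) → ζ₂ 0 = 0 →
      0 ≤ d →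
      (∀ y g, (∀ φ, A₂ y φ = inner ℝ g (ι φ)) →
        ∀ φ, |(A₂ - A₁) y φ| ≤ N * (‖g‖ + ‖y‖) * d * ‖φ‖) →
      0 < ε → ε ≤ 1 →
      ∃ w v : V, ‖w‖ ≤ C * (d + ε) ∧ ‖v‖ ≤ C ∧ ‖ι w - (ζ₁ T - ζ₂ T)‖ ≤ 2 * ε ∧
        ‖ι v - ζ₂ T‖ ≤ ε := by
  obtain ⟨Ca, hCa, ha⟩ := exists_energy_bound ι hα hκ K hT.le
  have hτ : 0 < T / 16 := by positivity
  obtain ⟨Cb, hCb, hb⟩ := exists_smoothing_bound ι hα hκ K hτ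
  obtain ⟨Cv, hCv, hv⟩ := exists_form_bound ι hα hκ K hι
  set τ := T / 16 with hτdef
  set u2 := Cb * (m + m) with hu2
  set u3 := Cb * (u2 + 0) with hu3
  set g0 := 2 * T * m + p * (m * T) with hg0
  set g1 := m + p * m with hg1
  set y1 := Ca * (1 + g1) with hy1
  set y0 := Ca * (1 + g0) with hy0
  set y2 := Cb * (y1 + (g1 + p * u2)) with hy2
  set y3 := Cb * (y2 + (p * u2 + p * u3)) with hy3
  set n0 := Cv * (g0 + y1 + y0) with hn0
  set n1 := Cv * (g1 + y2 + y1) with hn1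
  set n2 := Cv * (p * u2 + y3 + y2) with hn2
  have pu2 : 0 ≤ u2 := by positivity
  have pu3 : 0 ≤ u3 := by positivity
  have pg0 : 0 ≤ g0 := by positivity
  have pg1 : 0 ≤ g1 := by positivity
  have py1 : 0 ≤ y1 := by positivity
  have py0 : 0 ≤ y0 := by positivity
  have py2 : 0 ≤ y2 := by positivity
  have py3 : 0 ≤ y3 := by positivity
  have pn0 : 0 ≤ n0 := by positivity
  have pn1 : 0 ≤ n1 := by positivity
  have pn2 : 0 ≤ n2 := by positivity
  -- One constant such that `(A₂ - A₁)` applied to `Y`, `Y'` and `Y''` is bounded by `D d`.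
  set D := N * ((g0 + y1 + n0) + (g1 + y2 + n1) + (p * u2 + y3 + n2)) with hD
  have pD : 0 ≤ D := by positivity
  have hDle : ∀ a ∈ ({g0 + y1 + n0, g1 + y2 + n1, p * u2 + y3 + n2} : Set ℝ), N * a ≤ D := by
    have := mul_nonneg hp pu2
    rintro a (rfl | rfl | rfl) <;> refine mul_le_mul_of_nonneg_left ?_ hN <;> linarith
  set L := Cv * (1 + Cb * (Cb * (Ca + 1) + 1) + Cb * (Ca + 1)) with hL
  have pL : 0 < L := by positivity
  clear_value L D n0 n1 n2 y0 y1 y2 y3 g0 g1 u2 u3 τ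
  refine ⟨L * (2 + D) + n1, by positivity, ?_⟩
  intro A₀ A₁ A₂ P f u₀ Z₀ Z₁ Z₂ ζ₀ ζ₁ ζ₂ d ε hA₀ hA₁ hA₂ hP hf h₀ hζ₀ h₁ h10 h₂ h20 hd hAA hε hε1
  obtain ⟨r₁, hr₁, k₁⟩ := h₁.exists_timeAvg_close hT h10 hε
  obtain ⟨r₂, hr₂, k₂⟩ := h₂.exists_timeAvg_close hT h20 hε
  -- The width is chosen after all constants. The bound `T / 64` leaves room for four waiting times
  -- `τ = T / 16` between `2h` and `T - 2h`.
  obtain ⟨h, hh, hh1, hh2, hhT⟩ : ∃ h > 0, h ≤ r₁ ∧ h ≤ r₂ ∧ h ≤ T / 64 :=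
    ⟨min (min r₁ r₂) (T / 64), by positivity, (min_le_left _ _).trans (min_le_left _ _),
      (min_le_left _ _).trans (min_le_right _ _), min_le_right _ _⟩
  let ρ : ContDiffBump (0 : ℝ) := ⟨h / 2, h, by positivity, by linarith⟩
  have hρ : ρ.rOut = h := rfl
  obtain ⟨y1s, y1s', y1e⟩ := k₁ ρ hh1
  obtain ⟨y2s, y2s', y2e⟩ := k₂ ρ hh2
  obtain ⟨c, hc, hcav⟩ := timeAvg_affine ρ u₀ f
  obtain ⟨c', hc', hcav'⟩ := timeAvg_affine ρ (0 : H) f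
  rw [hρ] at y1s y1s' y1e y2s y2s' y2e hc hc'
  set I := Ioo h (T - h) with hI
  have hIo : IsOpen I := isOpen_Ioo
  set e := T - 2 * h with he
  clear_value e
  have hsub {a : ℝ} (ha : 2 * h ≤ a) : Icc a e ⊆ I := fun x hx =>
    ⟨by linarith [hx.1], by linarith [hx.2]⟩
  -- Smoothing on `[t - τ, t]`: one more time derivative is bounded at the price of a time `τ`.
  have step : ∀ (A : V →L[ℝ] V →L[ℝ] ℝ), IsGarding ι A α κ K → ∀ (y : ℝ → V)
      (G G' : ℝ → V →L[ℝ] ℝ) (a g c : ℝ), ContDiff ℝ ∞ y → (∀ t, HasDerivAt G (G' t) t) →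
      SolvesOn ι A y G I → 2 * h ≤ a → (∀ x ∈ Icc a e, ‖G x‖ ≤ g) → (∀ x ∈ Icc a e, ‖G' x‖ ≤ g) →
      (∀ x ∈ Icc a e, ‖ι (y x)‖ ≤ c) → ∀ t ∈ Icc (a + τ) e, ‖ι (deriv y t)‖ ≤ Cb * (c + g) := by
    intro A hA y G G' a g c hy hG hs hah hg hg' hc t ht
    have hsub' : Icc (t - τ) (t - τ + τ) ⊆ Icc a e := fun x hx =>
      ⟨by linarith [hx.1, ht.1], by linarith [hx.2, ht.2]⟩
    have := hb A hA y G G' I (t - τ) g hIo hy hG hs (hsub'.trans (hsub hah))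
      (fun x hx => hg x (hsub' hx)) (fun x hx => hg' x (hsub' hx))
    rw [sub_add_cancel] at this
    refine this.trans ?_
    have := hc (t - τ) ⟨by linarith [ht.1], by linarith [ht.2]⟩
    gcongr
  have energy : ∀ (A : V →L[ℝ] V →L[ℝ] ℝ), IsGarding ι A α κ K → ∀ (y : ℝ → V)
      (G : ℝ → V →L[ℝ] ℝ) (g c : ℝ), ContDiff ℝ ∞ y → SolvesOn ι A y G I →
      (∀ x ∈ Icc (2 * h) e, ‖G x‖ ≤ g) → ‖ι (y (2 * h))‖ ≤ c →
      ∀ t ∈ Icc (2 * h) e, ‖ι (y t)‖ ≤ Ca * (c + g) := by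
    intro A hA y G g c hy hs hg hc t ht
    refine (ha A hA y G I (2 * h) t g hy hs
      ((Icc_subset_Icc_right ht.2).trans (hsub le_rfl)) ht.1 (by linarith [ht.2])
      fun x hx => hg x ⟨hx.1, hx.2.trans ht.2⟩).trans ?_
    gcongr
  have smooth {y : ℝ → V} (hy : ContDiff ℝ ∞ y) : ContDiff ℝ ∞ (deriv y) ∧
      ∀ t, HasDerivAt y (deriv y t) t :=
    ⟨(contDiff_infty_iff_deriv.1 hy).2, fun t => (hy.differentiable (by simp) t).hasDerivAt⟩
  have hload (x : H) {r : ℝ} (hx : ‖x‖ ≤ r) : ‖loadFunctional ι x‖ ≤ r :=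
    (norm_loadFunctional_le hι x).trans hx
  -- the observed solution
  set U := timeAvg ρ Z₀ with hU
  have cU : ContDiff ℝ ∞ U := contDiff_timeAvg ρ h₀.continuous_primitive
  obtain ⟨cU1, dU⟩ := smooth cU
  obtain ⟨cU2, dU1⟩ := smooth cU1
  obtain ⟨cU3, dU2⟩ := smooth cU2
  have sU : SolvesOn ι A₀ U (fun t => loadFunctional ι (u₀ + (t - c) • f)) I := by
    have := h₀.solvesOn_timeAvg ρ
    simpa only [hcav] using this
  have sU1 : SolvesOn ι A₀ (deriv U) (fun _ => loadFunctional ι f) I := by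
    refine sU.deriv hIo cU fun t => ?_
    have := ((((hasDerivAt_id t).sub_const c).smul_const f).const_add u₀)
    rw [one_smul] at this
    exact (loadFunctional ι).hasFDerivAt.comp_hasDerivAt t this
  -- The integrated load is affine in time, so nothing is left of it after two derivatives.
  have sU2 : SolvesOn ι A₀ (deriv (deriv U)) (fun _ => 0) I :=
    sU1.deriv hIo cU1 fun t => hasDerivAt_const t _
  have bU0 : ∀ t ∈ Icc (2 * h) e, ‖ι (U t)‖ ≤ m * T := fun t ht =>
    h₀.norm_map_timeAvg_le ρ hζ₀ (hsub le_rfl ht)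
  have bU1 : ∀ t ∈ Icc (2 * h) e, ‖ι (deriv U t)‖ ≤ m := fun t ht =>
    h₀.norm_map_deriv_timeAvg_le ρ hζ₀ (hsub le_rfl ht)
  have bU2 : ∀ t ∈ Icc (2 * h + τ) e, ‖ι (deriv (deriv U) t)‖ ≤ u2 :=
    fun t ht => (step A₀ hA₀ (deriv U) _ (fun _ => 0) (2 * h) m m cU1 (fun t => hasDerivAt_const t _) sU1 le_rfl
      (fun _ _ => hload f hf) (fun _ _ => by simpa using hm) bU1 t ht).trans hu2.ge
  have bU3 : ∀ t ∈ Icc (2 * h + τ + τ) e, ‖ι (deriv (deriv (deriv U)) t)‖ ≤ u3 :=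
    fun t ht => (step A₀ hA₀ (deriv (deriv U)) _ (fun _ => 0) (2 * h + τ) 0 u2 cU2
      (fun t => hasDerivAt_const t _) sU2
      (by linarith) (fun _ _ => by simp) (fun _ _ => by simp) bU2 t ht).trans hu3.ge
  -- the right-hand side of the assimilation equation
  set R : ℝ → H := fun t => (t - c') • f + P (ι (U t)) with hR
  set R1 : ℝ → H := fun t => f + P (ι (deriv U t)) with hR1
  set R2 : ℝ → H := fun t => P (ι (deriv (deriv U) t)) with hR2
  set R3 : ℝ → H := fun t => P (ι (deriv (deriv (deriv U)) t)) with hR3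
  have dR : ∀ t, HasDerivAt R (R1 t) t := fun t => by
    have a1 := ((hasDerivAt_id t).sub_const c').smul_const f
    rw [one_smul] at a1
    exact a1.add ((P.comp ι).hasFDerivAt.comp_hasDerivAt t (dU t))
  have dR1 : ∀ t, HasDerivAt R1 (R2 t) t := fun t =>
    ((P.comp ι).hasFDerivAt.comp_hasDerivAt t (dU1 t)).const_add f
  have dR2 : ∀ t, HasDerivAt R2 (R3 t) t := fun t =>
    ((P.comp ι).hasFDerivAt.comp_hasDerivAt t (dU2 t))
  have dl {r r' : ℝ → H} (hr : ∀ t, HasDerivAt r (r' t) t) :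
      ∀ t, HasDerivAt (fun t => loadFunctional ι (r t)) (loadFunctional ι (r' t)) t := fun t =>
    (loadFunctional ι).hasFDerivAt.comp_hasDerivAt t (hr t)
  have bR : ∀ t ∈ Icc (2 * h) e, ‖R t‖ ≤ g0 := fun t ht => by
    have h1 : ‖(t - c') • f‖ ≤ 2 * T * m := by
      rw [norm_smul, Real.norm_eq_abs]
      have : |t - c'| ≤ 2 * T := by
        rw [abs_le] at hc' ⊢
        constructor <;> linarith [ht.1, ht.2]
      gcongr
    exact (norm_add_le _ _).trans (add_le_add h1 ((hP _).trans
      (mul_le_mul_of_nonneg_left (bU0 t ht) hp))) |>.trans hg0.ge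
  have bR1 : ∀ t ∈ Icc (2 * h) e, ‖R1 t‖ ≤ g1 := fun t ht =>
    (norm_add_le _ _).trans (add_le_add hf ((hP _).trans
      (mul_le_mul_of_nonneg_left (bU1 t ht) hp))) |>.trans hg1.ge
  have bR2 : ∀ t ∈ Icc (2 * h + τ) e, ‖R2 t‖ ≤ p * u2 := fun t ht =>
    (hP _).trans (mul_le_mul_of_nonneg_left (bU2 t ht) hp)
  have bR3 : ∀ t ∈ Icc (2 * h + τ + τ) e, ‖R3 t‖ ≤ p * u3 := fun t ht =>
    (hP _).trans (mul_le_mul_of_nonneg_left (bU3 t ht) hp)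
  have solves {A : V →L[ℝ] V →L[ℝ] ℝ} {Z : ℝ → V} {ζ : ℝ → H}
      (hZ : IntegratedSolution ι A T Z ζ (fun t => t • f + P (ι (Z₀ t)))) :
      SolvesOn ι A (timeAvg ρ Z) (fun t => loadFunctional ι (R t)) I := by
    have h1 := hZ.solvesOn_timeAvg ρ
    have h2 (t : ℝ) : timeAvg ρ (fun t => t • f + P (ι (Z₀ t))) t = R t := by
      have c1 : Continuous fun t => P (ι (Z₀ t)) :=
        (P.comp ι).continuous.comp h₀.continuous_primitive
      rw [timeAvg_add ρ (by fun_prop) c1]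
      have h3 := hcav' t
      simp only [zero_add] at h3
      rw [h3]
      exact congrArg _ (map_timeAvg ρ h₀.continuous_primitive (P.comp ι) t).symm
    simpa only [h2] using h1
  -- the second assimilated solution
  set Y := timeAvg ρ Z₂ with hY
  have cY : ContDiff ℝ ∞ Y := contDiff_timeAvg ρ h₂.continuous_primitive
  obtain ⟨cY1, dY⟩ := smooth cY
  obtain ⟨cY2, dY1⟩ := smooth cY1
  obtain ⟨cY3, dY2⟩ := smooth cY2
  have sY := solves h₂
  have sY1 := sY.deriv hIo cY (dl dR)
  have sY2 := sY1.deriv hIo cY1 (dl dR1)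
  have bY1 : ∀ t ∈ Icc (2 * h) e, ‖ι (deriv Y t)‖ ≤ y1 :=
    fun t ht => (energy A₂ hA₂ (deriv Y) _ g1 1 cY1 sY1 (fun x hx => hload _ (bR1 x hx)) (y2s'.trans hε1) t ht).trans hy1.ge
  have bY0 : ∀ t ∈ Icc (2 * h) e, ‖ι (Y t)‖ ≤ y0 :=
    fun t ht => (energy A₂ hA₂ Y _ g0 1 cY sY (fun x hx => hload _ (bR x hx)) (y2s.trans hε1) t ht).trans hy0.ge
  have m1 {a t : ℝ} (ha : 0 ≤ a) (ht : t ∈ Icc (2 * h + a) e) : t ∈ Icc (2 * h) e :=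
    ⟨by linarith [ht.1], ht.2⟩
  have m2 {b t : ℝ} (ht : t ∈ Icc (b + τ) e) : t ∈ Icc b e := ⟨by linarith [ht.1], ht.2⟩
  -- The load of `Y'` has derivative `R2`, which is bounded only from `2h + τ` on; the waiting time
  -- therefore starts there. The same delay recurs in `bY3`, `bW1` and `bW2`.
  have bY2 : ∀ t ∈ Icc (2 * h + τ + τ) e, ‖ι (deriv (deriv Y) t)‖ ≤ y2 :=
    fun t ht => (step A₂ hA₂ (deriv Y) _ _ (2 * h + τ) (g1 + p * u2) y1 cY1 (dl dR1) sY1 (by linarith)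
      (fun x hx => (hload _ (bR1 x (m2 hx))).trans (le_add_of_nonneg_right (by positivity)))
      (fun x hx => (hload _ (bR2 x hx)).trans (le_add_of_nonneg_left (by positivity)))
      (fun x hx => bY1 x (m2 hx)) t ht).trans (by rw [hy2])
  have bY3 : ∀ t ∈ Icc (2 * h + τ + τ + τ) e, ‖ι (deriv (deriv (deriv Y)) t)‖ ≤ y3 :=
    fun t ht => (step A₂ hA₂ (deriv (deriv Y)) _ _ (2 * h + τ + τ) (p * u2 + p * u3) y2 cY2 (dl dR2) sY2
      (by linarith)
      (fun x hx => (hload _ (bR2 x (m2 hx))).trans (le_add_of_nonneg_right (by positivity)))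
      (fun x hx => (hload _ (bR3 x hx)).trans (le_add_of_nonneg_left (by positivity)))
      bY2 t ht).trans hy3.ge
  have form {y : ℝ → V} {r : ℝ → H} {t a b b' : ℝ}
      (hs : SolvesOn ι A₂ y (fun t => loadFunctional ι (r t)) I) (ht : t ∈ Icc (2 * h) e)
      (ha : ‖r t‖ ≤ a) (hb : ‖ι (deriv y t)‖ ≤ b) (hb' : ‖ι (y t)‖ ≤ b') :
      ‖y t‖ ≤ Cv * (a + b + b') ∧
      ∀ φ, |(A₂ - A₁) (y t) φ| ≤ N * (a + b + Cv * (a + b + b')) * d * ‖φ‖ := by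
    have h1 : ‖y t‖ ≤ Cv * (a + b + b') := by
      refine (hv A₂ hA₂ y _ I t hs (hsub le_rfl ht)).trans ?_
      have := hload (r t) ha
      gcongr
    -- At a fixed time the equation says that `y t` solves the stationary problem with load `r t - ι
    -- y'`, which is what the hypothesis on `A₂ - A₁` asks for.
    refine ⟨h1, fun φ => (hAA (y t) (r t - ι (deriv y t)) (fun φ => ?_) φ).trans ?_⟩
    · have := hs t (hsub le_rfl ht) φ
      rw [loadFunctional_apply] at this
      rw [inner_sub_left]
      linarith
    · have h2 : ‖r t - ι (deriv y t)‖ ≤ a + b := (norm_sub_le _ _).trans (add_le_add ha hb)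
      gcongr
  have bG {y : V} {a : ℝ} (haD : N * a ≤ D) (hφ : ∀ φ, |(A₂ - A₁) y φ| ≤ N * a * d * ‖φ‖) :
      ‖(A₂ - A₁) y‖ ≤ D * d :=
    ContinuousLinearMap.opNorm_le_bound _ (by positivity) fun φ => (hφ φ).trans (by gcongr)
  have G0 : ∀ t ∈ Icc (2 * h) e, ‖(A₂ - A₁) (Y t)‖ ≤ D * d := fun t ht =>
    bG (hDle (g0 + y1 + n0) (by simp))
      (hn0 ▸ form sY ht (bR t ht) (bY1 t ht) (bY0 t ht)).2
  have G1 : ∀ t ∈ Icc (2 * h + τ + τ) e, ‖(A₂ - A₁) (deriv Y t)‖ ≤ D * d := fun t ht =>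
    bG (hDle (g1 + y2 + n1) (by simp))
      (hn1 ▸ form sY1 (m2 (m2 ht)) (bR1 t (m2 (m2 ht))) (bY2 t ht) (bY1 t (m2 (m2 ht)))).2
  have G2 : ∀ t ∈ Icc (2 * h + τ + τ + τ) e, ‖(A₂ - A₁) (deriv (deriv Y) t)‖ ≤ D * d := fun t ht =>
    bG (hDle (p * u2 + y3 + n2) (by simp))
      (hn2 ▸ form sY2 (m2 (m2 (m2 ht))) (bR2 t (m2 (m2 ht))) (bY3 t ht) (bY2 t (m2 ht))).2
  -- the difference
  have cY' : ContDiff ℝ ∞ (timeAvg ρ Z₁) := contDiff_timeAvg ρ h₁.continuous_primitive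
  obtain ⟨cY1', dY'⟩ := smooth cY'
  set W : ℝ → V := fun t => timeAvg ρ Z₁ t - Y t with hW
  have cW : ContDiff ℝ ∞ W := cY'.sub cY
  obtain ⟨cW1, dW⟩ := smooth cW
  obtain ⟨cW2, dW1⟩ := smooth cW1
  have eW1 (t : ℝ) : deriv W t = deriv (timeAvg ρ Z₁) t - deriv Y t :=
    ((dY' t).sub (dY t)).deriv
  have sW : SolvesOn ι A₁ W (fun t => (A₂ - A₁) (Y t)) I := by
    intro t ht φ
    have s1 := solves h₁ t ht φ
    have s2 := sY t ht φ
    rw [eW1]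
    simp only [hW, map_sub, inner_sub_left, _root_.sub_apply]
    linarith
  have dG {y y' : ℝ → V} (hy : ∀ t, HasDerivAt y (y' t) t) :
      ∀ t, HasDerivAt (fun t => (A₂ - A₁) (y t)) ((A₂ - A₁) (y' t)) t := fun t =>
    (A₂ - A₁).hasFDerivAt.comp_hasDerivAt t (hy t)
  have sW1 := sW.deriv hIo cW (dG dY)
  have bWs : ‖ι (W (2 * h))‖ ≤ 2 * ε := by
    simp only [hW, map_sub]
    exact (norm_sub_le _ _).trans (by linarith)
  set X := 2 * ε + D * d with hX
  have pX : 0 ≤ X := by positivity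
  have hDX : D * d ≤ X := by linarith
  have bW0 : ∀ t ∈ Icc (2 * h) e, ‖ι (W t)‖ ≤ Ca * X :=
    energy A₁ hA₁ W _ (D * d) (2 * ε) cW sW G0 bWs
  have bW1 : ∀ t ∈ Icc (2 * h + τ + τ + τ) e, ‖ι (deriv W t)‖ ≤ Cb * (Ca * X + X) :=
    step A₁ hA₁ W _ _ (2 * h + τ + τ) X (Ca * X) cW (dG dY) sW (by linarith)
      (fun x hx => (G0 x (m2 (m2 hx))).trans hDX) (fun x hx => (G1 x hx).trans hDX)
      (fun x hx => bW0 x (m2 (m2 hx)))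
  have bW2 : ∀ t ∈ Icc (2 * h + τ + τ + τ + τ) e,
      ‖ι (deriv (deriv W) t)‖ ≤ Cb * (Cb * (Ca * X + X) + X) :=
    step A₁ hA₁ (deriv W) _ _ (2 * h + τ + τ + τ) X _ cW1 (dG dY1) sW1 (by linarith)
      (fun x hx => (G1 x (m2 hx)).trans hDX) (fun x hx => (G2 x hx).trans hDX) bW1
  -- At `e = T - 2h` all four waiting times have elapsed.
  have hee : e ∈ Icc (2 * h + τ + τ + τ + τ) e := ⟨by linarith, le_rfl⟩
  refine ⟨deriv W e, deriv Y e, ?_, ?_, ?_, ?_⟩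
  · have h1 := hv A₁ hA₁ (deriv W) _ I e sW1 (hsub le_rfl (m2 (m2 (m2 (m2 hee)))))
    have h2 := (G1 e (m2 (m2 hee))).trans hDX
    have h3 := bW1 e (m2 hee)
    have h4 := bW2 e hee
    calc ‖deriv W e‖ ≤ Cv * (X + Cb * (Cb * (Ca * X + X) + X) + Cb * (Ca * X + X)) := by
          refine h1.trans ?_
          gcongr
      _ = L * X := by rw [hL]; ring
      _ ≤ (L * (2 + D) + n1) * (d + ε) := by
          have q1 : 2 * ε + D * d ≤ (2 + D) * (d + ε) := by
            have := mul_nonneg pD hε.le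
            linarith
          have q3 := mul_nonneg pn1 (add_nonneg hd hε.le)
          rw [hX, add_mul, mul_assoc]
          exact (mul_le_mul_of_nonneg_left q1 pL.le).trans (le_add_of_nonneg_right q3)
  · refine (form sY1 (m2 (m2 (m2 (m2 hee)))) (bR1 e (m2 (m2 (m2 (m2 hee))))) (bY2 e (m2 (m2 hee)))
      (bY1 e (m2 (m2 (m2 (m2 hee)))))).1.trans ?_
    rw [← hn1]
    exact le_add_of_nonneg_left (by positivity)
  · rw [eW1, map_sub, sub_sub_sub_comm]
    exact (norm_sub_le _ _).trans (by rw [two_mul]; exact add_le_add y1e y2e)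
  · exact y2e

/-- Lipschitz dependence on the form of the final value of the assimilated solution, in `V`. -/
theorem exists_lipschitz_bound (ι : V →L[ℝ] H) (hι : ∀ v, ‖ι v‖ ≤ ‖v‖) {α κ : ℝ} (hα : 0 < α)
    (hκ : 0 ≤ κ) (K : ℝ) {p m N T : ℝ} (hp : 0 ≤ p) (hm : 0 ≤ m) (hN : 0 ≤ N) (hT : 0 < T) :
    ∃ C, 0 < C ∧ ∀ (A₀ A₁ A₂ : V →L[ℝ] V →L[ℝ] ℝ) (P : H →L[ℝ] H) (f u₀ : H)
      (Z₀ Z₁ Z₂ : ℝ → V) (ζ₀ ζ₁ ζ₂ : ℝ → H) (d : ℝ),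
      IsGarding ι A₀ α κ K → IsGarding ι A₁ α κ K → IsGarding ι A₂ α κ K →
      (∀ h, ‖P h‖ ≤ p * ‖h‖) → ‖f‖ ≤ m →
      IntegratedSolution ι A₀ T Z₀ ζ₀ (fun t => u₀ + t • f) → (∀ t, ‖ζ₀ t‖ ≤ m) →
      IntegratedSolution ι A₁ T Z₁ ζ₁ (fun t => t • f + P (ι (Z₀ t))) → ζ₁ 0 = 0 →
      IntegratedSolution ι A₂ T Z₂ ζ₂ (fun t => t • f + P (ι (Z₀ t))) → ζ₂ 0 = 0 →
      0 ≤ d →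
      (∀ y g, (∀ φ, A₂ y φ = inner ℝ g (ι φ)) →
        ∀ φ, |(A₂ - A₁) y φ| ≤ N * (‖g‖ + ‖y‖) * d * ‖φ‖) →
      ∃ w v : V, ι w = ζ₁ T - ζ₂ T ∧ ‖w‖ ≤ C * d ∧ ι v = ζ₂ T ∧ ‖v‖ ≤ C := by
  obtain ⟨C, hC, h⟩ := exists_regularized_bound ι hι hα hκ K hp hm hN hT
  refine ⟨C, hC, ?_⟩
  intro A₀ A₁ A₂ P f u₀ Z₀ Z₁ Z₂ ζ₀ ζ₁ ζ₂ d hA₀ hA₁ hA₂ hP hf h₀ hζ₀ h₁ h10 h₂ h20 hd hAA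
  have key (ε : ℝ) (hε : 0 < ε) : ∃ w v : V, ‖w‖ ≤ C * d + ε ∧ ‖v‖ ≤ C + ε ∧
      ‖ι w - (ζ₁ T - ζ₂ T)‖ ≤ ε ∧ ‖ι v - ζ₂ T‖ ≤ ε := by
    -- Small enough that both `2ε'` and `C ε'` are at most `ε`.
    set ε' := min 1 (min (ε / 2) (ε / C)) with hε'
    have p0 : 0 < ε' := by positivity
    have p1 : ε' ≤ ε / 2 := (min_le_right _ _).trans (min_le_left _ _)
    have p2 : C * ε' ≤ ε := by
      rw [mul_comm, ← le_div_iff₀ hC]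
      exact (min_le_right _ _).trans (min_le_right _ _)
    obtain ⟨w, v, a1, a2, a3, a4⟩ := h A₀ A₁ A₂ P f u₀ Z₀ Z₁ Z₂ ζ₀ ζ₁ ζ₂ d ε' hA₀ hA₁ hA₂ hP hf h₀
      hζ₀ h₁ h10 h₂ h20 hd hAA p0 (min_le_left _ _)
    exact ⟨w, v, by linarith, by linarith, by linarith, by linarith⟩
  obtain ⟨w, hw, hwC⟩ := exists_preimage_of_approx ι (c := C * d) (v := ζ₁ T - ζ₂ T) fun ε hε => by
    obtain ⟨w, v, a1, a2, a3, a4⟩ := key ε hε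
    exact ⟨w, a1, a3⟩
  obtain ⟨v, hv, hvC⟩ := exists_preimage_of_approx ι (c := C) (v := ζ₂ T) fun ε hε => by
    obtain ⟨w, v, a1, a2, a3, a4⟩ := key ε hε
    exact ⟨v, a2, a4⟩
  exact ⟨w, v, hw, hwC, hv, hvC⟩

end LipschitzDependence

/-! ### The real-valued `L²` norm and Cauchy–Schwarz -/

section L2Norm

variable {X E F G : Type*} [MeasurableSpace X] {μ : Measure X} [NormedAddCommGroup E]
  [NormedAddCommGroup F] [NormedAddCommGroup G]

/-- The `L²` norm as a real number. -/
def l2n (μ : Measure X) (f : X → E) : ℝ := (eLpNorm f 2 μ).toReal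

theorem l2n_nonneg (f : X → E) : 0 ≤ l2n μ f := ENNReal.toReal_nonneg

theorem norm_eq_l2n (p : Lp E 2 μ) : ‖p‖ = l2n μ p := Lp.norm_def p

theorem l2n_congr {f : X → E} {g : X → E} (h : f =ᵐ[μ] g) : l2n μ f = l2n μ g := by
  rw [l2n, eLpNorm_congr_ae h, l2n]

theorem norm_toLp_eq_l2n {f : X → E} (hf : MemLp f 2 μ) : ‖hf.toLp f‖ = l2n μ f := Lp.norm_toLp f hf

theorem l2n_mono {f : X → E} {g : X → F} (hg : MemLp g 2 μ) (h : ∀ᵐ x ∂μ, ‖f x‖ ≤ ‖g x‖) :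
    l2n μ f ≤ l2n μ g :=
  ENNReal.toReal_mono hg.eLpNorm_ne_top (eLpNorm_mono_ae h)

theorem l2n_add_le {f g : X → E} (hf : MemLp f 2 μ) (hg : MemLp g 2 μ) :
    l2n μ (fun x => f x + g x) ≤ l2n μ f + l2n μ g := by
  rw [l2n, l2n, l2n, ← ENNReal.toReal_add hf.eLpNorm_ne_top hg.eLpNorm_ne_top]
  exact ENNReal.toReal_mono (ENNReal.add_ne_top.2 ⟨hf.eLpNorm_ne_top, hg.eLpNorm_ne_top⟩)
    (eLpNorm_add_le hf.1 hg.1 (by norm_num))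

theorem l2n_const_smul [NormedSpace ℝ E] (c : ℝ) (f : X → E) :
    l2n μ (fun x => c • f x) = |c| * l2n μ f := by
  have : (fun x => c • f x) = c • f := rfl
  rw [l2n, this, eLpNorm_const_smul, ENNReal.toReal_mul, l2n]
  simp

theorem l2n_norm (f : X → E) : l2n μ (fun x => ‖f x‖) = l2n μ f := by
  rw [l2n, eLpNorm_norm, l2n]

theorem integral_norm_mul_norm_le {f : X → E} {g : X → F} (hf : MemLp f 2 μ) (hg : MemLp g 2 μ) :
    ∫ x, ‖f x‖ * ‖g x‖ ∂μ ≤ l2n μ f * l2n μ g := by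
  have h := abs_real_inner_le_norm (hf.norm.toLp _) (hg.norm.toLp _)
  rw [norm_toLp_eq_l2n, norm_toLp_eq_l2n, l2n_norm, l2n_norm, L2.inner_def] at h
  refine (le_of_eq ?_).trans ((le_abs_self _).trans h)
  refine integral_congr_ae ?_
  filter_upwards [hf.norm.coeFn_toLp, hg.norm.coeFn_toLp] with x h1 h2
  rw [h1, h2]
  simp [mul_comm]

theorem integrable_norm_mul_norm {f : X → E} {g : X → F} (hf : MemLp f 2 μ) (hg : MemLp g 2 μ) :
    Integrable (fun x => ‖f x‖ * ‖g x‖) μ := hf.norm.integrable_mul hg.norm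

theorem integrable_inner_of_memLp {E : Type*} [NormedAddCommGroup E] [InnerProductSpace ℝ E]
    {f g : X → E} (hf : MemLp f 2 μ) (hg : MemLp g 2 μ) :
    Integrable (fun x => inner ℝ (f x) (g x)) μ :=
  (integrable_norm_mul_norm hf hg).mono' (hf.1.inner hg.1) (.of_forall fun _ => norm_inner_le_norm _ _)

/-- Cauchy–Schwarz for any integrand bounded by a product. -/
theorem norm_integral_le_l2n [NormedSpace ℝ G] {f : X → E} {g : X → F} {h : X → G}
    (hf : MemLp f 2 μ) (hg : MemLp g 2 μ) (hh : ∀ᵐ x ∂μ, ‖h x‖ ≤ ‖f x‖ * ‖g x‖) :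
    ‖∫ x, h x ∂μ‖ ≤ l2n μ f * l2n μ g :=
  (norm_integral_le_of_norm_le (integrable_norm_mul_norm hf hg) hh).trans
    (integral_norm_mul_norm_le hf hg)

theorem abs_integral_le_l2n {f : X → E} {g : X → F} {h : X → ℝ}
    (hf : MemLp f 2 μ) (hg : MemLp g 2 μ) (hh : ∀ᵐ x ∂μ, |h x| ≤ ‖f x‖ * ‖g x‖) :
    |∫ x, h x ∂μ| ≤ l2n μ f * l2n μ g := by
  rw [← Real.norm_eq_abs]
  exact norm_integral_le_l2n hf hg hh

theorem l2n_sq {f : X → E} (hf : MemLp f 2 μ) : l2n μ f ^ 2 = ∫ x, ‖f x‖ ^ 2 ∂μ := by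
  have h := real_inner_self_eq_norm_sq (hf.norm.toLp _)
  rw [norm_toLp_eq_l2n, l2n_norm, L2.inner_def] at h
  rw [← h]
  refine integral_congr_ae ?_
  filter_upwards [hf.norm.coeFn_toLp] with x h1
  rw [h1]
  simp

theorem tendsto_l2n_iff {ι : Type*} {l : Filter ι} {f : ι → X → E} (hf : ∀ i, MemLp (f i) 2 μ) :
    Filter.Tendsto (fun i => l2n μ (f i)) l (nhds 0) ↔
      Filter.Tendsto (fun i => eLpNorm (f i) 2 μ) l (nhds 0) := by
  rw [← ENNReal.tendsto_toReal_iff (fun i => (hf i).eLpNorm_ne_top) (by simp)]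
  rfl

end L2Norm

/-! ### Functions with weak gradients and integration by parts -/

section WeakPair

variable {Ω : Set Plane}

/-- `f` and `g` represent an element of the space `S` of pairs (function, gradient). -/
def WeakPair (S : Submodule ℝ (GradPair Ω)) (f : Plane → ℝ) (g : Plane → Plane) : Prop :=
  ∃ p ∈ S, p.fst =ᵐ[volume.restrict Ω] f ∧ p.snd =ᵐ[volume.restrict Ω] g

/-- The pair represented by two square integrable functions. -/
def mkPair {f : Plane → ℝ} {g : Plane → Plane} (hf : MemLp f 2 (volume.restrict Ω))
    (hg : MemLp g 2 (volume.restrict Ω)) : GradPair Ω :=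
  WithLp.toLp 2 (hf.toLp f, hg.toLp g)

theorem mkPair_fst {f : Plane → ℝ} {g : Plane → Plane} (hf : MemLp f 2 (volume.restrict Ω))
    (hg : MemLp g 2 (volume.restrict Ω)) : (mkPair hf hg).fst =ᵐ[volume.restrict Ω] f :=
  hf.coeFn_toLp

theorem mkPair_snd {f : Plane → ℝ} {g : Plane → Plane} (hf : MemLp f 2 (volume.restrict Ω))
    (hg : MemLp g 2 (volume.restrict Ω)) : (mkPair hf hg).snd =ᵐ[volume.restrict Ω] g :=
  hg.coeFn_toLp

theorem gradPair_ext {p r : GradPair Ω} (h1 : p.fst =ᵐ[volume.restrict Ω] r.fst)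
    (h2 : p.snd =ᵐ[volume.restrict Ω] r.snd) : p = r := by
  have e1 : p.fst = r.fst := Lp.ext h1
  have e2 : p.snd = r.snd := Lp.ext h2
  cases p; cases r
  simp_all [Prod.ext_iff]

variable {S : Submodule ℝ (GradPair Ω)} {f : Plane → ℝ} {g : Plane → Plane}

theorem WeakPair.memLp_fst (h : WeakPair S f g) : MemLp f 2 (volume.restrict Ω) := by
  obtain ⟨p, -, hp, -⟩ := h
  exact (Lp.memLp p.fst).ae_eq hp

theorem WeakPair.memLp_snd (h : WeakPair S f g) : MemLp g 2 (volume.restrict Ω) := by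
  obtain ⟨p, -, -, hp⟩ := h
  exact (Lp.memLp p.snd).ae_eq hp

theorem weakPair_iff (hf : MemLp f 2 (volume.restrict Ω)) (hg : MemLp g 2 (volume.restrict Ω)) :
    WeakPair S f g ↔ mkPair hf hg ∈ S := by
  constructor
  · rintro ⟨p, hp, h1, h2⟩
    have : p = mkPair hf hg := gradPair_ext (h1.trans (mkPair_fst hf hg).symm)
      (h2.trans (mkPair_snd hf hg).symm)
    rwa [← this]
  · intro h
    exact ⟨_, h, mkPair_fst hf hg, mkPair_snd hf hg⟩

theorem WeakPair.of_tendsto (hS : IsClosed (S : Set (GradPair Ω))) {fn : ℕ → Plane → ℝ}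
    {gn : ℕ → Plane → Plane} (h : ∀ n, WeakPair S (fn n) (gn n))
    (hf : MemLp f 2 (volume.restrict Ω)) (hg : MemLp g 2 (volume.restrict Ω))
    (h1 : Filter.Tendsto (fun n => eLpNorm (fun x => fn n x - f x) 2 (volume.restrict Ω))
      Filter.atTop (nhds 0))
    (h2 : Filter.Tendsto (fun n => eLpNorm (fun x => gn n x - g x) 2 (volume.restrict Ω))
      Filter.atTop (nhds 0)) : WeakPair S f g := by
  rw [weakPair_iff hf hg]
  refine hS.mem_of_tendsto (f := fun n => mkPair (h n).memLp_fst (h n).memLp_snd) (b := Filter.atTop)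
    ?_ (.of_forall fun n => (weakPair_iff _ _).1 (h n))
  refine (WithLp.prod_continuous_toLp 2 (L2 Ω) (L2Vec Ω)).continuousAt.tendsto.comp
    (Filter.Tendsto.prodMk_nhds ?_ ?_)
  · exact (Lp.tendsto_Lp_iff_tendsto_eLpNorm'' _ (fun n => (h n).memLp_fst) _ hf).2 h1
  · exact (Lp.tendsto_Lp_iff_tendsto_eLpNorm'' _ (fun n => (h n).memLp_snd) _ hg).2 h2

theorem isClosed_H10 : IsClosed (H10 Ω : Set (GradPair Ω)) :=
  Submodule.isClosed_topologicalClosure _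

theorem real_inner_gradient (φ : Plane → ℝ) (x v : Plane) :
    inner ℝ (∇ φ x) v = fderiv ℝ φ x v := by
  simp [gradient]

theorem gradient_eq_of_forall {φ : Plane → ℝ} {x w : Plane} (h : ∀ v, fderiv ℝ φ x v = inner ℝ w v) :
    ∇ φ x = w :=
  ext_inner_right ℝ fun v => by rw [real_inner_gradient, h]

theorem IsTestFunction.differentiableAt {φ : Plane → ℝ} (h : IsTestFunction Ω φ) (x : Plane) :
    DifferentiableAt ℝ φ x := h.1.differentiable (by simp) x

theorem IsTestFunction.add {φ ψ : Plane → ℝ} (hφ : IsTestFunction Ω φ) (hψ : IsTestFunction Ω ψ) :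
    IsTestFunction Ω (φ + ψ) :=
  ⟨hφ.1.add hψ.1, hφ.2.1.add hψ.2.1,
    (closure_mono (Function.support_add φ ψ)).trans (by
      rw [closure_union]; exact union_subset hφ.2.2 hψ.2.2)⟩

theorem IsTestFunction.smul {φ : Plane → ℝ} (hφ : IsTestFunction Ω φ) (c : ℝ) :
    IsTestFunction Ω (c • φ) :=
  ⟨hφ.1.const_smul c, hφ.2.1.smul_left (f := fun _ => c),
    (closure_mono (Function.support_const_smul_subset c φ)).trans hφ.2.2⟩

theorem isTestFunction_zero : IsTestFunction Ω 0 :=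
  ⟨contDiff_const, HasCompactSupport.zero, by simp [tsupport]⟩

theorem IsTestFunction.weakPair {φ : Plane → ℝ} (h : IsTestFunction Ω φ) :
    WeakPair (H10 Ω) φ (∇ φ) :=
  ⟨mkPair h.memLp h.memLp_gradient, Submodule.le_topologicalClosure _ (Submodule.subset_span
    ⟨φ, h, mkPair_fst _ _, mkPair_snd _ _⟩), mkPair_fst _ _, mkPair_snd _ _⟩

/-- Elements of `H¹₀` are limits of test functions, in the norm and almost everywhere. -/
theorem exists_test_seq {p : GradPair Ω} (hp : p ∈ H10 Ω) : ∃ φ : ℕ → Plane → ℝ,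
    (∀ n, IsTestFunction Ω (φ n)) ∧
    Filter.Tendsto (fun n => eLpNorm (fun x => φ n x - p.fst x) 2 (volume.restrict Ω))
      Filter.atTop (nhds 0) ∧
    Filter.Tendsto (fun n => eLpNorm (fun x => ∇ (φ n) x - p.snd x) 2 (volume.restrict Ω))
      Filter.atTop (nhds 0) ∧
    (∀ᵐ x ∂volume.restrict Ω, Filter.Tendsto (fun n => φ n x) Filter.atTop (nhds (p.fst x))) ∧
    (∀ᵐ x ∂volume.restrict Ω,
      Filter.Tendsto (fun n => ∇ (φ n) x) Filter.atTop (nhds (p.snd x))) := by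
  obtain ⟨r, hr, hrp⟩ := mem_closure_iff_seq_limit.1
    (show p ∈ closure ((Submodule.span ℝ _ : Submodule ℝ (GradPair Ω)) : Set (GradPair Ω)) from hp)
  -- Test functions already form a linear space, so taking the span adds nothing.
  have hspan : ∀ s ∈ Submodule.span ℝ {p : GradPair Ω | ∃ φ : Plane → ℝ, IsTestFunction Ω φ ∧
      p.fst =ᵐ[volume.restrict Ω] φ ∧ p.snd =ᵐ[volume.restrict Ω] ∇ φ}, ∃ φ : Plane → ℝ,
      IsTestFunction Ω φ ∧ s.fst =ᵐ[volume.restrict Ω] φ ∧ s.snd =ᵐ[volume.restrict Ω] ∇ φ := by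
    intro s hs
    induction hs using Submodule.span_induction with
    | mem x h => exact h
    | zero =>
      refine ⟨0, isTestFunction_zero, Lp.coeFn_zero _ _ _, (Lp.coeFn_zero _ _ _).trans ?_⟩
      refine .of_forall fun x => (gradient_eq_of_forall fun v => ?_).symm
      simp
    | add x y _ _ hx hy =>
      obtain ⟨φ, h1, h2, h3⟩ := hx
      obtain ⟨ψ, k1, k2, k3⟩ := hy
      refine ⟨φ + ψ, h1.add k1, (Lp.coeFn_add _ _).trans (h2.add k2),
        (Lp.coeFn_add _ _).trans ((h3.add k3).trans ?_)⟩
      refine .of_forall fun x => (gradient_eq_of_forall fun v => ?_).symm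
      rw [fderiv_add (h1.differentiableAt x) (k1.differentiableAt x), Pi.add_apply, inner_add_left,
        real_inner_gradient, real_inner_gradient]
      rfl
    | smul a x _ hx =>
      obtain ⟨φ, h1, h2, h3⟩ := hx
      refine ⟨a • φ, h1.smul a, (Lp.coeFn_smul _ _).trans (h2.const_smul a),
        (Lp.coeFn_smul _ _).trans ((h3.const_smul a).trans ?_)⟩
      refine .of_forall fun x => (gradient_eq_of_forall fun v => ?_).symm
      rw [fderiv_const_smul (h1.differentiableAt x), Pi.smul_apply, real_inner_smul_left,
        real_inner_gradient]
      rfl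
  choose φ h1 h2 h3 using fun n => hspan (r n) (hr n)
  have t1 : Filter.Tendsto (fun n => (r n).fst) Filter.atTop (nhds p.fst) :=
    ((continuous_fst.comp (WithLp.prod_continuous_ofLp 2 (L2 Ω) (L2Vec Ω))).tendsto p).comp hrp
  have t2 : Filter.Tendsto (fun n => (r n).snd) Filter.atTop (nhds p.snd) :=
    ((continuous_snd.comp (WithLp.prod_continuous_ofLp 2 (L2 Ω) (L2Vec Ω))).tendsto p).comp hrp
  have e1 : Filter.Tendsto (fun n => eLpNorm (fun x => φ n x - p.fst x) 2 (volume.restrict Ω))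
      Filter.atTop (nhds 0) := by
    refine (Lp.tendsto_Lp_iff_tendsto_eLpNorm' _ _).1 t1 |>.congr fun n => ?_
    exact eLpNorm_congr_ae ((h2 n).sub .rfl)
  have e2 : Filter.Tendsto (fun n => eLpNorm (fun x => ∇ (φ n) x - p.snd x) 2 (volume.restrict Ω))
      Filter.atTop (nhds 0) := by
    refine (Lp.tendsto_Lp_iff_tendsto_eLpNorm' _ _).1 t2 |>.congr fun n => ?_
    exact eLpNorm_congr_ae ((h3 n).sub .rfl)
  -- Convergence almost everywhere along a subsequence, first for the functions and then, along a
  -- further one, for the gradients.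
  obtain ⟨n1, hn1, a1⟩ := (tendstoInMeasure_of_tendsto_eLpNorm (by norm_num)
    (fun n => (h1 n).memLp.1) (Lp.memLp p.fst).1 e1).exists_seq_tendsto_ae
  obtain ⟨n2, hn2, a2⟩ := (tendstoInMeasure_of_tendsto_eLpNorm (by norm_num)
    (fun n => (h1 (n1 n)).memLp_gradient.1) (Lp.memLp p.snd).1
    (e2.comp hn1.tendsto_atTop)).exists_seq_tendsto_ae
  refine ⟨fun n => φ (n1 (n2 n)), fun n => h1 _, e1.comp (hn1.comp hn2).tendsto_atTop,
    e2.comp (hn1.comp hn2).tendsto_atTop, ?_, a2⟩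
  filter_upwards [a1] with x hx using hx.comp hn2.tendsto_atTop

/-- Integration by parts against elements of `H¹₀`. -/
theorem integral_smul_snd_eq_neg {β p : GradPair Ω} (hβ : β ∈ H1 Ω) (hp : p ∈ H10 Ω) :
    ∫ x in Ω, β.fst x • p.snd x = - ∫ x in Ω, p.fst x • β.snd x := by
  obtain ⟨φ, h, e1, e2, -, -⟩ := exists_test_seq hp
  have i1 {f : Plane → ℝ} {g : Plane → Plane} (hf : MemLp f 2 (volume.restrict Ω))
    (hg : MemLp g 2 (volume.restrict Ω)) : Integrable (fun x => f x • g x) (volume.restrict Ω) :=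
    memLp_one_iff_integrable.1 (hg.smul hf)
  have t1 : Filter.Tendsto (fun n => ∫ x in Ω, β.fst x • ∇ (φ n) x) Filter.atTop
      (nhds (∫ x in Ω, β.fst x • p.snd x)) := by
    rw [tendsto_iff_norm_sub_tendsto_zero]
    have := ((tendsto_l2n_iff fun n =>
      (h n).memLp_gradient.sub (Lp.memLp p.snd)).2 e2).const_mul (l2n (volume.restrict Ω) β.fst)
    rw [mul_zero] at this
    refine squeeze_zero (fun _ => norm_nonneg _) (fun n => ?_) this
    rw [← integral_sub (i1 (Lp.memLp _) (h n).memLp_gradient) (i1 (Lp.memLp _) (Lp.memLp _))]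
    refine norm_integral_le_l2n (Lp.memLp _) ((h n).memLp_gradient.sub (Lp.memLp p.snd))
      (.of_forall fun x => ?_)
    rw [← smul_sub, norm_smul]; rfl
  have t2 : Filter.Tendsto (fun n => ∫ x in Ω, φ n x • β.snd x) Filter.atTop
      (nhds (∫ x in Ω, p.fst x • β.snd x)) := by
    rw [tendsto_iff_norm_sub_tendsto_zero]
    have := ((tendsto_l2n_iff fun n =>
      (h n).memLp.sub (Lp.memLp p.fst)).2 e1).mul_const (l2n (volume.restrict Ω) β.snd)
    rw [zero_mul] at this
    refine squeeze_zero (fun _ => norm_nonneg _) (fun n => ?_) this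
    rw [← integral_sub (i1 (h n).memLp (Lp.memLp _)) (i1 (Lp.memLp _) (Lp.memLp _))]
    refine norm_integral_le_l2n ((h n).memLp.sub (Lp.memLp p.fst)) (Lp.memLp _)
      (.of_forall fun x => ?_)
    rw [← sub_smul, norm_smul]; rfl
  refine tendsto_nhds_unique t1 (t2.neg.congr fun n => ?_)
  exact (hβ (φ n) (h n)).symm

theorem memLp_gradient_of_contDiff {g : Plane → ℝ} (h1 : ContDiff ℝ ∞ g)
    (h2 : HasCompactSupport g) : MemLp (∇ g) 2 (volume.restrict Ω) := by
  have hu : IsTestFunction univ g := ⟨h1, h2, subset_univ _⟩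
  have := hu.memLp_gradient
  rw [Measure.restrict_univ] at this
  exact this.restrict Ω

/-- The test function vanishes outside `Ω`, so both integrals extend to the whole plane, where the
classical integration by parts has no boundary term. -/
theorem weakPair_H1_of_contDiff {g : Plane → ℝ} (h1 : ContDiff ℝ ∞ g)
    (h2 : HasCompactSupport g) : WeakPair (H1 Ω) g (∇ g) := by
  have hg : MemLp g 2 (volume.restrict Ω) :=
    (h1.continuous.memLp_of_hasCompactSupport h2).restrict Ω
  have hg' := memLp_gradient_of_contDiff (Ω := Ω) h1 h2
  rw [weakPair_iff hg hg']
  intro φ hφ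
  have e1 : ∫ x in Ω, (mkPair hg hg').fst x • ∇ φ x = ∫ x, g x • ∇ φ x := by
    refine Eq.trans (integral_congr_ae ?_) (setIntegral_eq_integral_of_forall_compl_eq_zero
      (f := fun x => g x • ∇ φ x) fun x hx => ?_)
    · filter_upwards [mkPair_fst hg hg'] with x hx
      rw [hx]
    · have : ∇ φ x = 0 := gradient_eq_of_forall fun v => by
        rw [fderiv_of_notMem_tsupport (𝕜 := ℝ) fun h => hx (hφ.2.2 h)]; simp
      rw [this, smul_zero]
  have e2 : ∫ x in Ω, φ x • (mkPair hg hg').snd x = ∫ x, φ x • ∇ g x := by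
    refine Eq.trans (integral_congr_ae ?_) (setIntegral_eq_integral_of_forall_compl_eq_zero
      (f := fun x => φ x • ∇ g x) fun x hx => ?_)
    · filter_upwards [mkPair_snd hg hg'] with x hx
      rw [hx]
    · rw [image_eq_zero_of_notMem_tsupport fun h => hx (hφ.2.2 h), zero_smul]
  rw [e1, e2]
  have hgu : IsTestFunction univ g := ⟨h1, h2, subset_univ _⟩
  have hφu : IsTestFunction univ φ := ⟨hφ.1, hφ.2.1, subset_univ _⟩
  have i {a c : Plane → ℝ} (ha : IsTestFunction univ a) (hc : IsTestFunction univ c) :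
      Integrable (fun x => a x • ∇ c x) := by
    have := memLp_one_iff_integrable.1 (hc.memLp_gradient.smul (r := 1) ha.memLp)
    rw [Measure.restrict_univ] at this
    exact this
  refine ext_inner_right ℝ fun v => ?_
  rw [inner_neg_left, real_inner_comm, ← integral_inner (i hgu hφu), real_inner_comm,
    ← integral_inner (i hφu hgu)]
  have e3 (a c : Plane → ℝ) : (fun x => inner ℝ v (a x • ∇ c x)) = fun x => a x * fderiv ℝ c x v := by
    ext x
    rw [real_inner_smul_right, real_inner_comm, real_inner_gradient]
  have j {a c : Plane → ℝ} (ha : IsTestFunction univ a) (hc : IsTestFunction univ c) :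
      Integrable (fun x => a x * fderiv ℝ c x v) := by
    rw [← e3]; exact (i ha hc).const_inner v
  rw [e3, e3, integral_mul_fderiv_eq_neg_fderiv_mul_of_integrable]
  · simp_rw [mul_comm]
  · simpa only [mul_comm] using j hφu hgu
  · exact j hgu hφu
  · exact (h1.continuous.mul hφ.1.continuous).integrable_of_hasCompactSupport h2.mul_right
  · exact fun x _ => hgu.differentiableAt x
  · exact fun x _ => hφu.differentiableAt x

theorem IsTestFunction.weakPair_H1 {φ : Plane → ℝ} (h : IsTestFunction Ω φ) :
    WeakPair (H1 Ω) φ (∇ φ) := weakPair_H1_of_contDiff h.1 h.2.1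

/-- The test function itself has a weak gradient, so integration by parts against elements of `H10`
can be read with the two roles exchanged. -/
theorem H10_le_H1 : H10 Ω ≤ H1 Ω := by
  intro p hp φ hφ
  have hφ' := (weakPair_iff hφ.memLp hφ.memLp_gradient).1 hφ.weakPair_H1
  have h := integral_smul_snd_eq_neg hφ' hp
  rw [integral_congr_ae (g := fun x => φ x • p.snd x) (by
    filter_upwards [mkPair_fst hφ.memLp hφ.memLp_gradient] with x hx; rw [hx]),
    integral_congr_ae (f := fun x => p.fst x • (mkPair _ _).snd x) (g := fun x => p.fst x • ∇ φ x) (by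
    filter_upwards [mkPair_snd hφ.memLp hφ.memLp_gradient] with x hx; rw [hx])] at h
  rw [h, neg_neg]

end WeakPair

/-! ### Mollification in the plane and products with test functions -/

section Mollification

variable {Ω : Set Plane} {E : Type*} [NormedAddCommGroup E] [InnerProductSpace ℝ E]

/-- Translation is continuous in `L²`. -/
theorem continuous_integral_inner_translate {Z f : Plane → E} (hZ : MemLp Z 2) (hf : MemLp f 2) :
    Continuous fun s : Plane => ∫ x, inner ℝ (Z x) (f (x - s)) := by
  let g : C(Plane, C(Plane, Plane)) :=
    ContinuousMap.curry ⟨fun p : Plane × Plane => p.2 - p.1, by fun_prop⟩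
  have hgm (s : Plane) : MeasurePreserving (g s) (volume : Measure Plane) volume :=
    measurePreserving_sub_right volume s
  have h1 : Continuous fun s => Lp.compMeasurePreserving (g s) (hgm s) (hf.toLp f) :=
    Continuous.compMeasurePreservingLp continuous_const g.continuous hgm (by norm_num)
  have h2 : Continuous fun s => inner ℝ (hZ.toLp Z)
      (Lp.compMeasurePreserving (g s) (hgm s) (hf.toLp f)) := continuous_const.inner h1
  convert h2 using 2 with s
  rw [L2.inner_def]
  refine integral_congr_ae ?_
  filter_upwards [hZ.coeFn_toLp, Lp.coeFn_compMeasurePreserving (hf.toLp f) (hgm s),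
    (hgm s).quasiMeasurePreserving.ae_eq_comp hf.coeFn_toLp] with x a b c
  rw [a, b, c]
  rfl

/-- Fubini: pairing with a mollification is the average of the pairings with translates. This
replaces convergence of mollifications in `L²` by continuity of a scalar function. -/
theorem integral_inner_convolution [CompleteSpace E] {Z f : Plane → E} (hZ : MemLp Z 2) (hf : MemLp f 2)
    (ρ : ContDiffBump (0 : Plane)) :
    ∫ x, inner ℝ (Z x) (convolution (ρ.normed volume) f (ContinuousLinearMap.lsmul ℝ ℝ) volume x)
      = ∫ s, ρ.normed volume s * ∫ x, inner ℝ (Z x) (f (x - s)) := by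
  have hfs (s : Plane) : MemLp (fun x => f (x - s)) 2 :=
    hf.comp_measurePreserving (measurePreserving_sub_right volume s)
  have hl (s : Plane) : l2n volume (fun x => f (x - s)) = l2n volume f := by
    have := eLpNorm_comp_measurePreserving (p := 2) hf.1
      (measurePreserving_sub_right (volume : Measure Plane) s)
    exact congrArg ENNReal.toReal this
  have hmeas : AEStronglyMeasurable
      (fun p : Plane × Plane => inner ℝ (Z p.1) (ρ.normed volume p.2 • f (p.1 - p.2)))
      ((volume : Measure Plane).prod volume) := by
    have h1 : AEStronglyMeasurable
      (fun p : Plane × Plane => (ContinuousLinearMap.lsmul ℝ ℝ) (ρ.normed volume p.2) (f (p.1 - p.2)))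
      ((volume : Measure Plane).prod volume) :=
      AEStronglyMeasurable.convolution_integrand _ ρ.continuous_normed.aestronglyMeasurable hf.1
    exact hZ.1.comp_fst.inner h1
  have hi (s : Plane) : Integrable fun x => inner ℝ (Z x) (f (x - s)) :=
    integrable_inner_of_memLp hZ (hfs s)
  have hint : Integrable
      (fun p : Plane × Plane => inner ℝ (Z p.1) (ρ.normed volume p.2 • f (p.1 - p.2)))
      ((volume : Measure Plane).prod volume) := by
    refine (integrable_prod_iff' hmeas).2 ⟨.of_forall fun s => ?_, ?_⟩
    · simp_rw [real_inner_smul_right]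
      exact (hi s).const_mul _
    · refine (ρ.integrable_normed.mul_const (l2n volume Z * l2n volume f)).mono'
        hmeas.prod_swap.norm.integral_prod_right' (.of_forall fun s => ?_)
      have h0 := ρ.nonneg_normed (μ := volume) s
      rw [Real.norm_of_nonneg (integral_nonneg fun x => norm_nonneg _)]
      calc ∫ x, ‖inner ℝ (Z x) (ρ.normed volume s • f (x - s))‖
          ≤ ∫ x, ρ.normed volume s * (‖Z x‖ * ‖f (x - s)‖) := by
            refine integral_mono_of_nonneg (.of_forall fun x => norm_nonneg _)
              ((integrable_norm_mul_norm hZ (hfs s)).const_mul _) (.of_forall fun x => ?_)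
            dsimp only
            rw [real_inner_smul_right, norm_mul, Real.norm_of_nonneg h0]
            exact mul_le_mul_of_nonneg_left (norm_inner_le_norm _ _) h0
        _ ≤ _ := by
            rw [integral_const_mul]
            refine mul_le_mul_of_nonneg_left ?_ h0
            rw [← hl s]
            exact integral_norm_mul_norm_le hZ (hfs s)
  have h1 := integral_integral_swap (f := fun x s => inner ℝ (Z x) (ρ.normed volume s • f (x - s))) hint
  have h2 : ∀ᵐ x, inner ℝ (Z x)
      (convolution (ρ.normed volume) f (ContinuousLinearMap.lsmul ℝ ℝ) volume x)
      = ∫ s, inner ℝ (Z x) (ρ.normed volume s • f (x - s)) := by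
    have hloc : LocallyIntegrable f := hf.locallyIntegrable (by norm_num)
    refine .of_forall fun x => ?_
    rw [integral_inner]
    · rfl
    · exact ρ.hasCompactSupport_normed.convolutionExists_left
        (ContinuousLinearMap.lsmul ℝ ℝ) ρ.continuous_normed hloc x
  rw [integral_congr_ae h2, h1]
  refine integral_congr_ae (.of_forall fun s => ?_)
  dsimp only
  rw [← integral_const_mul]
  simp_rw [real_inner_smul_right]

set_option maxHeartbeats 1000000 in
/-- The product of a test function and an element of `H¹` lies in `H¹₀`. -/
theorem IsTestFunction.mul_weakPair (hΩ : IsOpen Ω) {φ : Plane → ℝ} (hφ : IsTestFunction Ω φ)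
    {β : GradPair Ω} (hβ : β ∈ H1 Ω) :
    WeakPair (H10 Ω) (fun x => φ x * β.fst x) (fun x => φ x • β.snd x + β.fst x • ∇ φ x) := by
  have hΩm := hΩ.measurableSet
  have hφ0 {x : Plane} (hx : x ∉ Ω) : φ x = 0 :=
    image_eq_zero_of_notMem_tsupport fun h => hx (hφ.2.2 h)
  have hφ0' {x : Plane} (hx : x ∉ Ω) : ∇ φ x = 0 := gradient_eq_of_forall fun v => by
    rw [fderiv_of_notMem_tsupport (𝕜 := ℝ) fun h => hx (hφ.2.2 h)]; simp
  obtain ⟨B, hB⟩ := hφ.2.1.exists_bound_of_continuous hφ.1.continuous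
  have hcg : Continuous (∇ φ) := (InnerProductSpace.toDual ℝ Plane).symm.continuous.comp
    (hφ.1.continuous_fderiv (by simp))
  have hsg : HasCompactSupport (∇ φ) := (hφ.2.1.fderiv (𝕜 := ℝ)).comp_left
    (g := (InnerProductSpace.toDual ℝ Plane).symm) (map_zero _)
  obtain ⟨B', hB'⟩ := hsg.exists_bound_of_continuous hcg
  set f0 : Plane → ℝ := fun x => φ x * β.fst x with hf0
  set f1 : Plane → Plane := fun x => φ x • β.snd x + β.fst x • ∇ φ x with hf1
  have m0 : MemLp f0 2 (volume.restrict Ω) :=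
    (Lp.memLp β.fst).of_le_mul (c := B)
      (hφ.1.continuous.aestronglyMeasurable.mul (Lp.memLp β.fst).1)
      (.of_forall fun x => by rw [norm_mul]; gcongr; exact hB x)
  have m1 : MemLp f1 2 (volume.restrict Ω) := by
    refine MemLp.add ?_ ?_
    · exact (Lp.memLp β.snd).of_le_mul (c := B)
        (hφ.1.continuous.aestronglyMeasurable.smul (Lp.memLp β.snd).1)
        (.of_forall fun x => by rw [norm_smul]; gcongr; exact hB x)
    · exact (Lp.memLp β.fst).of_le_mul (c := B')
        ((Lp.memLp β.fst).1.smul hcg.aestronglyMeasurable)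
        (.of_forall fun x => by rw [norm_smul, mul_comm]; gcongr; exact hB' x)
  -- The factor `φ` makes the product its own extension by zero, whatever values `β` takes outside
  -- `Ω`.
  have s0 : Ω.indicator f0 = f0 := by
    ext x
    by_cases hx : x ∈ Ω
    · rw [indicator_of_mem hx]
    · rw [indicator_of_notMem hx, hf0]; simp [hφ0 hx]
  have s1 : Ω.indicator f1 = f1 := by
    ext1 x
    by_cases hx : x ∈ Ω
    · rw [indicator_of_mem hx]
    · rw [indicator_of_notMem hx, hf1]; simp [hφ0 hx, hφ0' hx]
  have M0 : MemLp f0 2 := by rw [← s0]; exact (memLp_indicator_iff_restrict hΩm).2 m0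
  have M1 : MemLp f1 2 := by rw [← s1]; exact (memLp_indicator_iff_restrict hΩm).2 m1
  rw [weakPair_iff m0 m1]
  have : CompleteSpace (H10 Ω) := isClosed_H10.completeSpace_coe
  -- Since `H10` is closed, it suffices that the product is orthogonal to every `z` orthogonal to
  -- `H10`. Small mollifications of the product are test functions, hence orthogonal to `z`; the
  -- kernel then shrinks.
  rw [← Submodule.orthogonal_orthogonal (H10 Ω), Submodule.mem_orthogonal]
  intro z hz
  have Z0 : MemLp (Ω.indicator z.fst) 2 := (memLp_indicator_iff_restrict hΩm).2 (Lp.memLp z.fst)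
  have Z1 : MemLp (Ω.indicator z.snd) 2 := (memLp_indicator_iff_restrict hΩm).2 (Lp.memLp z.snd)
  have hinner {g0 : Plane → ℝ} {g1 : Plane → Plane} (h0 : MemLp g0 2 (volume.restrict Ω))
      (h1 : MemLp g1 2 (volume.restrict Ω)) : inner ℝ z (mkPair h0 h1) =
      (∫ x, inner ℝ (Ω.indicator z.fst x) (g0 x)) + ∫ x, inner ℝ (Ω.indicator z.snd x) (g1 x) := by
    have a0 : ∫ x, inner ℝ (Ω.indicator z.fst x) (g0 x) = ∫ x in Ω, inner ℝ (z.fst x) (g0 x) := by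
      rw [← integral_indicator hΩm]
      refine integral_congr_ae (.of_forall fun x => ?_)
      by_cases hx : x ∈ Ω <;> simp [hx]
    have a1 : ∫ x, inner ℝ (Ω.indicator z.snd x) (g1 x) = ∫ x in Ω, inner ℝ (z.snd x) (g1 x) := by
      rw [← integral_indicator hΩm]
      refine integral_congr_ae (.of_forall fun x => ?_)
      by_cases hx : x ∈ Ω <;> simp [hx]
    rw [a0, a1, WithLp.prod_inner_apply, L2.inner_def, L2.inner_def]
    congr 1
    · refine integral_congr_ae ?_
      filter_upwards [mkPair_fst h0 h1] with x hx
      rw [← hx]; rfl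
    · refine integral_congr_ae ?_
      filter_upwards [mkPair_snd h0 h1] with x hx
      rw [← hx]; rfl
  -- The pairing of `z` with the pair translated by `s`. It is continuous, and its value at zero is
  -- the one to be shown to vanish.
  set C : Plane → ℝ := fun s => (∫ x, inner ℝ (Ω.indicator z.fst x) (f0 (x - s))) +
    ∫ x, inner ℝ (Ω.indicator z.snd x) (f1 (x - s)) with hC
  have cC : Continuous C := (continuous_integral_inner_translate Z0 M0).add
    (continuous_integral_inner_translate Z1 M1)
  have hC0 : inner ℝ z (mkPair m0 m1) = C 0 := by
    rw [hinner, hC]; simp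
  rw [hC0]
  obtain ⟨δ, hδ, hδΩ⟩ := hφ.2.1.isCompact.exists_cthickening_subset_open hΩ hφ.2.2
  -- the mollified pair is a test function
  have key (ρ : ContDiffBump (0 : Plane)) (hρ : ρ.rOut ≤ δ) :
      ∫ s, ρ.normed volume s * C s = 0 := by
    have l0 : LocallyIntegrable f0 := M0.locallyIntegrable (by norm_num)
    have l1 : LocallyIntegrable f1 := M1.locallyIntegrable (by norm_num)
    set ψ := convolution (ρ.normed volume) f0 (ContinuousLinearMap.lsmul ℝ ℝ) volume with hψ
    have cψ : ContDiff ℝ ∞ ψ := ρ.hasCompactSupport_normed.contDiff_convolution_left _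
      ρ.contDiff_normed l0
    have tψ : IsTestFunction Ω ψ := by
      have hsub : Function.support ψ ⊆ Metric.cthickening δ (tsupport φ) := by
        intro x hx
        obtain ⟨s, hs, y, hy, rfl⟩ := Set.mem_add.1 (support_convolution_subset _ hx)
        rw [ρ.support_normed_eq, mem_ball_zero_iff] at hs
        have hy' : y ∈ tsupport φ := subset_tsupport _ fun h => hy (by simp [hf0, h])
        refine Metric.mem_cthickening_of_dist_le _ y _ _ hy' ?_
        rw [dist_eq_norm]
        simp only [add_sub_cancel_right]
        linarith
      have hcl : tsupport ψ ⊆ Metric.cthickening δ (tsupport φ) :=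
        closure_minimal hsub Metric.isClosed_cthickening
      exact ⟨cψ, HasCompactSupport.of_support_subset_isCompact hφ.2.1.isCompact.cthickening hsub,
        hcl.trans hδΩ⟩
    have gψ : ∇ ψ = convolution (ρ.normed volume) f1 (ContinuousLinearMap.lsmul ℝ ℝ) volume := by
      ext1 x
      refine gradient_eq_of_forall fun v => ?_
      have d1 := (ρ.hasCompactSupport_normed (μ := volume)).hasFDerivAt_convolution_left
        (ContinuousLinearMap.lsmul ℝ ℝ) ((ρ.contDiff_normed (μ := volume) (n := 1))) l0 x
      have hd : ContDiff ℝ ∞ fun y => ρ.normed volume (x - y) :=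
        (ρ.contDiff_normed (μ := volume) (n := ⊤)).comp (contDiff_const.sub contDiff_id)
      -- The weak gradient of `β` is tested with `φ` times the reflected kernel. The product rule
      -- then turns the gradient of the mollification into the mollification of `f1`.
      have hχ : IsTestFunction Ω fun y => φ y * ρ.normed volume (x - y) :=
        ⟨hφ.1.mul hd, hφ.2.1.mul_right, (tsupport_mul_subset_left).trans hφ.2.2⟩
      have hw := hβ _ hχ
      have gχ (y : Plane) : ∇ (fun y => φ y * ρ.normed volume (x - y)) y
          = ρ.normed volume (x - y) • ∇ φ y - φ y • ∇ (ρ.normed volume) (x - y) := by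
        refine gradient_eq_of_forall fun w => ?_
        have e1 : HasFDerivAt φ (fderiv ℝ φ y) y := (hφ.differentiableAt y).hasFDerivAt
        have e2 : HasFDerivAt (fun y => ρ.normed volume (x - y))
            ((fderiv ℝ (ρ.normed volume) (x - y)).comp (-ContinuousLinearMap.id ℝ Plane)) y := by
          refine HasFDerivAt.comp y (((ρ.contDiff_normed (μ := volume) (n := 1)).differentiable
            (by simp) (x - y)).hasFDerivAt) ?_
          exact (hasFDerivAt_id y).const_sub x
        rw [(e1.fun_mul e2).fderiv, inner_sub_left, real_inner_smul_left, real_inner_smul_left,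
          real_inner_gradient, real_inner_gradient]
        simp
        ring
      have hρf : Continuous fun y => fderiv ℝ (ρ.normed volume) y v :=
        ((ρ.contDiff_normed (μ := volume) (n := 1)).continuous_fderiv (by simp)).clm_apply
          continuous_const
      have hρs : HasCompactSupport fun y => fderiv ℝ (ρ.normed volume) y v :=
        (ρ.hasCompactSupport_normed.fderiv (𝕜 := ℝ)).comp_left
          (g := fun L : Plane →L[ℝ] ℝ => L v) (by simp)
      have hsub : MeasurePreserving (fun y : Plane => x - y) volume volume :=
        Measure.measurePreserving_sub_left volume x
      have mA : MemLp (fun y => fderiv ℝ (ρ.normed volume) (x - y) v) 2 :=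
        (hρf.memLp_of_hasCompactSupport hρs).comp_measurePreserving hsub
      have mB : MemLp (fun y => ρ.normed volume (x - y)) 2 :=
        (ρ.continuous_normed.memLp_of_hasCompactSupport
          ρ.hasCompactSupport_normed).comp_measurePreserving hsub
      have iA : Integrable fun y => fderiv ℝ (ρ.normed volume) (x - y) v * f0 y :=
        mA.integrable_mul M0
      have iB : Integrable fun y => ρ.normed volume (x - y) * inner ℝ (f1 y) v :=
        mB.integrable_mul (M1.inner_const v)
      have eL : fderiv ℝ ψ x v = ∫ y, fderiv ℝ (ρ.normed volume) (x - y) v * f0 y := by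
        rw [d1.fderiv, convolution, ContinuousLinearMap.integral_apply]
        · rw [← integral_sub_left_eq_self _ volume x]
          refine integral_congr_ae (.of_forall fun s => ?_)
          simp
        · exact (ρ.hasCompactSupport_normed.fderiv (𝕜 := ℝ)).convolutionExists_left _
            ((ρ.contDiff_normed (μ := volume) (n := 1)).continuous_fderiv (by simp)) l0 x
      have eR : inner ℝ (convolution (ρ.normed volume) f1 (ContinuousLinearMap.lsmul ℝ ℝ) volume x) v
          = ∫ y, ρ.normed volume (x - y) * inner ℝ (f1 y) v := by
        rw [real_inner_comm, convolution, ← integral_inner]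
        · rw [← integral_sub_left_eq_self _ volume x]
          refine integral_congr_ae (.of_forall fun s => ?_)
          simp only [ContinuousLinearMap.lsmul_apply, real_inner_smul_right, sub_sub_cancel,
            real_inner_comm v]
        · exact ρ.hasCompactSupport_normed.convolutionExists_left
            (ContinuousLinearMap.lsmul ℝ ℝ) ρ.continuous_normed l1 x
      rw [eL, eR, eq_comm, ← sub_eq_zero, ← integral_sub iB iA,
        ← setIntegral_eq_integral_of_forall_compl_eq_zero (s := Ω) fun y hy => by
          simp [hf0, hf1, hφ0 hy, hφ0' hy]]
      have i1 : Integrable (fun y => β.fst y • ∇ (fun y => φ y * ρ.normed volume (x - y)) y)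
          (volume.restrict Ω) :=
        memLp_one_iff_integrable.1 (hχ.memLp_gradient.smul (Lp.memLp β.fst))
      have i2 : Integrable (fun y => (φ y * ρ.normed volume (x - y)) • β.snd y)
          (volume.restrict Ω) :=
        memLp_one_iff_integrable.1 ((Lp.memLp β.snd).smul hχ.memLp)
      have hw2 : ∫ y in Ω, inner ℝ v (β.fst y • ∇ (fun y => φ y * ρ.normed volume (x - y)) y
          + (φ y * ρ.normed volume (x - y)) • β.snd y) = 0 := by
        refine (integral_inner (i1.add i2) v).trans ?_
        simp only [Pi.add_apply]
        rw [integral_add i1 i2, hw, neg_add_cancel, inner_zero_right]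
      rw [← hw2]
      refine integral_congr_ae (.of_forall fun y => ?_)
      simp only [hf0, hf1, gχ, inner_add_right, real_inner_smul_right, inner_sub_right,
        real_inner_comm v]
      rw [← real_inner_gradient, real_inner_comm v]
      ring
    have c0 : Continuous fun s => ∫ x, inner ℝ (Ω.indicator z.fst x) (f0 (x - s)) :=
      continuous_integral_inner_translate Z0 M0
    have c1 : Continuous fun s => ∫ x, inner ℝ (Ω.indicator z.snd x) (f1 (x - s)) :=
      continuous_integral_inner_translate Z1 M1
    simp only [hC, mul_add]
    have j0 : Integrable fun s => ρ.normed volume s *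
        ∫ x, inner ℝ (Ω.indicator z.fst x) (f0 (x - s)) :=
      (ρ.continuous_normed.mul c0).integrable_of_hasCompactSupport
        ρ.hasCompactSupport_normed.mul_right
    have j1 : Integrable fun s => ρ.normed volume s *
        ∫ x, inner ℝ (Ω.indicator z.snd x) (f1 (x - s)) :=
      (ρ.continuous_normed.mul c1).integrable_of_hasCompactSupport
        ρ.hasCompactSupport_normed.mul_right
    rw [integral_add j0 j1,
      ← integral_inner_convolution Z0 M0, ← integral_inner_convolution Z1 M1, ← hψ, ← gψ,
      ← hinner tψ.memLp tψ.memLp_gradient]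
    rw [Submodule.mem_orthogonal] at hz
    rw [real_inner_comm]
    exact hz _ ((weakPair_iff tψ.memLp tψ.memLp_gradient).1 tψ.weakPair)
  -- Kernels of shrinking radius: the vanishing averages of `C` converge to `C 0`.
  let ρ : ℕ → ContDiffBump (0 : Plane) := fun n =>
    ⟨δ / (n + 1) / 2, δ / (n + 1), by positivity, half_lt_self (by positivity)⟩
  have hlim := ContDiffBump.convolution_tendsto_right_of_continuous (φ := ρ) (l := Filter.atTop)
    (μ := volume) (g := fun s => C (-s)) (by
      have := (tendsto_one_div_add_atTop_nhds_zero_nat (𝕜 := ℝ)).const_mul δ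
      simpa [ρ, div_eq_mul_inv] using this) (cC.comp continuous_neg) 0
  refine tendsto_nhds_unique (f := fun _ : ℕ => (0 : ℝ)) (l := Filter.atTop) ?_ tendsto_const_nhds
  have h0 : (fun n => convolution ((ρ n).normed volume) (fun s => C (-s))
      (ContinuousLinearMap.lsmul ℝ ℝ) volume 0) = fun _ => 0 := by
    ext n
    have := key (ρ n) (div_le_self hδ.le (by simp))
    simpa [convolution] using this
  rw [h0, neg_zero] at hlim
  exact hlim

end Mollification

/-! ### Sobolev inequality and products in `L²` -/

section SobolevProducts

variable {Ω : Set Plane}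

theorem norm_gradPair_fst_le (p : GradPair Ω) : ‖p.fst‖ ≤ ‖p‖ := by
  rw [WithLp.prod_norm_eq_of_L2]
  exact Real.le_sqrt_of_sq_le (le_add_of_nonneg_right (sq_nonneg _))

theorem norm_gradPair_snd_le (p : GradPair Ω) : ‖p.snd‖ ≤ ‖p‖ := by
  rw [WithLp.prod_norm_eq_of_L2]
  exact Real.le_sqrt_of_sq_le (le_add_of_nonneg_left (sq_nonneg _))

theorem norm_le_fst_add_snd (p : GradPair Ω) : ‖p‖ ≤ ‖p.fst‖ + ‖p.snd‖ := by
  rw [WithLp.prod_norm_eq_of_L2]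
  refine Real.sqrt_le_iff.2 ⟨by positivity, ?_⟩
  nlinarith [mul_nonneg (norm_nonneg p.fst) (norm_nonneg p.snd)]

theorem abs_l2n_sub_le {X E : Type*} [MeasurableSpace X] {μ : Measure X} [NormedAddCommGroup E]
    {f g : X → E} (hf : MemLp f 2 μ) (hg : MemLp g 2 μ) :
    |l2n μ f - l2n μ g| ≤ l2n μ (fun x => f x - g x) := by
  rw [← norm_toLp_eq_l2n hf, ← norm_toLp_eq_l2n hg]
  refine (abs_norm_sub_norm_le _ _).trans (le_of_eq ?_)
  rw [← MemLp.toLp_sub, norm_toLp_eq_l2n]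
  rfl

theorem tendsto_l2n_of_dominated {X E F : Type*} [MeasurableSpace X] {μ : Measure X}
    [NormedAddCommGroup E] [NormedAddCommGroup F] {h : ℕ → X → E} {G : X → F}
    (hh : ∀ n, AEStronglyMeasurable (h n) μ) (hG : MemLp G 2 μ)
    (hb : ∀ n, ∀ᵐ x ∂μ, ‖h n x‖ ≤ ‖G x‖)
    (hl : ∀ᵐ x ∂μ, Filter.Tendsto (fun n => h n x) Filter.atTop (nhds 0)) :
    Filter.Tendsto (fun n => l2n μ (h n)) Filter.atTop (nhds 0) := by
  have hm (n : ℕ) : MemLp (h n) 2 μ := hG.mono (hh n) (hb n)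
  have h1 : Filter.Tendsto (fun n => ∫ x, ‖h n x‖ ^ 2 ∂μ) Filter.atTop (nhds (∫ _, (0 : ℝ) ∂μ)) := by
    refine tendsto_integral_of_dominated_convergence (fun x => ‖G x‖ ^ 2)
      (fun n => (hh n).norm.pow 2) (by simpa only [sq] using integrable_norm_mul_norm hG hG) ?_ ?_
    · intro n
      filter_upwards [hb n] with x hx
      rw [Real.norm_of_nonneg (by positivity)]
      gcongr
    · filter_upwards [hl] with x hx
      simpa using hx.norm.pow 2
  have h2 := h1.sqrt
  simp only [integral_zero, Real.sqrt_zero] at h2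
  refine h2.congr fun n => ?_
  rw [← l2n_sq (hm n), Real.sqrt_sq (l2n_nonneg _)]

theorem tendsto_l2n_of_le_mul {X E F : Type*} [MeasurableSpace X] {μ : Measure X}
    [NormedAddCommGroup E] [NormedAddCommGroup F] {h : ℕ → X → E} {g : ℕ → X → F} {B : ℝ}
    (hg : ∀ n, MemLp (g n) 2 μ) (hb : ∀ n, ∀ᵐ x ∂μ, ‖h n x‖ ≤ B * ‖g n x‖)
    (hl : Filter.Tendsto (fun n => l2n μ (g n)) Filter.atTop (nhds 0)) :
    Filter.Tendsto (fun n => l2n μ (h n)) Filter.atTop (nhds 0) := by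
  have h2 := hl.const_mul |B|
  rw [mul_zero] at h2
  refine squeeze_zero (fun n => l2n_nonneg _) (fun n => ?_) h2
  have h3 : l2n μ (fun x => B • ‖g n x‖) = |B| * l2n μ (g n) := by
    rw [l2n_const_smul, l2n_norm]
  rw [← h3]
  refine l2n_mono ((hg n).norm.const_smul B) ?_
  filter_upwards [hb n] with x hx
  exact hx.trans (le_abs_self _)

theorem tendsto_l2n_add {X E : Type*} [MeasurableSpace X] {μ : Measure X}
    [NormedAddCommGroup E] {g h : ℕ → X → E} (hg : ∀ n, MemLp (g n) 2 μ)
    (hh : ∀ n, MemLp (h n) 2 μ)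
    (lg : Filter.Tendsto (fun n => l2n μ (g n)) Filter.atTop (nhds 0))
    (lh : Filter.Tendsto (fun n => l2n μ (h n)) Filter.atTop (nhds 0)) :
    Filter.Tendsto (fun n => l2n μ (fun x => g n x + h n x)) Filter.atTop (nhds 0) := by
  have := lg.add lh
  rw [add_zero] at this
  exact squeeze_zero (fun n => l2n_nonneg _) (fun n => l2n_add_le (hg n) (hh n)) this

theorem WeakPair.of_tendsto_l2n {S : Submodule ℝ (GradPair Ω)} (hS : IsClosed (S : Set (GradPair Ω)))
    {f : Plane → ℝ} {g : Plane → Plane} {fn : ℕ → Plane → ℝ}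
    {gn : ℕ → Plane → Plane} (h : ∀ n, WeakPair S (fn n) (gn n))
    (hf : MemLp f 2 (volume.restrict Ω)) (hg : MemLp g 2 (volume.restrict Ω))
    (h1 : Filter.Tendsto (fun n => l2n (volume.restrict Ω) (fun x => fn n x - f x))
      Filter.atTop (nhds 0))
    (h2 : Filter.Tendsto (fun n => l2n (volume.restrict Ω) (fun x => gn n x - g x))
      Filter.atTop (nhds 0)) : WeakPair S f g :=
  WeakPair.of_tendsto hS h hf hg ((tendsto_l2n_iff fun n => (h n).memLp_fst.sub hf).1 h1)
    ((tendsto_l2n_iff fun n => (h n).memLp_snd.sub hg).1 h2)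

theorem IsTestFunction.continuous_gradient {φ : Plane → ℝ} (hφ : IsTestFunction Ω φ) :
    Continuous (∇ φ) := (InnerProductSpace.toDual ℝ Plane).symm.continuous.comp
    (hφ.1.continuous_fderiv (by simp))

theorem IsTestFunction.gradient_eq_zero {φ : Plane → ℝ} (hφ : IsTestFunction Ω φ) {x : Plane}
    (hx : x ∉ Ω) : ∇ φ x = 0 := gradient_eq_of_forall fun v => by
  rw [fderiv_of_notMem_tsupport (𝕜 := ℝ) fun h => hx (hφ.2.2 h)]; simp

/-- Two is its own conjugate exponent and the dimension of the plane, so the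
Gagliardo–Nirenberg–Sobolev inequality with gradient exponent one lands in `L²`. -/
theorem exists_sobolev_one_test (Ω : Set Plane) :
    ∃ S : ℝ, 0 ≤ S ∧ ∀ φ : Plane → ℝ, IsTestFunction Ω φ →
      l2n (volume.restrict Ω) φ ≤ S * ∫ x in Ω, ‖∇ φ x‖ := by
  refine ⟨eLpNormLESNormFDerivOneConst (volume : Measure Plane) ((2 : NNReal) : ℝ),
    NNReal.coe_nonneg _, fun φ hφ => ?_⟩
  have hconj : NNReal.HolderConjugate (Module.finrank ℝ Plane : NNReal) 2 := by
    rw [finrank_euclideanSpace_fin]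
    rw [NNReal.holderConjugate_iff]
    constructor
    · norm_num
    · push_cast
      rw [← NNReal.coe_inj]
      push_cast
      norm_num
  have h := eLpNorm_le_eLpNorm_fderiv_one (volume : Measure Plane) (hφ.1.of_le (by simp)) hφ.2.1 hconj
  have hint : Integrable (∇ φ) := by
    refine hφ.continuous_gradient.integrable_of_hasCompactSupport ?_
    exact (hφ.2.1.fderiv (𝕜 := ℝ)).comp_left (g := (InnerProductSpace.toDual ℝ Plane).symm) (map_zero _)
  have hn (x : Plane) : ‖fderiv ℝ φ x‖ = ‖∇ φ x‖ := by simp [gradient]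
  have e1 : eLpNorm (fderiv ℝ φ) 1 volume = ENNReal.ofReal (∫ x in Ω, ‖∇ φ x‖) := by
    rw [eLpNorm_congr_norm_ae (g := ∇ φ) (.of_forall hn), eLpNorm_one_eq_lintegral_enorm,
      ← ofReal_integral_norm_eq_lintegral_enorm hint]
    congr 1
    refine (setIntegral_eq_integral_of_forall_compl_eq_zero fun x hx => ?_).symm
    rw [hφ.gradient_eq_zero hx, norm_zero]
  rw [e1] at h
  have h2 := (eLpNorm_mono_measure φ (Measure.restrict_le_self (s := Ω))).trans h
  have h3 := ENNReal.toReal_mono (ENNReal.mul_ne_top ENNReal.coe_ne_top ENNReal.ofReal_ne_top) h2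
  rw [ENNReal.toReal_mul, ENNReal.toReal_ofReal (integral_nonneg fun _ => norm_nonneg _)] at h3
  exact h3

variable [IsFiniteMeasure (volume.restrict Ω)]

/-- The Gagliardo–Nirenberg–Sobolev inequality `W₀^{1,1} ⊂ L²` on `H¹₀`. -/
theorem exists_sobolev_one (Ω : Set Plane) [IsFiniteMeasure (volume.restrict Ω)] :
    ∃ S : ℝ, 0 ≤ S ∧ ∀ p ∈ H10 Ω, ‖p.fst‖ ≤ S * ∫ x in Ω, ‖p.snd x‖ := by
  obtain ⟨S, hS, h⟩ := exists_sobolev_one_test Ω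
  refine ⟨S, hS, fun p hp => ?_⟩
  obtain ⟨φ, hφ, e1, e2, -, -⟩ := exists_test_seq hp
  rw [norm_eq_l2n]
  have l1 := (tendsto_l2n_iff fun n => (hφ n).memLp.sub (Lp.memLp p.fst)).2 e1
  have l2 := (tendsto_l2n_iff fun n => (hφ n).memLp_gradient.sub (Lp.memLp p.snd)).2 e2
  have t1 : Filter.Tendsto (fun n => l2n (volume.restrict Ω) (φ n)) Filter.atTop
      (nhds (l2n (volume.restrict Ω) p.fst)) := by
    rw [tendsto_iff_norm_sub_tendsto_zero]
    exact squeeze_zero (fun _ => norm_nonneg _)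
      (fun n => abs_l2n_sub_le (hφ n).memLp (Lp.memLp p.fst)) l1
  have t2 : Filter.Tendsto (fun n => ∫ x in Ω, ‖∇ (φ n) x‖) Filter.atTop
      (nhds (∫ x in Ω, ‖p.snd x‖)) := by
    rw [tendsto_iff_norm_sub_tendsto_zero]
    -- On a finite measure space `L²` convergence of the gradients gives `L¹` convergence, by
    -- Cauchy–Schwarz with the constant one.
    have l3 := l2.mul_const (l2n (volume.restrict Ω) (fun _ : Plane => (1 : ℝ)))
    rw [zero_mul] at l3
    refine squeeze_zero (fun _ => norm_nonneg _) (fun n => ?_) l3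
    rw [← integral_sub ((hφ n).memLp_gradient.integrable (by norm_num)).norm
      ((Lp.memLp p.snd).integrable (by norm_num)).norm]
    refine norm_integral_le_l2n ((hφ n).memLp_gradient.sub (Lp.memLp p.snd)) (memLp_const 1)
      (.of_forall fun x => ?_)
    rw [norm_one, mul_one]
    exact abs_norm_sub_norm_le _ _
  exact le_of_tendsto_of_tendsto' t1 (t2.const_mul S) fun n => h _ (hφ n)

/-- A product of an element of `H¹₀` and an element of `H¹` is square integrable. -/
theorem exists_mul_bound (hΩ : IsOpen Ω) :
    ∃ S : ℝ, 0 ≤ S ∧ ∀ p ∈ H10 Ω, ∀ β ∈ H1 Ω,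
      MemLp (fun x => p.fst x * β.fst x) 2 (volume.restrict Ω) ∧
      l2n (volume.restrict Ω) (fun x => p.fst x * β.fst x) ≤
        S * (‖p.fst‖ * ‖β.snd‖ + ‖β.fst‖ * ‖p.snd‖) := by
  obtain ⟨S, hS, h⟩ := exists_sobolev_one Ω
  refine ⟨S, hS, fun p hp β hβ => ?_⟩
  obtain ⟨φ, hφ, e1, e2, a1, -⟩ := exists_test_seq hp
  have l1 := (tendsto_l2n_iff fun n => (hφ n).memLp.sub (Lp.memLp p.fst)).2 e1
  have l2 := (tendsto_l2n_iff fun n => (hφ n).memLp_gradient.sub (Lp.memLp p.snd)).2 e2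
  have t1 : Filter.Tendsto (fun n => l2n (volume.restrict Ω) (φ n)) Filter.atTop
      (nhds (l2n (volume.restrict Ω) p.fst)) := by
    rw [tendsto_iff_norm_sub_tendsto_zero]
    exact squeeze_zero (fun _ => norm_nonneg _)
      (fun n => abs_l2n_sub_le (hφ n).memLp (Lp.memLp p.fst)) l1
  have t2 : Filter.Tendsto (fun n => l2n (volume.restrict Ω) (∇ (φ n))) Filter.atTop
      (nhds (l2n (volume.restrict Ω) p.snd)) := by
    rw [tendsto_iff_norm_sub_tendsto_zero]
    exact squeeze_zero (fun _ => norm_nonneg _)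
      (fun n => abs_l2n_sub_le (hφ n).memLp_gradient (Lp.memLp p.snd)) l2
  have hw (n : ℕ) := (hφ n).mul_weakPair hΩ hβ
  have hb (n : ℕ) : l2n (volume.restrict Ω) (fun x => φ n x * β.fst x) ≤
      S * (l2n (volume.restrict Ω) (φ n) * ‖β.snd‖ +
        ‖β.fst‖ * l2n (volume.restrict Ω) (∇ (φ n))) := by
    obtain ⟨r, hr, r1, r2⟩ := hw n
    rw [← l2n_congr r1, ← norm_eq_l2n]
    refine (h r hr).trans (mul_le_mul_of_nonneg_left ?_ hS)
    rw [norm_eq_l2n, norm_eq_l2n]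
    have i1 := integrable_norm_mul_norm (hφ n).memLp (Lp.memLp β.snd)
    have i2 := integrable_norm_mul_norm (Lp.memLp β.fst) (hφ n).memLp_gradient
    calc ∫ x in Ω, ‖r.snd x‖ ≤ ∫ x in Ω, (‖φ n x‖ * ‖β.snd x‖ + ‖β.fst x‖ * ‖∇ (φ n) x‖) := by
          refine integral_mono_ae ((Lp.memLp r.snd).integrable (by norm_num)).norm (i1.add i2) ?_
          filter_upwards [r2] with x hx
          rw [hx, ← norm_smul, ← norm_smul]
          exact norm_add_le _ _
      _ ≤ _ := by
          rw [integral_add i1 i2]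
          exact add_le_add (integral_norm_mul_norm_le (hφ n).memLp (Lp.memLp β.snd))
            (integral_norm_mul_norm_le (Lp.memLp β.fst) (hφ n).memLp_gradient)
  have hm : AEStronglyMeasurable (fun x => p.fst x * β.fst x) (volume.restrict Ω) :=
    (Lp.memLp p.fst).1.mul (Lp.memLp β.fst).1
  have hlim : Filter.Tendsto (fun n => ENNReal.ofReal (S * (l2n (volume.restrict Ω) (φ n) * ‖β.snd‖ +
        ‖β.fst‖ * l2n (volume.restrict Ω) (∇ (φ n))))) Filter.atTop
      (nhds (ENNReal.ofReal (S * (‖p.fst‖ * ‖β.snd‖ + ‖β.fst‖ * ‖p.snd‖)))) := by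
    rw [norm_eq_l2n p.fst, norm_eq_l2n p.snd]
    exact ENNReal.tendsto_ofReal (((t1.mul_const _).add (t2.const_mul _)).const_mul S)
  -- Fatou's lemma along the almost everywhere convergent test functions.
  have hE : eLpNorm (fun x => p.fst x * β.fst x) 2 (volume.restrict Ω) ≤
      ENNReal.ofReal (S * (‖p.fst‖ * ‖β.snd‖ + ‖β.fst‖ * ‖p.snd‖)) := by
    refine (Lp.eLpNorm_lim_le_liminf_eLpNorm (f := fun n x => φ n x * β.fst x)
      (fun n => (hw n).memLp_fst.1) _ ?_).trans ?_
    · filter_upwards [a1] with x hx using hx.mul_const _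
    · rw [← hlim.liminf_eq]
      refine Filter.liminf_le_liminf (.of_forall fun n => ?_)
      rw [ENNReal.le_ofReal_iff_toReal_le (hw n).memLp_fst.eLpNorm_ne_top]
      · exact hb n
      · exact (l2n_nonneg _).trans (hb n)
  refine ⟨⟨hm, hE.trans_lt ENNReal.ofReal_lt_top⟩, ?_⟩
  rw [l2n]
  exact ENNReal.toReal_le_of_le_ofReal (by positivity) hE

/-- Multiplication by an element of `H¹` is a small perturbation on `H¹₀`. -/
theorem exists_mul_small (hΩ : IsOpen Ω) {β : GradPair Ω} (hβ : β ∈ H1 Ω) {ε : ℝ} (hε : 0 < ε) :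
    ∃ C : ℝ, 0 ≤ C ∧ ∀ p ∈ H10 Ω,
      l2n (volume.restrict Ω) (fun x => p.fst x * β.fst x) ≤ ε * ‖p‖ + C * ‖p.fst‖ := by
  obtain ⟨S, hS, h⟩ := exists_mul_bound hΩ
  -- In the product estimate `∇p` is multiplied only by the `L²` norm of `β`. A smooth `g` close to
  -- `β` in `L²` makes that factor small. The gradient of the remainder may be large, but it meets
  -- only `‖p.fst‖`, and `g` is bounded.
  obtain ⟨g, hg1, hg2, hg3⟩ := (Lp.memLp β.fst).exist_eLpNorm_sub_le (by norm_num) (by norm_num)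
    (ε := ε / (S + 1)) (by positivity)
  obtain ⟨r, hr, r1, r2⟩ := weakPair_H1_of_contDiff (Ω := Ω) hg2 hg1
  obtain ⟨B, hB⟩ := hg1.exists_bound_of_continuous hg2.continuous
  have hB0 : 0 ≤ B := (norm_nonneg _).trans (hB 0)
  have hβr : β - r ∈ H1 Ω := (H1 Ω).sub_mem hβ hr
  have hsmall : ‖(β - r).fst‖ ≤ ε / (S + 1) := by
    rw [norm_eq_l2n]
    refine ENNReal.toReal_le_of_le_ofReal (by positivity) (le_trans (le_of_eq ?_) hg3)
    exact eLpNorm_congr_ae ((Lp.coeFn_sub β.fst r.fst).trans (Filter.EventuallyEq.rfl.sub r1))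
  refine ⟨B + S * ‖(β - r).snd‖, by positivity, fun p hp => ?_⟩
  obtain ⟨m1, b1⟩ := h p hp (β - r) hβr
  have m2 : MemLp (fun x => p.fst x * g x) 2 (volume.restrict Ω) :=
    (Lp.memLp p.fst).of_le_mul (c := B) ((Lp.memLp p.fst).1.mul hg2.continuous.aestronglyMeasurable)
      (.of_forall fun x => by rw [norm_mul, mul_comm]; gcongr; exact hB x)
  have b2 : l2n (volume.restrict Ω) (fun x => p.fst x * g x) ≤ B * ‖p.fst‖ := by
    rw [norm_eq_l2n, ← abs_of_nonneg hB0, ← l2n_const_smul]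
    refine l2n_mono ((Lp.memLp p.fst).const_smul B) (.of_forall fun x => ?_)
    rw [norm_mul, norm_smul, mul_comm, Real.norm_of_nonneg hB0]
    gcongr
    exact hB x
  have e : (fun x => p.fst x * β.fst x) =ᵐ[volume.restrict Ω]
      fun x => p.fst x * g x + p.fst x * (β - r).fst x := by
    filter_upwards [Lp.coeFn_sub β.fst r.fst, r1] with x hx hx'
    have : (β - r).fst x = β.fst x - g x := by rw [← hx']; exact hx
    rw [this]; ring
  rw [l2n_congr e]
  refine (l2n_add_le m2 m1).trans ?_
  have b3 : S * (‖(β - r).fst‖ * ‖p.snd‖) ≤ ε * ‖p‖ := by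
    have : S * (ε / (S + 1)) ≤ ε := by
      rw [mul_div_assoc', div_le_iff₀ (by positivity)]
      nlinarith
    calc S * (‖(β - r).fst‖ * ‖p.snd‖) ≤ S * (ε / (S + 1) * ‖p‖) := by
          gcongr
          exact norm_gradPair_snd_le p
      _ ≤ _ := by rw [← mul_assoc]; gcongr
  nlinarith [norm_nonneg p.fst]

end SobolevProducts

/-! ### Chain rule, truncation and products of bounded functions in `H¹₀` -/

section ChainRule

variable {Ω : Set Plane}

theorem IsTestFunction.comp {φ : Plane → ℝ} (hφ : IsTestFunction Ω φ) {θ : ℝ → ℝ}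
    (hθ : ContDiff ℝ ∞ θ) (h0 : θ 0 = 0) :
    IsTestFunction Ω (fun x => θ (φ x)) ∧ ∀ x, ∇ (fun x => θ (φ x)) x = deriv θ (φ x) • ∇ φ x := by
  have hs : tsupport (fun x => θ (φ x)) ⊆ tsupport φ :=
    closure_mono fun x hx h => hx (by show θ (φ x) = 0; rw [h, h0])
  refine ⟨⟨hθ.comp hφ.1, hφ.2.1.comp_left h0, hs.trans hφ.2.2⟩, fun x => ?_⟩
  refine gradient_eq_of_forall fun v => ?_
  have h1 : HasFDerivAt (fun x => θ (φ x)) (deriv θ (φ x) • fderiv ℝ φ x) x :=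
    (hθ.differentiable (by simp) (φ x)).hasDerivAt.comp_hasFDerivAt x
      (hφ.differentiableAt x).hasFDerivAt
  rw [h1.fderiv, real_inner_smul_left, real_inner_gradient]
  rfl

theorem exists_test_seq_comp {p : GradPair Ω} (hp : p ∈ H10 Ω) {θ : ℝ → ℝ}
    (hθ : ContDiff ℝ ∞ θ) (h0 : θ 0 = 0) {B : ℝ} (hB : ∀ s, |deriv θ s| ≤ B) :
    ∃ φ : ℕ → Plane → ℝ, (∀ n, IsTestFunction Ω (φ n)) ∧
      (∀ n, IsTestFunction Ω (fun x => θ (φ n x))) ∧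
      Filter.Tendsto (fun n => l2n (volume.restrict Ω) (fun x => θ (φ n x) - θ (p.fst x)))
        Filter.atTop (nhds 0) ∧
      Filter.Tendsto (fun n => l2n (volume.restrict Ω)
        (fun x => ∇ (fun x => θ (φ n x)) x - deriv θ (p.fst x) • p.snd x)) Filter.atTop (nhds 0) ∧
      (∀ᵐ x ∂volume.restrict Ω,
        Filter.Tendsto (fun n => θ (φ n x)) Filter.atTop (nhds (θ (p.fst x)))) ∧
      MemLp (fun x => θ (p.fst x)) 2 (volume.restrict Ω) ∧
      MemLp (fun x => deriv θ (p.fst x) • p.snd x) 2 (volume.restrict Ω) := by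
  obtain ⟨φ, hφ, e1, e2, a1, -⟩ := exists_test_seq hp
  have l1 := (tendsto_l2n_iff fun n => (hφ n).memLp.sub (Lp.memLp p.fst)).2 e1
  have l2 := (tendsto_l2n_iff fun n => (hφ n).memLp_gradient.sub (Lp.memLp p.snd)).2 e2
  have hd : Continuous (deriv θ) := hθ.continuous_deriv (by simp)
  have hB0 : 0 ≤ B := (abs_nonneg _).trans (hB 0)
  have hlip (s t : ℝ) : |θ s - θ t| ≤ B * |s - t| := by
    have := Convex.norm_image_sub_le_of_norm_deriv_le (f := θ) (s := univ) (x := t) (y := s) (C := B)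
      (fun x _ => hθ.differentiable (by simp) x) (fun x _ => hB x) convex_univ (mem_univ _)
      (mem_univ _)
    simpa using this
  have pm := (Lp.memLp p.fst).1
  have cm {f : Plane → ℝ} (hf : AEStronglyMeasurable f (volume.restrict Ω)) :
      AEStronglyMeasurable (fun x => deriv θ (f x)) (volume.restrict Ω) :=
    hd.comp_aestronglyMeasurable hf
  have mS (a : Plane → ℝ) (ha : AEStronglyMeasurable a (volume.restrict Ω)) {D : ℝ}
      (hD : ∀ x, |a x| ≤ D) :
      MemLp (fun x => a x • p.snd x) 2 (volume.restrict Ω) :=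
    (Lp.memLp p.snd).of_le_mul (c := D) (ha.smul (Lp.memLp p.snd).1) (.of_forall fun x => by
      rw [norm_smul]; gcongr; exact hD x)
  refine ⟨φ, hφ, fun n => ((hφ n).comp hθ h0).1, ?_, ?_, ?_, ?_, ?_⟩
  · exact tendsto_l2n_of_le_mul (B := B) (fun n => (hφ n).memLp.sub (Lp.memLp p.fst))
      (fun n => .of_forall fun x => hlip _ _) l1
  · have hA (n : ℕ) : MemLp (fun x => deriv θ (φ n x) • (∇ (φ n) x - p.snd x)) 2
        (volume.restrict Ω) :=
      ((hφ n).memLp_gradient.sub (Lp.memLp p.snd)).of_le_mul (c := B)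
        ((cm (hφ n).memLp.1).smul ((hφ n).memLp_gradient.sub (Lp.memLp p.snd)).1)
        (.of_forall fun x => by
          rw [norm_smul]; exact mul_le_mul_of_nonneg_right (hB _) (norm_nonneg _))
    have hB2 (n : ℕ) (x : Plane) : |deriv θ (φ n x) - deriv θ (p.fst x)| ≤ 2 * B := by
      have := abs_sub (deriv θ (φ n x)) (deriv θ (p.fst x))
      linarith [hB (φ n x), hB (p.fst x)]
    have hC (n : ℕ) : MemLp (fun x => (deriv θ (φ n x) - deriv θ (p.fst x)) • p.snd x) 2
        (volume.restrict Ω) :=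
      mS _ ((cm (hφ n).memLp.1).sub (cm pm)) (hB2 n)
    have t1 : Filter.Tendsto (fun n => l2n (volume.restrict Ω)
        (fun x => deriv θ (φ n x) • (∇ (φ n) x - p.snd x))) Filter.atTop (nhds 0) :=
      tendsto_l2n_of_le_mul (B := B) (fun n => (hφ n).memLp_gradient.sub (Lp.memLp p.snd))
        (fun n => .of_forall fun x => by
          rw [norm_smul]; exact mul_le_mul_of_nonneg_right (hB _) (norm_nonneg _)) l2
    -- Here only the coefficient converges, pointwise almost everywhere; it is bounded, so dominated
    -- convergence applies.
    have t2 : Filter.Tendsto (fun n => l2n (volume.restrict Ω)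
        (fun x => (deriv θ (φ n x) - deriv θ (p.fst x)) • p.snd x)) Filter.atTop (nhds 0) := by
      refine tendsto_l2n_of_dominated (G := fun x => (2 * B) • p.snd x) (fun n => (hC n).1)
        ((Lp.memLp p.snd).const_smul (2 * B)) (fun n => .of_forall fun x => ?_) ?_
      · rw [norm_smul, norm_smul, Real.norm_of_nonneg (by positivity : 0 ≤ 2 * B)]
        gcongr
        exact hB2 n x
      · filter_upwards [a1] with x hx
        have := (((hd.tendsto (p.fst x)).comp hx).sub_const (deriv θ (p.fst x))).smul_const (p.snd x)
        simpa using this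
    refine (tendsto_l2n_add hA hC t1 t2).congr fun n => ?_
    refine l2n_congr (.of_forall fun x => ?_)
    dsimp only
    rw [((hφ n).comp hθ h0).2 x, smul_sub, sub_smul]
    abel
  · filter_upwards [a1] with x hx using (hθ.continuous.tendsto _).comp hx
  · refine (Lp.memLp p.fst).of_le_mul (c := B) (hθ.continuous.comp_aestronglyMeasurable pm)
      (.of_forall fun x => ?_)
    have := hlip (p.fst x) 0
    rwa [h0, sub_zero, sub_zero] at this
  · exact mS _ (cm pm) fun x => hB _

/-- The chain rule in `H¹₀`. -/
theorem comp_weakPair {p : GradPair Ω} (hp : p ∈ H10 Ω) {θ : ℝ → ℝ}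
    (hθ : ContDiff ℝ ∞ θ) (h0 : θ 0 = 0) {B : ℝ} (hB : ∀ s, |deriv θ s| ≤ B) :
    WeakPair (H10 Ω) (fun x => θ (p.fst x)) (fun x => deriv θ (p.fst x) • p.snd x) := by
  obtain ⟨φ, -, h1, h2, h3, -, h5, h6⟩ := exists_test_seq_comp hp hθ h0 hB
  exact WeakPair.of_tendsto_l2n isClosed_H10 (fun n => (h1 n).weakPair) h5 h6 h2 h3

/-- A smooth approximation of the positive part. -/
def smoothPos (s : ℝ) : ℝ := s * Real.smoothTransition s

theorem contDiff_smoothPos : ContDiff ℝ ∞ smoothPos :=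
  contDiff_id.mul Real.smoothTransition.contDiff

theorem smoothPos_of_nonpos {s : ℝ} (h : s ≤ 0) : smoothPos s = 0 := by
  rw [smoothPos, Real.smoothTransition.zero_of_nonpos h, mul_zero]

theorem smoothPos_of_one_le {s : ℝ} (h : 1 ≤ s) : smoothPos s = s := by
  rw [smoothPos, Real.smoothTransition.one_of_one_le h, mul_one]

theorem abs_smoothPos_le (s : ℝ) : |smoothPos s| ≤ max s 0 := by
  rcases le_total s 0 with h | h
  · simp [smoothPos_of_nonpos h]
  · rw [smoothPos, abs_mul, abs_of_nonneg h, abs_of_nonneg (Real.smoothTransition.nonneg s),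
      max_eq_left h]
    exact mul_le_of_le_one_right h (Real.smoothTransition.le_one s)

theorem deriv_smoothPos_of_nonpos {s : ℝ} (h : s ≤ 0) : deriv smoothPos s = 0 := by
  have hc : Continuous (deriv smoothPos) := contDiff_smoothPos.continuous_deriv (by simp)
  have h1 : Iio (0 : ℝ) ⊆ {s | deriv smoothPos s = 0} := fun x hx => by
    have : smoothPos =ᶠ[nhds x] fun _ => 0 := by
      filter_upwards [Iio_mem_nhds hx] with y hy using smoothPos_of_nonpos hy.le
    simp [this.deriv_eq]
  have h2 := closure_minimal h1 (isClosed_eq hc continuous_const)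
  rw [closure_Iio] at h2
  exact h2 h

theorem deriv_smoothPos_of_one_lt {s : ℝ} (h : 1 < s) : deriv smoothPos s = 1 := by
  have : smoothPos =ᶠ[nhds s] id := by
    filter_upwards [Ioi_mem_nhds h] with y hy using smoothPos_of_one_le (le_of_lt hy)
  rw [this.deriv_eq, deriv_id]

theorem exists_deriv_smoothPos_bound : ∃ B, ∀ s, |deriv smoothPos s| ≤ B := by
  have hc : Continuous (deriv smoothPos) := contDiff_smoothPos.continuous_deriv (by simp)
  obtain ⟨B, hB⟩ := (isCompact_Icc (a := (0 : ℝ)) (b := 1)).exists_bound_of_continuousOn hc.continuousOn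
  refine ⟨max B 1, fun s => ?_⟩
  rcases le_or_gt s 0 with h | h
  · rw [deriv_smoothPos_of_nonpos h]; simp
  rcases le_or_gt s 1 with h' | h'
  · exact (hB s ⟨h.le, h'⟩).trans (le_max_left _ _)
  · rw [deriv_smoothPos_of_one_lt h']; simp

/-- Truncation in `H¹₀`. -/
theorem truncation_weakPair {p : GradPair Ω} (hp : p ∈ H10 Ω) {k : ℝ} (hk : 0 ≤ k) :
    WeakPair (H10 Ω) (fun x => max (p.fst x - k) 0)
      (fun x => (if k < p.fst x then (1 : ℝ) else 0) • p.snd x) := by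
  obtain ⟨B, hB⟩ := exists_deriv_smoothPos_bound
  have hB0 : 0 ≤ B := (abs_nonneg _).trans (hB 0)
  have hB1 : 1 ≤ B := by have := hB 2; rwa [deriv_smoothPos_of_one_lt (by norm_num), abs_one] at this
  -- Rescaled copies of `smoothPos`. As `k ≥ 0`, they vanish at zero and map test functions to test
  -- functions; their derivatives are bounded uniformly in `n`.
  let θ : ℕ → ℝ → ℝ := fun n s => ((n : ℝ) + 1)⁻¹ * smoothPos (((n : ℝ) + 1) * (s - k))
  have hN (n : ℕ) : (0 : ℝ) < n + 1 := by positivity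
  have hθ (n : ℕ) : ContDiff ℝ ∞ (θ n) := by
    refine contDiff_const.mul (contDiff_smoothPos.comp ?_)
    exact contDiff_const.mul (contDiff_id.sub contDiff_const)
  have hθd (n : ℕ) (s : ℝ) : deriv (θ n) s = deriv smoothPos (((n : ℝ) + 1) * (s - k)) := by
    have h1 : HasDerivAt (fun s => ((n : ℝ) + 1) * (s - k)) ((n : ℝ) + 1) s := by
      simpa using ((hasDerivAt_id s).sub_const k).const_mul ((n : ℝ) + 1)
    have h2 : HasDerivAt smoothPos (deriv smoothPos (((n : ℝ) + 1) * (s - k)))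
        (((n : ℝ) + 1) * (s - k)) :=
      (contDiff_smoothPos.differentiable (by simp) _).hasDerivAt
    have h3 := ((h2.comp s h1).const_mul (((n : ℝ) + 1)⁻¹)).deriv
    have h4 : θ n = fun y => ((n : ℝ) + 1)⁻¹ * (smoothPos ∘ fun s => ((n : ℝ) + 1) * (s - k)) y := rfl
    rw [h4, h3]
    have := (hN n).ne'
    field_simp
  have hθ0 (n : ℕ) : θ n 0 = 0 := by
    have : smoothPos (((n : ℝ) + 1) * (0 - k)) = 0 := smoothPos_of_nonpos
      (mul_nonpos_of_nonneg_of_nonpos (hN n).le (by linarith))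
    simp only [θ, this, mul_zero]
  have hθb (n : ℕ) (s : ℝ) : |θ n s| ≤ max (s - k) 0 := by
    simp only [θ]
    rw [abs_mul, abs_of_pos (inv_pos.2 (hN n)), inv_mul_le_iff₀ (hN n)]
    refine (abs_smoothPos_le _).trans ?_
    rw [mul_max_of_nonneg _ _ (hN n).le, mul_zero]
  have hmaxle (s : ℝ) : max (s - k) 0 ≤ |s| :=
    max_le (by linarith [le_abs_self s]) (abs_nonneg s)
  have hbig {s : ℝ} (hs : k < s) : ∀ᶠ n : ℕ in Filter.atTop, 1 < ((n : ℝ) + 1) * (s - k) := by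
    have := (Filter.tendsto_atTop_add_const_right Filter.atTop (1 : ℝ)
      (tendsto_natCast_atTop_atTop (R := ℝ))).atTop_mul_const (sub_pos.2 hs)
    exact this.eventually_gt_atTop 1
  have hθt (s : ℝ) : Filter.Tendsto (fun n => θ n s) Filter.atTop (nhds (max (s - k) 0)) := by
    rcases le_or_gt s k with h | h
    · have : (fun n => θ n s) = fun _ => (0 : ℝ) := by
        ext n
        have : smoothPos (((n : ℝ) + 1) * (s - k)) = 0 := smoothPos_of_nonpos
          (mul_nonpos_of_nonneg_of_nonpos (hN n).le (by linarith))
        simp only [θ, this, mul_zero]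
      rw [this, max_eq_right (by linarith)]
      exact tendsto_const_nhds
    · refine tendsto_const_nhds.congr' ?_
      filter_upwards [hbig h] with n hn
      simp only [θ]
      rw [smoothPos_of_one_le hn.le, max_eq_left (by linarith), inv_mul_cancel_left₀ (hN n).ne']
  -- At `s = k` the limit is zero because the derivative of `smoothPos` vanishes at zero. The
  -- convergence thus holds everywhere, and nothing has to be known about the gradient on the level
  -- set.
  have hθdt (s : ℝ) : Filter.Tendsto (fun n => deriv (θ n) s) Filter.atTop
      (nhds (if k < s then 1 else 0)) := by
    simp only [hθd]
    rcases le_or_gt s k with h | h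
    · have : (fun n : ℕ => deriv smoothPos (((n : ℝ) + 1) * (s - k))) = fun _ => (0 : ℝ) := by
        ext n
        exact deriv_smoothPos_of_nonpos
          (mul_nonpos_of_nonneg_of_nonpos (hN n).le (by linarith))
      rw [this, if_neg (not_lt.2 h)]
      exact tendsto_const_nhds
    · rw [if_pos h]
      refine tendsto_const_nhds.congr' ?_
      filter_upwards [hbig h] with n hn
      rw [deriv_smoothPos_of_one_lt hn]
  have hw (n : ℕ) := comp_weakPair hp (hθ n) (hθ0 n) (B := B) fun s => by rw [hθd]; exact hB _
  have m1 : MemLp (fun x => max (p.fst x - k) 0) 2 (volume.restrict Ω) := by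
    refine (Lp.memLp p.fst).mono ?_ (.of_forall fun x => ?_)
    · exact (show Continuous fun s : ℝ => max (s - k) 0 by fun_prop).comp_aestronglyMeasurable
        (Lp.memLp p.fst).1
    · rw [Real.norm_of_nonneg (le_max_right _ _)]; exact hmaxle _
  have hif : AEStronglyMeasurable (fun x => if k < p.fst x then (1 : ℝ) else 0) (volume.restrict Ω) :=
    ((measurable_const.ite measurableSet_Ioi measurable_const :
      Measurable fun s : ℝ => if s ∈ Ioi k then (1 : ℝ) else 0).comp_aemeasurable
        (Lp.memLp p.fst).1.aemeasurable).aestronglyMeasurable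
  have m2 : MemLp (fun x => (if k < p.fst x then (1 : ℝ) else 0) • p.snd x) 2
      (volume.restrict Ω) := by
    refine (Lp.memLp p.snd).mono (hif.smul (Lp.memLp p.snd).1) (.of_forall fun x => ?_)
    split_ifs <;> simp
  refine WeakPair.of_tendsto_l2n isClosed_H10 hw m1 m2 ?_ ?_
  · refine tendsto_l2n_of_dominated (G := fun x => (2 : ℝ) • p.fst x)
      (fun n => ((hw n).memLp_fst.sub m1).1) ((Lp.memLp p.fst).const_smul (2 : ℝ))
      (fun n => .of_forall fun x => ?_) (.of_forall fun x => ?_)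
    · have h1 := hθb n (p.fst x)
      have h2 := hmaxle (p.fst x)
      have h3 : |max (p.fst x - k) 0| = max (p.fst x - k) 0 := abs_of_nonneg (le_max_right _ _)
      rw [norm_smul, Real.norm_eq_abs, Real.norm_eq_abs, Real.norm_eq_abs]
      have h4 := abs_sub (θ n (p.fst x)) (max (p.fst x - k) 0)
      rw [abs_of_pos (by norm_num : (0 : ℝ) < 2)]
      linarith
    · simpa using (hθt (p.fst x)).sub_const (max (p.fst x - k) 0)
  · refine tendsto_l2n_of_dominated (G := fun x => (B + 1) • p.snd x)
      (fun n => ((hw n).memLp_snd.sub m2).1) ((Lp.memLp p.snd).const_smul (B + 1))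
      (fun n => .of_forall fun x => ?_) (.of_forall fun x => ?_)
    · rw [← sub_smul, norm_smul, norm_smul, Real.norm_of_nonneg (by positivity : 0 ≤ B + 1)]
      refine mul_le_mul_of_nonneg_right ?_ (norm_nonneg _)
      refine (norm_sub_le _ _).trans (add_le_add ?_ ?_)
      · rw [hθd]; exact hB _
      · split_ifs <;> simp
    · have := ((hθdt (p.fst x)).sub_const (if k < p.fst x then (1 : ℝ) else 0)).smul_const (p.snd x)
      simpa [sub_smul] using this

/-- A smooth bounded function which is the identity near `[-K, K]`. -/
theorem exists_smooth_cutoff (K : ℝ) : ∃ θ : ℝ → ℝ, ∃ B : ℝ, ContDiff ℝ ∞ θ ∧ θ 0 = 0 ∧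
    (∀ s, |θ s| ≤ B) ∧ (∀ s, |deriv θ s| ≤ B) ∧
    (∀ s, |s| ≤ K → θ s = s ∧ deriv θ s = 1) := by
  -- The plateau reaches beyond `|K|`, so the product is the identity in a neighbourhood of each
  -- point of `[-K, K]` and its derivative there is one.
  let χ : ContDiffBump (0 : ℝ) := ⟨|K| + 1, |K| + 2, by positivity, by linarith⟩
  have hc : ContDiff ℝ ∞ fun s : ℝ => s * χ s := contDiff_id.mul χ.contDiff
  have hs : HasCompactSupport fun s : ℝ => s * χ s := χ.hasCompactSupport.mul_left
  obtain ⟨B1, h1⟩ := hs.exists_bound_of_continuous hc.continuous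
  obtain ⟨B2, h2⟩ := hs.deriv.exists_bound_of_continuous (hc.continuous_deriv (by simp))
  refine ⟨fun s => s * χ s, max B1 B2, hc, by simp, fun s => (h1 s).trans (le_max_left _ _),
    fun s => (h2 s).trans (le_max_right _ _), fun s hs => ?_⟩
  have hsK : |s| < |K| + 1 := by linarith [le_abs_self K]
  have hev : (fun s : ℝ => s * χ s) =ᶠ[nhds s] id := by
    have : Metric.ball (0 : ℝ) (|K| + 1) ∈ nhds s :=
      Metric.isOpen_ball.mem_nhds (by simpa using hsK)
    filter_upwards [this] with y hy
    rw [χ.one_of_mem_closedBall (Metric.ball_subset_closedBall hy), mul_one, id]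
  exact ⟨hev.self_of_nhds, by rw [hev.deriv_eq, deriv_id]⟩

/-- The product of a bounded element of `H¹₀` and a bounded element of `H¹` lies in `H¹₀`. -/
theorem mul_weakPair (hΩ : IsOpen Ω) {p : GradPair Ω} (hp : p ∈ H10 Ω) {K : ℝ}
    (hK : ∀ᵐ x ∂volume.restrict Ω, |p.fst x| ≤ K) {δ : GradPair Ω} (hδ : δ ∈ H1 Ω) {B : ℝ}
    (hB : ∀ᵐ x ∂volume.restrict Ω, |δ.fst x| ≤ B) :
    WeakPair (H10 Ω) (fun x => p.fst x * δ.fst x)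
      (fun x => p.fst x • δ.snd x + δ.fst x • p.snd x) := by
  -- Composing with the cutoff bounds the approximating test functions uniformly and does not change
  -- their limit `p`. The uniform bound supplies the majorant for the term with `δ.snd`.
  obtain ⟨θ, D, hθ, h0, hD, hD', hid⟩ := exists_smooth_cutoff K
  obtain ⟨φ, -, h1, h2, h3, h4, h5, h6⟩ := exists_test_seq_comp hp hθ h0 hD'
  have c1 : (fun x => θ (p.fst x)) =ᵐ[volume.restrict Ω] p.fst := by
    filter_upwards [hK] with x hx using (hid _ hx).1
  have c2 : (fun x => deriv θ (p.fst x) • p.snd x) =ᵐ[volume.restrict Ω] p.snd := by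
    filter_upwards [hK] with x hx
    rw [(hid _ hx).2, one_smul]
  have hKD : ∀ᵐ x ∂volume.restrict Ω, |p.fst x| ≤ D := by
    filter_upwards [c1] with x hx
    rw [← hx]; exact hD _
  have hw (n : ℕ) := (h1 n).mul_weakPair hΩ hδ
  have pm := (Lp.memLp p.fst).1
  have dm := (Lp.memLp δ.fst).1
  have m1 : MemLp (fun x => p.fst x * δ.fst x) 2 (volume.restrict Ω) := by
    refine (Lp.memLp δ.fst).of_le_mul (c := D) (pm.mul dm) ?_
    filter_upwards [hKD] with x hx
    rw [norm_mul]; gcongr; exact hx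
  have m2 : MemLp (fun x => p.fst x • δ.snd x) 2 (volume.restrict Ω) := by
    refine (Lp.memLp δ.snd).of_le_mul (c := D) (pm.smul (Lp.memLp δ.snd).1) ?_
    filter_upwards [hKD] with x hx
    rw [norm_smul]; gcongr; exact hx
  have m3 : MemLp (fun x => δ.fst x • p.snd x) 2 (volume.restrict Ω) := by
    refine (Lp.memLp p.snd).of_le_mul (c := B) (dm.smul (Lp.memLp p.snd).1) ?_
    filter_upwards [hB] with x hx
    rw [norm_smul]; gcongr; exact hx
  have n1 (n : ℕ) : MemLp (fun x => θ (φ n x) - p.fst x) 2 (volume.restrict Ω) :=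
    (h1 n).memLp.sub (Lp.memLp p.fst)
  have n2 (n : ℕ) : MemLp (fun x => ∇ (fun x => θ (φ n x)) x - p.snd x) 2 (volume.restrict Ω) :=
    (h1 n).memLp_gradient.sub (Lp.memLp p.snd)
  have l1 : Filter.Tendsto (fun n => l2n (volume.restrict Ω) (fun x => θ (φ n x) - p.fst x))
      Filter.atTop (nhds 0) := h2.congr fun n => l2n_congr (by
        filter_upwards [c1] with x hx; rw [hx])
  have l2 : Filter.Tendsto (fun n => l2n (volume.restrict Ω)
      (fun x => ∇ (fun x => θ (φ n x)) x - p.snd x)) Filter.atTop (nhds 0) :=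
    h3.congr fun n => l2n_congr (by filter_upwards [c2] with x hx; rw [hx])
  refine WeakPair.of_tendsto_l2n isClosed_H10 hw m1 (m2.add m3) ?_ ?_
  · refine tendsto_l2n_of_le_mul (B := B) n1 (fun n => ?_) l1
    filter_upwards [hB] with x hx
    rw [← sub_mul, norm_mul, mul_comm]
    gcongr
    exact hx
  · have q1 (n : ℕ) : MemLp (fun x => (θ (φ n x) - p.fst x) • δ.snd x) 2 (volume.restrict Ω) := by
      refine (Lp.memLp δ.snd).of_le_mul (c := 2 * D) ((n1 n).1.smul (Lp.memLp δ.snd).1) ?_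
      filter_upwards [hKD] with x hx
      rw [norm_smul]
      gcongr
      exact (norm_sub_le _ _).trans (by rw [two_mul]; exact add_le_add (hD _) hx)
    have q2 (n : ℕ) : MemLp (fun x => δ.fst x • (∇ (fun x => θ (φ n x)) x - p.snd x)) 2
        (volume.restrict Ω) := by
      refine (n2 n).of_le_mul (c := B) (dm.smul (n2 n).1) ?_
      filter_upwards [hB] with x hx
      rw [norm_smul]; gcongr; exact hx
    have t1 : Filter.Tendsto (fun n => l2n (volume.restrict Ω)
        (fun x => (θ (φ n x) - p.fst x) • δ.snd x)) Filter.atTop (nhds 0) := by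
      refine tendsto_l2n_of_dominated (G := fun x => (2 * D) • δ.snd x) (fun n => (q1 n).1)
        ((Lp.memLp δ.snd).const_smul (2 * D)) (fun n => ?_) ?_
      · filter_upwards [hKD] with x hx
        rw [norm_smul, norm_smul]
        gcongr
        refine (norm_sub_le _ _).trans (le_trans ?_ (le_abs_self _))
        rw [two_mul]; exact add_le_add (hD _) hx
      · filter_upwards [h4, c1] with x hx hx'
        rw [hx'] at hx
        simpa using (hx.sub_const (p.fst x)).smul_const (δ.snd x)
    have t2 : Filter.Tendsto (fun n => l2n (volume.restrict Ω)
        (fun x => δ.fst x • (∇ (fun x => θ (φ n x)) x - p.snd x))) Filter.atTop (nhds 0) := by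
      refine tendsto_l2n_of_le_mul (B := B) n2 (fun n => ?_) l2
      filter_upwards [hB] with x hx
      rw [norm_smul]; gcongr; exact hx
    refine (tendsto_l2n_add q1 q2 t1 t2).congr fun n => l2n_congr (.of_forall fun x => ?_)
    dsimp only
    rw [sub_smul, smul_sub]
    abel

end ChainRule

/-! ### Boundedness and Gårding's inequality for the elliptic form -/

section Form

variable {Ω : Set Plane}

theorem coeFn_add_fst (p r : GradPair Ω) :
    (p + r).fst =ᵐ[volume.restrict Ω] fun x => p.fst x + r.fst x := Lp.coeFn_add p.fst r.fst

theorem coeFn_add_snd (p r : GradPair Ω) :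
    (p + r).snd =ᵐ[volume.restrict Ω] fun x => p.snd x + r.snd x := Lp.coeFn_add p.snd r.snd

theorem coeFn_sub_fst (p r : GradPair Ω) :
    (p - r).fst =ᵐ[volume.restrict Ω] fun x => p.fst x - r.fst x := Lp.coeFn_sub p.fst r.fst

theorem coeFn_smul_fst (a : ℝ) (p : GradPair Ω) :
    (a • p).fst =ᵐ[volume.restrict Ω] fun x => a * p.fst x := Lp.coeFn_smul a p.fst

theorem coeFn_smul_snd (a : ℝ) (p : GradPair Ω) :
    (a • p).snd =ᵐ[volume.restrict Ω] fun x => a • p.snd x := Lp.coeFn_smul a p.snd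

theorem ae_abs_le_norm {μ : Measure Plane} (c : Lp ℝ ⊤ μ) : ∀ᵐ x ∂μ, |c x| ≤ ‖c‖ := by
  have h := ae_le_eLpNormEssSup (f := c) (μ := μ)
  filter_upwards [h] with x hx
  rw [Lp.norm_def, eLpNorm_exponent_top]
  have hfin : eLpNormEssSup c μ ≠ ⊤ := by
    rw [← eLpNorm_exponent_top]; exact (Lp.memLp c).eLpNorm_ne_top
  simpa using ENNReal.toReal_mono hfin hx

theorem abs_apply_le_norm (z : Plane) (j : Fin 2) : |z j| ≤ ‖z‖ := by
  simpa using PiLp.norm_apply_le z j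

theorem aestronglyMeasurable_snd_apply (φ : GradPair Ω) (j : Fin 2) :
    AEStronglyMeasurable (fun x => φ.snd x j) (volume.restrict Ω) :=
  (EuclideanSpace.proj (𝕜 := ℝ) j).continuous.comp_aestronglyMeasurable (Lp.memLp φ.snd).1

theorem memLp_snd_apply (φ : GradPair Ω) (j : Fin 2) :
    MemLp (fun x => φ.snd x j) 2 (volume.restrict Ω) :=
  (Lp.memLp φ.snd).mono (aestronglyMeasurable_snd_apply φ j)
    (.of_forall fun _ => abs_apply_le_norm _ _)

theorem diffusion_bound {q : GradPair Ω} {Q : ℝ}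
    (hq : ∀ᵐ x ∂volume.restrict Ω, |q.fst x| ≤ Q) (hQ : 0 ≤ Q) (v φ : GradPair Ω) :
    Integrable (fun x => q.fst x * inner ℝ (v.snd x) (φ.snd x)) (volume.restrict Ω) ∧
      |∫ x in Ω, q.fst x * inner ℝ (v.snd x) (φ.snd x)| ≤ Q * ‖v.snd‖ * ‖φ.snd‖ := by
  have hb : ∀ᵐ x ∂volume.restrict Ω, |q.fst x * inner ℝ (v.snd x) (φ.snd x)| ≤
      ‖(Q • v.snd x : Plane)‖ * ‖φ.snd x‖ := by
    filter_upwards [hq] with x hx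
    rw [abs_mul, norm_smul, Real.norm_of_nonneg hQ, mul_assoc]
    exact mul_le_mul hx (abs_real_inner_le_norm _ _) (abs_nonneg _) hQ
  have hm : MemLp (fun x => Q • v.snd x) 2 (volume.restrict Ω) := (Lp.memLp v.snd).const_smul Q
  refine ⟨(integrable_norm_mul_norm hm (Lp.memLp φ.snd)).mono'
    ((Lp.memLp q.fst).1.mul ((Lp.memLp v.snd).1.inner (Lp.memLp φ.snd).1)) hb, ?_⟩
  refine (abs_integral_le_l2n hm (Lp.memLp φ.snd) hb).trans_eq ?_
  rw [l2n_const_smul, abs_of_nonneg hQ, ← norm_eq_l2n, ← norm_eq_l2n]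

theorem reaction_bound (c : Lp ℝ ⊤ (volume.restrict Ω)) (v φ : GradPair Ω) :
    Integrable (fun x => c x * v.fst x * φ.fst x) (volume.restrict Ω) ∧
      |∫ x in Ω, c x * v.fst x * φ.fst x| ≤ ‖c‖ * ‖v.fst‖ * ‖φ.fst‖ := by
  have hb : ∀ᵐ x ∂volume.restrict Ω, |c x * v.fst x * φ.fst x| ≤
      ‖‖c‖ • v.fst x‖ * ‖φ.fst x‖ := by
    filter_upwards [ae_abs_le_norm c] with x hx
    rw [abs_mul, abs_mul, norm_smul, norm_norm]
    exact mul_le_mul_of_nonneg_right (mul_le_mul_of_nonneg_right hx (abs_nonneg _)) (abs_nonneg _)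
  have hm : MemLp (fun x => ‖c‖ • v.fst x) 2 (volume.restrict Ω) := (Lp.memLp v.fst).const_smul ‖c‖
  refine ⟨(integrable_norm_mul_norm hm (Lp.memLp φ.fst)).mono'
    (((Lp.memLp c).1.mul (Lp.memLp v.fst).1).mul (Lp.memLp φ.fst).1) hb, ?_⟩
  refine (abs_integral_le_l2n hm (Lp.memLp φ.fst) hb).trans_eq ?_
  rw [l2n_const_smul, abs_of_nonneg (norm_nonneg c), ← norm_eq_l2n, ← norm_eq_l2n]

theorem ellipticForm_smul_left (q : H1 Ω) (b : Fin 2 → H1 Ω)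
    (c : Lp ℝ ⊤ (volume.restrict Ω)) (a : ℝ) (v φ : GradPair Ω) :
    ellipticForm q b c (a • v) φ = a * ellipticForm q b c v φ := by
  rw [ellipticForm, ellipticForm, ← integral_const_mul]
  refine integral_congr_ae ?_
  filter_upwards [coeFn_smul_fst a v, coeFn_smul_snd a v] with x h1 h2
  rw [h1, h2, real_inner_smul_left]
  ring

theorem ellipticForm_smul_right (q : H1 Ω) (b : Fin 2 → H1 Ω)
    (c : Lp ℝ ⊤ (volume.restrict Ω)) (a : ℝ) (v φ : GradPair Ω) :
    ellipticForm q b c v (a • φ) = a * ellipticForm q b c v φ := by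
  rw [ellipticForm, ellipticForm, ← integral_const_mul]
  refine integral_congr_ae ?_
  filter_upwards [coeFn_smul_fst a φ, coeFn_smul_snd a φ] with x h1 h2
  rw [h1, h2, real_inner_smul_right]
  simp only [PiLp.smul_apply, smul_eq_mul, Fin.sum_univ_two]
  ring

/-- The inclusion of `H¹₀` into `L²`. -/
def inclL2 (Ω : Set Plane) : ↥(H10 Ω) →L[ℝ] L2 Ω :=
  (WithLp.fstL 2 ℝ (L2 Ω) (L2Vec Ω)).comp (H10 Ω).subtypeL

theorem inclL2_apply (v : ↥(H10 Ω)) : inclL2 Ω v = v.1.fst := rfl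

theorem norm_inclL2_le (v : ↥(H10 Ω)) : ‖inclL2 Ω v‖ ≤ ‖v‖ := norm_gradPair_fst_le v.1

variable [IsFiniteMeasure (volume.restrict Ω)]

theorem transport_bound (hΩ : IsOpen Ω) {v β : GradPair Ω} (hv : v ∈ H10 Ω) (hβ : β ∈ H1 Ω)
    (φ : GradPair Ω) (j : Fin 2) :
    Integrable (fun x => v.fst x * (β.fst x * φ.snd x j)) (volume.restrict Ω) ∧
      |∫ x in Ω, v.fst x * (β.fst x * φ.snd x j)| ≤
        l2n (volume.restrict Ω) (fun x => v.fst x * β.fst x) * ‖φ.snd‖ := by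
  obtain ⟨S, hS, h⟩ := exists_mul_bound hΩ
  have hm := (h v hv β hβ).1
  have hb : ∀ᵐ x ∂volume.restrict Ω, |v.fst x * (β.fst x * φ.snd x j)| ≤
      ‖v.fst x * β.fst x‖ * ‖φ.snd x‖ := .of_forall fun x => by
    rw [← mul_assoc, abs_mul]
    exact mul_le_mul_of_nonneg_left (abs_apply_le_norm _ _) (abs_nonneg _)
  refine ⟨(integrable_norm_mul_norm hm (Lp.memLp φ.snd)).mono'
    ((Lp.memLp v.fst).1.mul ((Lp.memLp β.fst).1.mul (aestronglyMeasurable_snd_apply φ j))) hb, ?_⟩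
  rw [norm_eq_l2n]
  exact abs_integral_le_l2n hm (Lp.memLp φ.snd) hb

/-- Splitting the integral needs integrability of the transport term, which holds because the
product of an element of `H10` with an element of `H1` is in `L²`. -/
theorem ellipticForm_eq (hΩ : IsOpen Ω) {q : H1 Ω} {Q : ℝ}
    (hq : ∀ᵐ x ∂volume.restrict Ω, |q.1.fst x| ≤ Q) (hQ : 0 ≤ Q) (b : Fin 2 → H1 Ω)
    (c : Lp ℝ ⊤ (volume.restrict Ω)) {v : GradPair Ω} (hv : v ∈ H10 Ω) (φ : GradPair Ω) :
    ellipticForm q b c v φ = (∫ x in Ω, q.1.fst x * inner ℝ (v.snd x) (φ.snd x))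
      - (∑ j, ∫ x in Ω, v.fst x * ((b j).1.fst x * φ.snd x j))
      + ∫ x in Ω, c x * v.fst x * φ.fst x := by
  have i1 := (diffusion_bound hq hQ v φ).1
  have i2 (j : Fin 2) := (transport_bound hΩ hv (b j).2 φ j).1
  have i3 := (reaction_bound c v φ).1
  have i4 := integrable_finsetSum Finset.univ fun j _ => i2 j
  have e := integral_add (i1.sub i4) i3
  have e' := integral_sub i1 i4
  simp only [Pi.sub_apply] at e
  rw [← integral_finsetSum _ fun j _ => i2 j, ← e', ← e, ellipticForm]
  simp only [Finset.mul_sum]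

theorem ellipticForm_add_left (hΩ : IsOpen Ω) {q : H1 Ω} {Q : ℝ}
    (hq : ∀ᵐ x ∂volume.restrict Ω, |q.1.fst x| ≤ Q) (hQ : 0 ≤ Q) (b : Fin 2 → H1 Ω)
    (c : Lp ℝ ⊤ (volume.restrict Ω)) {v w : GradPair Ω} (hv : v ∈ H10 Ω) (hw : w ∈ H10 Ω)
    (φ : GradPair Ω) :
    ellipticForm q b c (v + w) φ = ellipticForm q b c v φ + ellipticForm q b c w φ := by
  have i (v : GradPair Ω) (hv : v ∈ H10 Ω) := ((diffusion_bound hq hQ v φ).1.sub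
    (integrable_finsetSum Finset.univ fun j _ => (transport_bound hΩ hv (b j).2 φ j).1)).add
    (reaction_bound c v φ).1
  have i' (v : GradPair Ω) (hv : v ∈ H10 Ω) : Integrable (fun x => q.1.fst x * inner ℝ (v.snd x) (φ.snd x)
    - v.fst x * (∑ j, (b j).1.fst x * φ.snd x j)
    + c x * v.fst x * φ.fst x) (volume.restrict Ω) := by
    refine (i v hv).congr (.of_forall fun x => ?_)
    simp only [Pi.add_apply, Pi.sub_apply, Finset.mul_sum]
  rw [ellipticForm, ellipticForm, ellipticForm, ← integral_add (i' v hv) (i' w hw)]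
  refine integral_congr_ae ?_
  filter_upwards [coeFn_add_fst v w, coeFn_add_snd v w] with x h1 h2
  rw [h1, h2, inner_add_left]
  ring

theorem ellipticForm_add_right (hΩ : IsOpen Ω) {q : H1 Ω} {Q : ℝ}
    (hq : ∀ᵐ x ∂volume.restrict Ω, |q.1.fst x| ≤ Q) (hQ : 0 ≤ Q) (b : Fin 2 → H1 Ω)
    (c : Lp ℝ ⊤ (volume.restrict Ω)) {v : GradPair Ω} (hv : v ∈ H10 Ω) (φ ψ : GradPair Ω) :
    ellipticForm q b c v (φ + ψ) = ellipticForm q b c v φ + ellipticForm q b c v ψ := by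
  have i (φ : GradPair Ω) := ((diffusion_bound hq hQ v φ).1.sub
    (integrable_finsetSum Finset.univ fun j _ => (transport_bound hΩ hv (b j).2 φ j).1)).add
    (reaction_bound c v φ).1
  have i' (φ : GradPair Ω) : Integrable (fun x => q.1.fst x * inner ℝ (v.snd x) (φ.snd x)
    - v.fst x * (∑ j, (b j).1.fst x * φ.snd x j)
    + c x * v.fst x * φ.fst x) (volume.restrict Ω) := by
    refine (i φ).congr (.of_forall fun x => ?_)
    simp only [Pi.add_apply, Pi.sub_apply, Finset.mul_sum]
  rw [ellipticForm, ellipticForm, ellipticForm, ← integral_add (i' φ) (i' ψ)]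
  refine integral_congr_ae ?_
  filter_upwards [coeFn_add_fst φ ψ, coeFn_add_snd φ ψ] with x h1 h2
  rw [h1, h2, inner_add_right]
  simp only [PiLp.add_apply, mul_add, Finset.sum_add_distrib]
  ring

/-- The elliptic form is bounded on `H¹₀`, uniformly with respect to the diffusion coefficient. -/
theorem exists_ellipticForm_bound (hΩ : IsOpen Ω) (b : Fin 2 → H1 Ω)
    (c : Lp ℝ ⊤ (volume.restrict Ω)) {Q : ℝ} (hQ : 0 ≤ Q) :
    ∃ K : ℝ, 0 ≤ K ∧ ∀ q : H1 Ω, (∀ᵐ x ∂volume.restrict Ω, |q.1.fst x| ≤ Q) →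
      ∃ A : ↥(H10 Ω) →L[ℝ] ↥(H10 Ω) →L[ℝ] ℝ, (∀ v φ, A v φ = ellipticForm q b c v.1 φ.1) ∧
        ∀ v φ, |A v φ| ≤ K * ‖v‖ * ‖φ‖ := by
  choose C hC hb using fun j => exists_mul_small hΩ (b j).2 one_pos
  have hS : 0 ≤ ∑ j, (1 + C j) := Finset.sum_nonneg fun j _ => add_nonneg zero_le_one (hC j)
  refine ⟨Q + (∑ j, (1 + C j)) + ‖c‖, by positivity, fun q hq => ?_⟩
  have key (v φ : ↥(H10 Ω)) : |ellipticForm q b c v.1 φ.1| ≤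
      (Q + (∑ j, (1 + C j)) + ‖c‖) * ‖v‖ * ‖φ‖ := by
    rw [ellipticForm_eq hΩ hq hQ b c v.2]
    have nv1 : ‖v.1.fst‖ ≤ ‖v‖ := norm_gradPair_fst_le v.1
    have nv2 : ‖v.1.snd‖ ≤ ‖v‖ := norm_gradPair_snd_le v.1
    have nf1 : ‖φ.1.fst‖ ≤ ‖φ‖ := norm_gradPair_fst_le φ.1
    have nf2 : ‖φ.1.snd‖ ≤ ‖φ‖ := norm_gradPair_snd_le φ.1
    have h1 : |∫ x in Ω, q.1.fst x * inner ℝ (v.1.snd x) (φ.1.snd x)| ≤ Q * ‖v‖ * ‖φ‖ :=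
      (diffusion_bound hq hQ v.1 φ.1).2.trans (by gcongr)
    have h3 : |∫ x in Ω, c x * v.1.fst x * φ.1.fst x| ≤ ‖c‖ * ‖v‖ * ‖φ‖ :=
      (reaction_bound c v.1 φ.1).2.trans (by gcongr)
    have h2 : |∑ j, ∫ x in Ω, v.1.fst x * ((b j).1.fst x * φ.1.snd x j)| ≤
        (∑ j, (1 + C j)) * ‖v‖ * ‖φ‖ := by
      rw [mul_assoc, Finset.sum_mul]
      refine (Finset.abs_sum_le_sum_abs _ _).trans (Finset.sum_le_sum fun j _ => ?_)
      refine (transport_bound hΩ v.2 (b j).2 φ.1 j).2.trans ?_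
      rw [← mul_assoc]
      refine mul_le_mul ?_ nf2 (norm_nonneg _) (mul_nonneg (add_nonneg zero_le_one (hC j)) (norm_nonneg _))
      refine (hb j v.1 v.2).trans ?_
      have := mul_le_mul_of_nonneg_left nv1 (hC j)
      have e : ‖v.1‖ = ‖v‖ := rfl
      rw [e]; linarith
    rw [add_mul, add_mul, add_mul, add_mul]
    exact (abs_add_le _ _).trans (add_le_add ((abs_sub _ _).trans (add_le_add h1 h2)) h3)
  let L : ↥(H10 Ω) →ₗ[ℝ] ↥(H10 Ω) →ₗ[ℝ] ℝ := LinearMap.mk₂ ℝ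
    (fun v φ => ellipticForm q b c v.1 φ.1)
    (fun v w φ => ellipticForm_add_left hΩ hq hQ b c v.2 w.2 φ.1)
    (fun a v φ => ellipticForm_smul_left q b c a v.1 φ.1)
    (fun v φ ψ => ellipticForm_add_right hΩ hq hQ b c v.2 φ.1 ψ.1)
    (fun a v φ => ellipticForm_smul_right q b c a v.1 φ.1)
  exact ⟨L.mkContinuous₂ _ key, fun v φ => rfl, key⟩

/-- Gårding's inequality, uniformly with respect to the diffusion coefficient. -/
theorem exists_garding (hΩ : IsOpen Ω) (b : Fin 2 → H1 Ω)
    (c : Lp ℝ ⊤ (volume.restrict Ω)) {q₀ : ℝ} (hq₀ : 0 < q₀) (q₁ : ℝ) :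
    ∃ κ : ℝ, 0 ≤ κ ∧ ∀ q ∈ admissible Ω q₀ q₁, ∀ v ∈ H10 Ω,
      q₀ / 2 * ‖v‖ ^ 2 ≤ ellipticForm q b c v v + κ * ‖v.fst‖ ^ 2 := by
  -- The two transport terms cost `q₀ / 8` each and Young's inequality below another `q₀ / 4`. Of
  -- the `q₀` provided by the diffusion, `q₀ / 2` remains. The `q₀` in `κ` pays for completing
  -- `‖v.snd‖²` to `‖v‖²`.
  choose C hC hb using fun j => exists_mul_small hΩ (b j).2 (by positivity : 0 < q₀ / 8)
  refine ⟨q₀ + (C 0 + C 1) ^ 2 / q₀ + ‖c‖, by positivity, fun q hq v hv => ?_⟩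
  have hq' : ∀ᵐ x ∂volume.restrict Ω, |q.1.fst x| ≤ |q₀| + |q₁| := by
    filter_upwards [hq] with x hx
    rw [abs_le]
    constructor
    · linarith [neg_abs_le q₀, abs_nonneg q₁, hx.1]
    · linarith [le_abs_self q₁, abs_nonneg q₀, hx.2]
  have hQ : 0 ≤ |q₀| + |q₁| := by positivity
  rw [ellipticForm_eq hΩ hq' hQ b c hv]
  have e : ‖v‖ ^ 2 = ‖v.fst‖ ^ 2 + ‖v.snd‖ ^ 2 := WithLp.prod_norm_sq_eq_of_L2 v
  have h1 : q₀ * ‖v.snd‖ ^ 2 ≤ ∫ x in Ω, q.1.fst x * inner ℝ (v.snd x) (v.snd x) := by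
    rw [norm_eq_l2n, l2n_sq (Lp.memLp v.snd), ← integral_const_mul]
    refine integral_mono_ae ((Lp.memLp v.snd).norm.integrable_sq.const_mul _)
      (diffusion_bound hq' hQ v v).1 ?_
    filter_upwards [hq] with x hx
    rw [real_inner_self_eq_norm_sq]
    exact mul_le_mul_of_nonneg_right hx.1 (sq_nonneg _)
  have h3 := neg_abs_le (∫ x in Ω, c x * v.fst x * v.fst x)
  have h3' := (reaction_bound c v v).2
  have h2 (j : Fin 2) : ∫ x in Ω, v.fst x * ((b j).1.fst x * v.snd x j) ≤
      (q₀ / 8 * ‖v‖ + C j * ‖v.fst‖) * ‖v‖ := by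
    refine (le_abs_self _).trans ((transport_bound hΩ hv (b j).2 v j).2.trans ?_)
    refine mul_le_mul (hb j v hv) (norm_gradPair_snd_le v) (norm_nonneg _) ?_
    have := hC j
    positivity
  rw [Fin.sum_univ_two]
  have h20 := h2 0
  have h21 := h2 1
  have young : (C 0 + C 1) * ‖v.fst‖ * ‖v‖ ≤ q₀ / 4 * ‖v‖ ^ 2 + (C 0 + C 1) ^ 2 / q₀ * ‖v.fst‖ ^ 2 := by
    have : q₀ / 4 * ‖v‖ ^ 2 + (C 0 + C 1) ^ 2 / q₀ * ‖v.fst‖ ^ 2 - (C 0 + C 1) * ‖v.fst‖ * ‖v‖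
        = (q₀ / 2 * ‖v‖ - (C 0 + C 1) * ‖v.fst‖) ^ 2 / q₀ := by
      field_simp; ring
    have h0 : 0 ≤ (q₀ / 2 * ‖v‖ - (C 0 + C 1) * ‖v.fst‖) ^ 2 / q₀ := by positivity
    linarith
  nlinarith [norm_nonneg v]

end Form

/-! ### Boundedness of stationary solutions by truncation -/

section Stampacchia

theorem mul_sqrt_measureReal_le {X : Type*} [MeasurableSpace X] {μ : Measure X} [IsFiniteMeasure μ]
    {f : X → ℝ} (hf : MemLp f 2 μ) {c : ℝ} (hc : 0 ≤ c) {A : Set X} (hA : ∀ x ∈ A, c ≤ f x) :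
    c * √(μ.real A) ≤ l2n μ f := by
  refine (sq_le_sq₀ (by positivity) (l2n_nonneg f)).1 ?_
  rw [mul_pow, Real.sq_sqrt measureReal_nonneg, l2n_sq hf]
  have h := mul_meas_ge_le_integral_of_nonneg (μ := μ) (f := fun x => ‖f x‖ ^ 2)
    (.of_forall fun x => sq_nonneg _) hf.norm.integrable_sq (c ^ 2)
  refine le_trans (mul_le_mul_of_nonneg_left (measureReal_mono fun x hx => ?_) (sq_nonneg c)) h
  exact pow_le_pow_left₀ hc ((hA x hx).trans (le_abs_self _)) 2

theorem l2n_indicator_one {X : Type*} [MeasurableSpace X] {μ : Measure X} [IsFiniteMeasure μ]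
    {A : Set X} (hA : MeasurableSet A) :
    MemLp (A.indicator (1 : X → ℝ)) 2 μ ∧ l2n μ (A.indicator (1 : X → ℝ)) = √(μ.real A) := by
  have hm : MemLp (A.indicator (1 : X → ℝ)) 2 μ := (memLp_const (1 : ℝ)).indicator hA
  refine ⟨hm, ?_⟩
  rw [← Real.sqrt_sq (l2n_nonneg _), l2n_sq hm, ← integral_indicator_one hA]
  congr 2
  ext x
  by_cases hx : x ∈ A <;> simp [hx]

/-- De Giorgi's iteration for a function that decays quadratically between levels. -/
theorem eq_zero_of_level_decay {m : ℝ → ℝ} (hm : Antitone m) (h0 : ∀ k, 0 ≤ m k) {C l : ℝ}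
    (hC : 0 ≤ C) (hl : 0 < l) (h : ∀ k h, l ≤ k → k < h → (h - k) * m h ≤ C * k * m k ^ 2)
    (hsmall : 16 * C * m l ≤ 1) : m (2 * l) = 0 := by
  have hx (n : ℕ) : (0 : ℝ) < (1 / 2) ^ n := by positivity
  have hx1 (n : ℕ) : ((1 : ℝ) / 2) ^ n ≤ 1 := pow_le_one₀ (by norm_num) (by norm_num)
  -- Levels `l (2 - 2⁻ⁿ)` between `l` and `2l`, with decay `4⁻ⁿ`. Each gap is `l 2⁻ⁿ / 2`; with the
  -- factor `k ≤ 2l`, the step closes exactly under the smallness condition with constant `16`.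
  have key (n : ℕ) : m (l * (2 - (1 / 2) ^ n)) ≤ m l * ((1 / 2) ^ n * (1 / 2) ^ n) := by
    induction n with
    | zero => norm_num
    | succ n ih =>
      have := h (l * (2 - (1 / 2) ^ n)) (l * (2 - (1 / 2) ^ (n + 1)))
        (by nlinarith [hx1 n]) (by rw [pow_succ]; nlinarith [hx n])
      rw [pow_succ] at this ⊢
      set z := ((1 : ℝ) / 2) ^ n
      have z0 : 0 < z := hx n
      have z1 : z ≤ 1 := hx1 n
      have a : m (l * (2 - z)) ^ 2 ≤ (m l * (z * z)) ^ 2 := pow_le_pow_left₀ (h0 _) ih 2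
      have e : l * (2 - z * (1 / 2)) - l * (2 - z) = l * (z / 2) := by ring
      rw [e] at this
      have b : l * (z / 2) * m (l * (2 - z * (1 / 2))) ≤ C * (l * 2) * (m l * (z * z)) ^ 2 := by
        refine this.trans ?_
        gcongr
        · linarith
      have b' : l * (z / 2) * m (l * (2 - z * (1 / 2))) ≤
          l * (z / 2) * (m l * (z * (1 / 2) * (z * (1 / 2)))) := by
        refine b.trans ?_
        have e2 : C * (l * 2) * (m l * (z * z)) ^ 2
            = (l * (z / 2) * (m l * (z * (1 / 2) * (z * (1 / 2))))) * ((16 * C * m l) * z) := by ring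
        rw [e2]
        refine mul_le_of_le_one_right (by have := h0 l; positivity) ?_
        have : 0 ≤ 16 * C * m l := by have := h0 l; positivity
        nlinarith
      exact le_of_mul_le_mul_left b' (by positivity)
  have lim : Filter.Tendsto (fun n : ℕ => m l * (((1 : ℝ) / 2) ^ n * (1 / 2) ^ n)) Filter.atTop
      (nhds (m l * (0 * 0))) :=
    ((tendsto_pow_atTop_nhds_zero_of_lt_one (by norm_num) (by norm_num)).mul
      (tendsto_pow_atTop_nhds_zero_of_lt_one (by norm_num) (by norm_num))).const_mul _
  rw [mul_zero, mul_zero] at lim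
  refine le_antisymm (ge_of_tendsto' lim fun n => (hm ?_).trans (key n)) (h0 _)
  nlinarith [hx n]

/-- Here `n` is the `L²` norm and `X` the `H¹` norm of a truncation, and `m` the root of the measure
of its level set. Since `m` is small, the zero order term of Gårding's inequality is absorbed by
`X²`. This bounds `X` by a multiple of `k m`, and the Sobolev inequality gives the second factor
`m`. -/
theorem level_arith {κ S B k m X n a q : ℝ} (hκ : 0 ≤ κ) (hS : 0 ≤ S) (hB : 0 ≤ B) (hk : 0 ≤ k)
    (hm : 0 ≤ m) (hm1 : m ≤ 1) (hX : 0 ≤ X) (hq : 0 < q) (hn : 0 ≤ n) (h1 : n ≤ S * (m * X))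
    (h2 : a ≤ k * (1 + B) * n) (h3 : q / 2 * X ^ 2 ≤ a + κ * n ^ 2) (h4 : 4 * κ * S ^ 2 * m ≤ q) :
    n ≤ 4 * (1 + B) * S ^ 2 / q * k * m ^ 2 := by
  have q1 : κ * n ^ 2 ≤ q / 4 * X ^ 2 := by
    calc κ * n ^ 2 ≤ κ * (S * (m * X)) ^ 2 := by gcongr
      _ = (κ * S ^ 2 * m) * m * X ^ 2 := by ring
      _ ≤ (q / 4) * 1 * X ^ 2 := by
          gcongr
          linarith
      _ = _ := by ring
  have q2 : q / 4 * X * X ≤ k * (1 + B) * S * m * X := by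
    have : k * (1 + B) * n ≤ k * (1 + B) * (S * (m * X)) := by gcongr
    linarith
  have q3 : q / 4 * X ≤ k * (1 + B) * S * m := by
    rcases hX.eq_or_lt with h0 | h0
    · rw [← h0, mul_zero]; positivity
    · exact le_of_mul_le_mul_right q2 h0
  have q4 : X ≤ 4 / q * (k * (1 + B) * S * m) := by
    have := mul_le_mul_of_nonneg_left q3 (by positivity : 0 ≤ 4 / q)
    have e : 4 / q * (q / 4 * X) = X := by field_simp
    linarith
  calc n ≤ S * (m * (4 / q * (k * (1 + B) * S * m))) := h1.trans (by gcongr)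
    _ = _ := by ring

variable {Ω : Set Plane}

theorem integral_mul_snd_apply {β p : GradPair Ω} (hβ : β ∈ H1 Ω) (hp : p ∈ H10 Ω) (j : Fin 2) :
    ∫ x in Ω, β.fst x * p.snd x j = - ∫ x in Ω, p.fst x * β.snd x j := by
  have i (f g : GradPair Ω) : Integrable (fun x => f.fst x • g.snd x) (volume.restrict Ω) :=
    memLp_one_iff_integrable.1 ((Lp.memLp g.snd).smul (Lp.memLp f.fst))
  have h := congrArg (EuclideanSpace.proj (𝕜 := ℝ) j) (integral_smul_snd_eq_neg hβ hp)
  rw [map_neg, ← ContinuousLinearMap.integral_comp_comm _ (i β p),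
    ← ContinuousLinearMap.integral_comp_comm _ (i p β)] at h
  simpa using h

theorem abs_coeff_le {q₀ q₁ : ℝ} {q : H1 Ω} (hq : q ∈ admissible Ω q₀ q₁) :
    ∀ᵐ x ∂volume.restrict Ω, |q.1.fst x| ≤ |q₀| + |q₁| := by
  filter_upwards [hq] with x hx
  rw [abs_le]
  constructor
  · linarith [neg_abs_le q₀, abs_nonneg q₁, hx.1]
  · linarith [le_abs_self q₁, abs_nonneg q₀, hx.2]

theorem ellipticForm_neg_left (q : H1 Ω) (b : Fin 2 → H1 Ω) (c : Lp ℝ ⊤ (volume.restrict Ω))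
    (v φ : GradPair Ω) : ellipticForm q b c (-v) φ = -ellipticForm q b c v φ := by
  have := ellipticForm_smul_left q b c (-1) v φ
  rwa [neg_one_smul, neg_one_mul] at this

variable [IsFiniteMeasure (volume.restrict Ω)]

/-- Where `r` is not zero, `y` equals `r + k` and has the same gradient. The contribution of `k` to
the transport term is integrated by parts, so that only `∇b` in `L²` enters. -/
theorem ellipticForm_truncation (hΩ : IsOpen Ω) {q : H1 Ω} {Q : ℝ}
    (hq : ∀ᵐ x ∂volume.restrict Ω, |q.1.fst x| ≤ Q) (hQ : 0 ≤ Q) (b : Fin 2 → H1 Ω)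
    (c : Lp ℝ ⊤ (volume.restrict Ω)) {y r : GradPair Ω} (hy : y ∈ H10 Ω) (hr : r ∈ H10 Ω) {k : ℝ}
    (h1 : r.fst =ᵐ[volume.restrict Ω] fun x => max (y.fst x - k) 0)
    (h2 : r.snd =ᵐ[volume.restrict Ω] fun x => (if k < y.fst x then (1 : ℝ) else 0) • y.snd x) :
    ellipticForm q b c y r = ellipticForm q b c r r
      + k * ∑ j, (∫ x in Ω, r.fst x * (b j).1.snd x j) + k * ∫ x in Ω, c x * r.fst x := by
  rw [ellipticForm_eq hΩ hq hQ b c hy, ellipticForm_eq hΩ hq hQ b c hr]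
  have d : ∫ x in Ω, q.1.fst x * inner ℝ (y.snd x) (r.snd x)
      = ∫ x in Ω, q.1.fst x * inner ℝ (r.snd x) (r.snd x) := by
    refine integral_congr_ae ?_
    filter_upwards [h2] with x hx
    rw [hx]
    split_ifs <;> simp
  have t (j : Fin 2) : ∫ x in Ω, y.fst x * ((b j).1.fst x * r.snd x j)
      = (∫ x in Ω, r.fst x * ((b j).1.fst x * r.snd x j)) - k * ∫ x in Ω, r.fst x * (b j).1.snd x j := by
    have i : Integrable (fun x => (b j).1.fst x * r.snd x j) (volume.restrict Ω) :=
      memLp_one_iff_integrable.1 ((memLp_snd_apply r j).smul (Lp.memLp (b j).1.fst))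
    have e := integral_mul_snd_apply (b j).2 hr j
    have e' : (∫ x in Ω, r.fst x * (b j).1.snd x j) = - ∫ x in Ω, (b j).1.fst x * r.snd x j := by
      rw [e, neg_neg]
    rw [e', mul_neg, sub_neg_eq_add, ← integral_const_mul,
      ← integral_add (transport_bound hΩ hr (b j).2 r j).1 (i.const_mul k)]
    refine integral_congr_ae ?_
    filter_upwards [h1, h2] with x hx hx'
    rw [hx, hx']
    split_ifs with hk
    · rw [max_eq_left (by linarith)]; ring
    · simp
  have s : ∫ x in Ω, c x * y.fst x * r.fst x
      = (∫ x in Ω, c x * r.fst x * r.fst x) + k * ∫ x in Ω, c x * r.fst x := by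
    have i : Integrable (fun x => c x * r.fst x) (volume.restrict Ω) :=
      ((Lp.memLp r.fst).integrable (by norm_num)).bdd_mul (c := ‖c‖) (Lp.memLp c).1 (ae_abs_le_norm c)
    rw [← integral_const_mul, ← integral_add (reaction_bound c r r).1 (i.const_mul k)]
    refine integral_congr_ae ?_
    filter_upwards [h1] with x hx
    rw [hx]
    rcases le_total (y.fst x - k) 0 with hk | hk
    · rw [max_eq_right hk]; simp
    · rw [max_eq_left hk]; ring
  rw [d, s, Fin.sum_univ_two, Fin.sum_univ_two, Fin.sum_univ_two, t 0, t 1]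
  ring

/-- The equation is tested with the truncation `(y - k)⁺`. The root `m k` of the measure of the
level set then satisfies `(h - k) m h ≤ C₁ k (m k)²`, and the iteration makes it vanish at level `2
L N`. -/
theorem exists_upper_bound (hΩ : IsOpen Ω) (b : Fin 2 → H1 Ω)
    (c : Lp ℝ ⊤ (volume.restrict Ω)) {q₀ : ℝ} (hq₀ : 0 < q₀) (q₁ : ℝ) :
    ∃ C : ℝ, 0 ≤ C ∧ ∀ q ∈ admissible Ω q₀ q₁, ∀ y ∈ H10 Ω, ∀ g : L2 Ω,
      (∀ φ ∈ H10 Ω, ellipticForm q b c y φ = inner ℝ g φ.fst) →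
      ∀ N, 0 < N → ‖g‖ ≤ N → ‖y‖ ≤ N → ∀ᵐ x ∂volume.restrict Ω, y.fst x ≤ C * N := by
  obtain ⟨S, hS, hsob⟩ := exists_sobolev_one Ω
  obtain ⟨κ, hκ, hgar⟩ := exists_garding hΩ b c hq₀ q₁
  set B := ‖(b 0).1.snd‖ + ‖(b 1).1.snd‖ + l2n (volume.restrict Ω) (fun _ => ‖c‖) with hB
  have hB0 : 0 ≤ B := add_nonneg (by positivity) (l2n_nonneg _)
  set C₁ := 4 * (1 + B) * S ^ 2 / q₀ with hC₁
  have hC₁0 : 0 ≤ C₁ := by positivity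
  -- Chebyshev's inequality gives `m k ≤ 1 / L` for `k ≥ L N`. The three summands ensure `m k ≤ 1`,
  -- the start of the iteration and the absorption of the Gårding term.
  set L := 1 + 16 * C₁ + 4 * κ * S ^ 2 / q₀ with hL
  have hL1 : 1 ≤ L := by
    have : 0 ≤ 4 * κ * S ^ 2 / q₀ := by positivity
    linarith
  have hL2 : 16 * C₁ ≤ L := by
    have : 0 ≤ 4 * κ * S ^ 2 / q₀ := by positivity
    linarith
  have hL3 : 4 * κ * S ^ 2 ≤ q₀ * L := by
    have : 4 * κ * S ^ 2 = q₀ * (4 * κ * S ^ 2 / q₀) := by field_simp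
    rw [this]
    exact mul_le_mul_of_nonneg_left (by linarith) hq₀.le
  have hQ : 0 ≤ |q₀| + |q₁| := by positivity
  refine ⟨2 * L, by positivity, fun q hq y hy g hyg N hN hgN hyN => ?_⟩
  set m : ℝ → ℝ := fun k => √((volume.restrict Ω).real {x | k < y.fst x}) with hm
  have ymeas : Measurable (y.fst : Plane → ℝ) := (Lp.stronglyMeasurable y.fst).measurable
  have cheb (k : ℝ) (hk : 0 ≤ k) : k * m k ≤ N :=
    (mul_sqrt_measureReal_le (Lp.memLp y.fst) hk fun x hx => le_of_lt hx).trans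
      (by rw [← norm_eq_l2n]; exact (norm_gradPair_fst_le y).trans hyN)
  have mpos (k : ℝ) : 0 ≤ m k := Real.sqrt_nonneg _
  have manti : Antitone m := fun k h hkh =>
    Real.sqrt_le_sqrt (measureReal_mono fun x hx => lt_of_le_of_lt hkh hx)
  have msmall (k : ℝ) (hk : L * N ≤ k) : L * m k ≤ 1 := by
    have h1 := cheb k (by nlinarith)
    have h2 : L * N * m k ≤ N := (mul_le_mul_of_nonneg_right hk (mpos k)).trans h1
    nlinarith
  have hdecay (k h : ℝ) (hk : L * N ≤ k) (hkh : k < h) : (h - k) * m h ≤ C₁ * k * m k ^ 2 := by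
    have hNk : N ≤ k := by nlinarith
    have hk0 : 0 < k := hN.trans_le hNk
    have hw := truncation_weakPair hy hk0.le
    obtain ⟨r, hr, h1, h2⟩ := hw
    set A := {x | k < y.fst x} with hA
    have hAm : MeasurableSet A := measurableSet_lt measurable_const ymeas
    have s1 : (h - k) * m h ≤ ‖r.fst‖ := by
      rw [norm_eq_l2n, l2n_congr h1]
      refine mul_sqrt_measureReal_le ((memLp_congr_ae h1).1 (Lp.memLp r.fst)) (by linarith) ?_
      exact fun x hx => (sub_le_sub_right (le_of_lt hx) k).trans (le_max_left _ _)
    -- The gradient of `r` lives on the level set, so its `L¹` norm gains the factor `m k`.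
    have s2 : ‖r.fst‖ ≤ S * (m k * ‖r‖) := by
      refine (hsob r hr).trans (mul_le_mul_of_nonneg_left ?_ hS)
      obtain ⟨mi, li⟩ := l2n_indicator_one (μ := volume.restrict Ω) hAm
      calc ∫ x in Ω, ‖r.snd x‖ = ∫ x in Ω, ‖A.indicator (1 : Plane → ℝ) x‖ * ‖r.snd x‖ := by
            refine integral_congr_ae ?_
            filter_upwards [h2] with x hx
            by_cases hxA : x ∈ A
            · simp [hxA]
            · have : ¬ k < y.fst x := hxA
              rw [hx, if_neg this]; simp
        _ ≤ m k * ‖r.snd‖ := by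
            rw [norm_eq_l2n, hm]
            dsimp only
            rw [← li]
            exact integral_norm_mul_norm_le mi (Lp.memLp r.snd)
        _ ≤ _ := mul_le_mul_of_nonneg_left (norm_gradPair_snd_le r) (mpos k)
    have e := ellipticForm_truncation hΩ (abs_coeff_le hq) hQ b c hy hr h1 h2
    rw [hyg r hr, Fin.sum_univ_two] at e
    have g1 : inner ℝ g r.fst ≤ N * ‖r.fst‖ :=
      (real_inner_le_norm _ _).trans (mul_le_mul_of_nonneg_right hgN (norm_nonneg _))
    have g2 (j : Fin 2) : |∫ x in Ω, r.fst x * (b j).1.snd x j| ≤ ‖r.fst‖ * ‖(b j).1.snd‖ := by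
      rw [norm_eq_l2n, norm_eq_l2n]
      refine abs_integral_le_l2n (Lp.memLp _) (Lp.memLp _) (.of_forall fun x => ?_)
      rw [abs_mul]
      exact mul_le_mul_of_nonneg_left (abs_apply_le_norm _ _) (abs_nonneg _)
    have g3 : |∫ x in Ω, c x * r.fst x| ≤ l2n (volume.restrict Ω) (fun _ => ‖c‖) * ‖r.fst‖ := by
      rw [norm_eq_l2n r.fst]
      refine abs_integral_le_l2n (memLp_const _) (Lp.memLp _) ?_
      filter_upwards [ae_abs_le_norm c] with x hx
      rw [abs_mul, norm_norm]
      exact mul_le_mul_of_nonneg_right hx (abs_nonneg _)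
    have g20 := neg_abs_le (∫ x in Ω, r.fst x * (b 0).1.snd x 0)
    have g21 := neg_abs_le (∫ x in Ω, r.fst x * (b 1).1.snd x 1)
    have g30 := neg_abs_le (∫ x in Ω, c x * r.fst x)
    have up : ellipticForm q b c r r ≤ k * (1 + B) * ‖r.fst‖ := by
      have a1 : N * ‖r.fst‖ ≤ k * ‖r.fst‖ := mul_le_mul_of_nonneg_right hNk (norm_nonneg _)
      have a2 : -((∫ x in Ω, r.fst x * (b 0).1.snd x 0) + (∫ x in Ω, r.fst x * (b 1).1.snd x 1)
          + ∫ x in Ω, c x * r.fst x) ≤ B * ‖r.fst‖ := by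
        rw [hB]; linarith [g2 0, g2 1]
      have a3 := mul_le_mul_of_nonneg_left a2 hk0.le
      linarith
    have gd := hgar q hq r hr
    set X := ‖r‖ with hX
    have X0 : 0 ≤ X := norm_nonneg r
    have m1 : m k ≤ 1 :=
      (le_mul_of_one_le_left (mpos k) hL1).trans (msmall k hk)
    have small : 4 * κ * S ^ 2 * m k ≤ q₀ := by
      have w4 := mul_le_mul_of_nonneg_right hL3 (mpos k)
      have w5 := mul_le_mul_of_nonneg_left (msmall k hk) hq₀.le
      linarith
    exact s1.trans (level_arith hκ hS hB0 hk0.le (mpos k) m1 X0 hq₀ (norm_nonneg _) s2 up gd small)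
  have hz := eq_zero_of_level_decay manti mpos hC₁0 (by positivity : 0 < L * N) hdecay (by
    have := msmall (L * N) le_rfl
    nlinarith [mpos (L * N)])
  have hz' : (volume.restrict Ω).real {x | 2 * (L * N) < y.fst x} = 0 :=
    (Real.sqrt_eq_zero measureReal_nonneg).1 hz
  rw [measureReal_eq_zero_iff] at hz'
  rw [ae_iff]
  convert hz' using 3
  ext x
  rw [not_le, mul_assoc]

/-- Boundedness of weak solutions of the stationary problem, uniformly with respect to the
diffusion coefficient. -/
theorem exists_sup_bound (hΩ : IsOpen Ω) (b : Fin 2 → H1 Ω)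
    (c : Lp ℝ ⊤ (volume.restrict Ω)) {q₀ : ℝ} (hq₀ : 0 < q₀) (q₁ : ℝ) :
    ∃ C : ℝ, 0 ≤ C ∧ ∀ q ∈ admissible Ω q₀ q₁, ∀ y ∈ H10 Ω, ∀ g : L2 Ω,
      (∀ φ ∈ H10 Ω, ellipticForm q b c y φ = inner ℝ g φ.fst) →
      ∀ N, 0 < N → ‖g‖ ≤ N → ‖y‖ ≤ N → ∀ᵐ x ∂volume.restrict Ω, |y.fst x| ≤ C * N := by
  obtain ⟨C, hC, h⟩ := exists_upper_bound hΩ b c hq₀ q₁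
  refine ⟨C, hC, fun q hq y hy g hyg N hN hg hyN => ?_⟩
  -- The problem is linear: the lower bound is the upper bound for `-y`.
  have h' := h q hq (-y) ((H10 Ω).neg_mem hy) (-g) (fun φ hφ => by
    rw [ellipticForm_neg_left, hyg φ hφ, inner_neg_left]) N hN (by rwa [norm_neg]) (by rwa [norm_neg])
  filter_upwards [h q hq y hy g hyg N hN hg hyN, h', coeFn_smul_fst (-1) y] with x h1 h2 h3
  rw [neg_one_smul, neg_one_mul] at h3
  rw [h3] at h2
  exact abs_le.2 ⟨by linarith, h1⟩

end Stampacchia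

/-! ### Weighted gradient estimate and the difference of two forms -/

section CoefficientDifference

/-- Two terms `q / 8 X²` are absorbed on the left, and the mixed term `α X E` costs another `q / 4`
by Young's inequality. Half of `q X²` is left against a multiple of `E²`. -/
theorem exists_sq_arith {q a₀ β₀ Q C₀ S γ : ℝ} (hq : 0 < q) (hC₀ : 0 ≤ C₀)
    (ha : 0 ≤ a₀) (hβ : 0 ≤ β₀) (hS : 0 ≤ S) (hγ : 0 ≤ γ) :
    ∃ C, 0 ≤ C ∧ ∀ X E : ℝ, 0 ≤ X → 0 ≤ E →
      q * X ^ 2 ≤ 2 * Q * X * (C₀ * E) + ((q / 8 * X + a₀ * E) * (2 * (C₀ * E) + X)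
        + (q / 8 * X + β₀ * E) * (2 * (C₀ * E) + X)) + γ * (C₀ * E) ^ 2
        + S * E * (2 * (C₀ * E) + X) → X ≤ C * E := by
  obtain ⟨α, hα⟩ : ∃ α, α = 2 * Q * C₀ + (q / 2 * C₀ + a₀ + β₀) + S := ⟨_, rfl⟩
  refine ⟨√((2 / q) * (α ^ 2 / q + (2 * C₀ * (a₀ + β₀) + γ * C₀ ^ 2 + 2 * S * C₀))),
    Real.sqrt_nonneg _, fun X E hX hE h => ?_⟩
  set θ := 2 * C₀ * (a₀ + β₀) + γ * C₀ ^ 2 + 2 * S * C₀ with hθ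
  have h1 : q * X ^ 2 ≤ q / 4 * X ^ 2 + α * (X * E) + θ * E ^ 2 := by
    rw [hα, hθ]
    refine h.trans (le_of_eq ?_)
    ring
  have h2 : α * (X * E) ≤ q / 4 * X ^ 2 + α ^ 2 / q * E ^ 2 := by
    have e : q / 4 * X ^ 2 + α ^ 2 / q * E ^ 2 - α * (X * E) = (q / 2 * X - α * E) ^ 2 / q := by
      field_simp; ring
    have : 0 ≤ (q / 2 * X - α * E) ^ 2 / q := by positivity
    linarith
  have h3 : X ^ 2 ≤ (2 / q) * (α ^ 2 / q + θ) * E ^ 2 := by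
    have h4 : q / 2 * X ^ 2 ≤ (α ^ 2 / q + θ) * E ^ 2 := by linarith
    have h5 := mul_le_mul_of_nonneg_left h4 (by positivity : 0 ≤ 2 / q)
    have e : 2 / q * (q / 2 * X ^ 2) = X ^ 2 := by field_simp
    linarith
  have hθ0 : 0 ≤ θ := by positivity
  refine (sq_le_sq₀ hX (by positivity)).1 ?_
  rwa [mul_pow, Real.sq_sqrt (by positivity)]

variable {Ω : Set Plane} [IsFiniteMeasure (volume.restrict Ω)]

/-- Weighted gradient estimate for weak solutions of the stationary problem: the product of a
bounded `H¹` function and the gradient is controlled by the `H¹` norm of the function. -/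
theorem exists_weighted_gradient_bound (hΩ : IsOpen Ω) (b : Fin 2 → H1 Ω)
    (c : Lp ℝ ⊤ (volume.restrict Ω)) {q₀ : ℝ} (hq₀ : 0 < q₀) (q₁ : ℝ) :
    ∃ C : ℝ, 0 ≤ C ∧ ∀ q ∈ admissible Ω q₀ q₁, ∀ y ∈ H10 Ω, ∀ g : L2 Ω,
      (∀ φ ∈ H10 Ω, ellipticForm q b c y φ = inner ℝ g φ.fst) →
      ∀ N, 0 < N → ‖g‖ ≤ N → ‖y‖ ≤ N → ∀ δ ∈ H1 Ω, ∀ B,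
      (∀ᵐ x ∂volume.restrict Ω, |δ.fst x| ≤ B) →
      MemLp (fun x => δ.fst x • y.snd x) 2 (volume.restrict Ω) ∧
      l2n (volume.restrict Ω) (fun x => δ.fst x • y.snd x) ≤ C * (N * ‖δ‖) := by
  obtain ⟨C₀, hC₀, hsup⟩ := exists_sup_bound hΩ b c hq₀ q₁
  obtain ⟨S, hS, hmul⟩ := exists_mul_bound hΩ
  choose D hD hsm using fun j => exists_mul_small hΩ (b j).2 (by positivity : 0 < q₀ / 8)
  have hQ : 0 ≤ |q₀| + |q₁| := by positivity
  have hd (j : Fin 2) : 0 ≤ q₀ / 8 * (2 * C₀) + D j * C₀ := by have := hD j; positivity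
  obtain ⟨C, hC, harith⟩ := exists_sq_arith (Q := |q₀| + |q₁|) hq₀ hC₀ (hd 0) (hd 1) hS
    (norm_nonneg c)
  refine ⟨C, hC, fun q hq y hy g hyg N hN hgN hyN δ hδ B hB => ?_⟩
  have hK := hsup q hq y hy g hyg N hN hgN hyN
  have hK0 : 0 ≤ C₀ * N := by positivity
  -- The admissible test function is `χ = y δ²`, built in two steps through `p = y δ`. The bound `B`
  -- only serves to put these products in `H10`; it does not enter the constant.
  obtain ⟨p, hp, p1, p2⟩ := mul_weakPair hΩ hy hK hδ hB
  have hK' : ∀ᵐ x ∂volume.restrict Ω, |p.fst x| ≤ C₀ * N * B := by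
    filter_upwards [p1, hK, hB] with x h1 h2 h3
    rw [h1, abs_mul]
    exact mul_le_mul h2 h3 (abs_nonneg _) hK0
  obtain ⟨χ, hχ, c1, c2⟩ := mul_weakPair hΩ hp hK' hδ hB
  have mX : MemLp (fun x => δ.fst x • y.snd x) 2 (volume.restrict Ω) := by
    refine (Lp.memLp y.snd).of_le_mul (c := B) ((Lp.memLp δ.fst).1.smul (Lp.memLp y.snd).1) ?_
    filter_upwards [hB] with x hx
    rw [norm_smul]; gcongr; exact hx
  have hYb : ∀ᵐ x ∂volume.restrict Ω, ‖y.fst x • δ.snd x‖ ≤ C₀ * N * ‖δ.snd x‖ := by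
    filter_upwards [hK] with x hx
    rw [norm_smul]
    exact mul_le_mul_of_nonneg_right hx (norm_nonneg _)
  have mY : MemLp (fun x => y.fst x • δ.snd x) 2 (volume.restrict Ω) :=
    (Lp.memLp δ.snd).of_le_mul ((Lp.memLp y.fst).1.smul (Lp.memLp δ.snd).1) hYb
  refine ⟨mX, ?_⟩
  set w := ‖δ‖ with hw
  have hw0 : 0 ≤ w := norm_nonneg δ
  have w1 : ‖δ.fst‖ ≤ w := norm_gradPair_fst_le δ
  have w2 : ‖δ.snd‖ ≤ w := norm_gradPair_snd_le δ
  set X := l2n (volume.restrict Ω) (fun x => δ.fst x • y.snd x) with hX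
  have hX0 : 0 ≤ X := l2n_nonneg _
  set E := N * w with hE
  have hE0 : 0 ≤ E := by positivity
  have lY : l2n (volume.restrict Ω) (fun x => y.fst x • δ.snd x) ≤ C₀ * E := by
    have : l2n (volume.restrict Ω) (fun x => (C₀ * N) • δ.snd x) ≤ C₀ * N * w := by
      rw [l2n_const_smul, abs_of_nonneg hK0, ← norm_eq_l2n]
      exact mul_le_mul_of_nonneg_left w2 hK0
    rw [hE, ← mul_assoc]
    refine le_trans (l2n_mono ((Lp.memLp δ.snd).const_smul (C₀ * N)) ?_) this
    filter_upwards [hYb] with x hx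
    rw [Pi.smul_apply, norm_smul (C₀ * N), Real.norm_of_nonneg hK0]
    exact hx
  have lp1 : ‖p.fst‖ ≤ C₀ * E := by
    have : l2n (volume.restrict Ω) (fun x => (C₀ * N) • δ.fst x) ≤ C₀ * N * w := by
      rw [l2n_const_smul, abs_of_nonneg hK0, ← norm_eq_l2n]
      exact mul_le_mul_of_nonneg_left w1 hK0
    rw [hE, ← mul_assoc, norm_eq_l2n]
    refine le_trans (l2n_mono ((Lp.memLp δ.fst).const_smul (C₀ * N)) ?_) this
    filter_upwards [p1, hK] with x h1 hx
    rw [Pi.smul_apply, h1, norm_smul (C₀ * N), Real.norm_of_nonneg hK0, norm_mul]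
    exact mul_le_mul_of_nonneg_right hx (norm_nonneg _)
  have lp2 : ‖p.snd‖ ≤ C₀ * E + X := by
    rw [norm_eq_l2n, l2n_congr p2]
    exact (l2n_add_le mY mX).trans (add_le_add lY le_rfl)
  have lp : ‖p‖ ≤ 2 * (C₀ * E) + X := (norm_le_fst_add_snd p).trans (by linarith)
  have mG : MemLp (fun x => (2 : ℝ) • (y.fst x • δ.snd x) + δ.fst x • y.snd x) 2
      (volume.restrict Ω) := (mY.const_smul (2 : ℝ)).add mX
  have lG : l2n (volume.restrict Ω) (fun x => (2 : ℝ) • (y.fst x • δ.snd x) + δ.fst x • y.snd x) ≤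
      2 * (C₀ * E) + X := by
    refine (l2n_add_le (mY.const_smul (2 : ℝ)) mX).trans (add_le_add ?_ le_rfl)
    have := l2n_const_smul (μ := volume.restrict Ω) (2 : ℝ) (fun x => y.fst x • δ.snd x)
    rw [abs_of_pos two_pos] at this
    refine this.trans_le (mul_le_mul_of_nonneg_left lY two_pos.le)
  -- One factor `δ` is split off from `∇(y δ²)`: it is paired with `∇y` in the diffusion term and
  -- with `y` in the transport term.
  have c2' : χ.snd =ᵐ[volume.restrict Ω]
      fun x => δ.fst x • ((2 : ℝ) • (y.fst x • δ.snd x) + δ.fst x • y.snd x) := by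
    filter_upwards [c2, p1, p2] with x h h1 h2
    rw [h, h1, h2]
    module
  have hform := hyg χ hχ
  rw [ellipticForm_eq hΩ (abs_coeff_le hq) hQ b c hy, Fin.sum_univ_two] at hform
  -- The square of `δ ∇y` appears with weight at least `q₀`; the mixed term with `y ∇δ` is
  -- controlled by the sup bound on `y`.
  have hD : q₀ * X ^ 2 - 2 * (|q₀| + |q₁|) * (X * (C₀ * E)) ≤
      ∫ x in Ω, q.1.fst x * inner ℝ (y.snd x) (χ.snd x) := by
    have i1 := mX.norm.integrable_sq
    have i2 := integrable_norm_mul_norm mX mY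
    have hl := integral_norm_mul_norm_le mX mY
    have hl' : X * l2n (volume.restrict Ω) (fun x => y.fst x • δ.snd x) ≤ X * (C₀ * E) :=
      mul_le_mul_of_nonneg_left lY hX0
    have hm : ∫ x in Ω, (q₀ * ‖δ.fst x • y.snd x‖ ^ 2
        - 2 * (|q₀| + |q₁|) * (‖δ.fst x • y.snd x‖ * ‖y.fst x • δ.snd x‖)) ≤
        ∫ x in Ω, q.1.fst x * inner ℝ (y.snd x) (χ.snd x) := by
      refine integral_mono_ae ((i1.const_mul q₀).sub (i2.const_mul _))
        (diffusion_bound (abs_coeff_le hq) hQ y χ).1 ?_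
      filter_upwards [c2', hq, abs_coeff_le hq] with x h1 h2 h3
      have e : inner ℝ (y.snd x) (χ.snd x) = ‖δ.fst x • y.snd x‖ ^ 2
          + 2 * inner ℝ (δ.fst x • y.snd x) (y.fst x • δ.snd x) := by
        rw [h1, ← real_inner_self_eq_norm_sq]
        simp only [real_inner_smul_left, real_inner_smul_right, inner_add_right]
        ring
      have a1 := abs_real_inner_le_norm (δ.fst x • y.snd x) (y.fst x • δ.snd x)
      have a2 : |q.1.fst x * inner ℝ (δ.fst x • y.snd x) (y.fst x • δ.snd x)| ≤
          (|q₀| + |q₁|) * (‖δ.fst x • y.snd x‖ * ‖y.fst x • δ.snd x‖) := by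
        rw [abs_mul]
        exact mul_le_mul h3 a1 (abs_nonneg _) hQ
      have a3 := neg_abs_le (q.1.fst x * inner ℝ (δ.fst x • y.snd x) (y.fst x • δ.snd x))
      have a4 := mul_le_mul_of_nonneg_right h2.1 (sq_nonneg ‖δ.fst x • y.snd x‖)
      rw [e]
      linarith
    rw [integral_sub (i1.const_mul q₀) (i2.const_mul _), integral_const_mul, integral_const_mul,
      ← l2n_sq mX] at hm
    refine le_trans ?_ hm
    have := mul_le_mul_of_nonneg_left (hl.trans hl') (by positivity : 0 ≤ 2 * (|q₀| + |q₁|))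
    linarith
  -- The integrand is `(p b) · (2 y ∇δ + δ ∇y)`, and multiplication of `p` by `b` is a small
  -- perturbation.
  have hT (j : Fin 2) : ∫ x in Ω, y.fst x * ((b j).1.fst x * χ.snd x j) ≤
      (q₀ / 8 * X + (q₀ / 8 * (2 * C₀) + D j * C₀) * E) * (2 * (C₀ * E) + X) := by
    refine (le_abs_self _).trans (le_trans (abs_integral_le_l2n (hmul p hp _ (b j).2).1 mG ?_) ?_)
    · filter_upwards [c2', p1] with x h1 h2
      rw [h1, h2]
      simp only [PiLp.smul_apply, smul_eq_mul]
      have e (z : Plane) : y.fst x * ((b j).1.fst x * (δ.fst x * z j))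
          = (y.fst x * δ.fst x * (b j).1.fst x) * z j := by ring
      rw [e, abs_mul]
      exact mul_le_mul_of_nonneg_left (abs_apply_le_norm _ _) (abs_nonneg _)
    · refine mul_le_mul ?_ lG (l2n_nonneg _) (by have := hd j; positivity)
      refine (hsm j p hp).trans ?_
      have a1 := mul_le_mul_of_nonneg_left lp (by positivity : 0 ≤ q₀ / 8)
      have a2 := mul_le_mul_of_nonneg_left lp1 (‹∀ j, 0 ≤ D j› j)
      linarith
  have hR : |∫ x in Ω, c x * y.fst x * χ.fst x| ≤ ‖c‖ * (C₀ * E) ^ 2 := by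
    have e : ∫ x in Ω, c x * y.fst x * χ.fst x = ∫ x in Ω, c x * p.fst x * p.fst x := by
      refine integral_congr_ae ?_
      filter_upwards [c1, p1] with x h1 h2
      rw [h1, h2]; ring
    rw [e, sq, ← mul_assoc]
    refine (reaction_bound c p p).2.trans ?_
    gcongr
  -- The norm of `χ = p δ` is estimated as a product of an element of `H10` and one of `H1`, without
  -- using `B`.
  have hg : inner ℝ g χ.fst ≤ S * E * (2 * (C₀ * E) + X) := by
    refine (real_inner_le_norm _ _).trans ?_
    have a1 : ‖χ.fst‖ ≤ S * (C₀ * E * w + w * (C₀ * E + X)) := by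
      rw [norm_eq_l2n, l2n_congr c1]
      refine (hmul p hp δ hδ).2.trans (mul_le_mul_of_nonneg_left (add_le_add ?_ ?_) hS)
      · gcongr
      · gcongr
    calc ‖g‖ * ‖χ.fst‖ ≤ N * (S * (C₀ * E * w + w * (C₀ * E + X))) := by gcongr
      _ = _ := by rw [hE]; ring
  have hRneg := neg_abs_le (∫ x in Ω, c x * y.fst x * χ.fst x)
  refine harith X E hX0 hE0 ?_
  have h0 := hT 0
  have h1 := hT 1
  linarith

/-- The difference of two elliptic forms at a weak solution of the stationary problem. -/
theorem exists_form_difference_bound (hΩ : IsOpen Ω) (b : Fin 2 → H1 Ω)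
    (c : Lp ℝ ⊤ (volume.restrict Ω)) {q₀ : ℝ} (hq₀ : 0 < q₀) (q₁ : ℝ) :
    ∃ C : ℝ, 0 ≤ C ∧ ∀ q ∈ admissible Ω q₀ q₁, ∀ q' ∈ admissible Ω q₀ q₁, ∀ y ∈ H10 Ω, ∀ g : L2 Ω,
      (∀ φ ∈ H10 Ω, ellipticForm q b c y φ = inner ℝ g φ.fst) → ∀ φ : GradPair Ω,
      |ellipticForm q b c y φ - ellipticForm q' b c y φ| ≤
        C * (‖g‖ + ‖y‖) * ‖q - q'‖ * ‖φ‖ := by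
  obtain ⟨C, hC, h⟩ := exists_weighted_gradient_bound hΩ b c hq₀ q₁
  have hQ : 0 ≤ |q₀| + |q₁| := by positivity
  refine ⟨C, hC, fun q hq q' hq' y hy g hyg φ => ?_⟩
  have hB : ∀ᵐ x ∂volume.restrict Ω, |(q.1 - q'.1).fst x| ≤ 2 * (|q₀| + |q₁|) := by
    filter_upwards [coeFn_sub_fst q.1 q'.1, abs_coeff_le hq, abs_coeff_le hq'] with x h1 h2 h3
    rw [h1]
    exact (abs_sub _ _).trans (by linarith)
  have e : ellipticForm q b c y φ - ellipticForm q' b c y φ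
      = ∫ x in Ω, (q.1 - q'.1).fst x * inner ℝ (y.snd x) (φ.snd x) := by
    rw [ellipticForm_eq hΩ (abs_coeff_le hq) hQ b c hy,
      ellipticForm_eq hΩ (abs_coeff_le hq') hQ b c hy]
    have := integral_sub (diffusion_bound (abs_coeff_le hq) hQ y φ).1
      (diffusion_bound (abs_coeff_le hq') hQ y φ).1
    have e2 : ∫ x in Ω, (q.1 - q'.1).fst x * inner ℝ (y.snd x) (φ.snd x)
        = ∫ x in Ω, (q.1.fst x * inner ℝ (y.snd x) (φ.snd x)
          - q'.1.fst x * inner ℝ (y.snd x) (φ.snd x)) := by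
      refine integral_congr_ae ?_
      filter_upwards [coeFn_sub_fst q.1 q'.1] with x h1
      rw [h1, sub_mul]
    rw [e2, this]
    ring
  have key (N : ℝ) (hN : 0 < N) (h1 : ‖g‖ + ‖y‖ ≤ N) :
      |ellipticForm q b c y φ - ellipticForm q' b c y φ| ≤ C * N * ‖q - q'‖ * ‖φ‖ := by
    obtain ⟨m, hb⟩ := h q hq y hy g hyg N hN (by linarith [norm_nonneg y])
      (by linarith [norm_nonneg g]) (q.1 - q'.1) (q - q').2 _ hB
    rw [e]
    refine (abs_integral_le_l2n m (Lp.memLp φ.snd) (.of_forall fun x => ?_)).trans ?_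
    · rw [norm_smul, abs_mul, mul_assoc]
      exact mul_le_mul_of_nonneg_left (abs_real_inner_le_norm _ _) (abs_nonneg _)
    · rw [← norm_eq_l2n, mul_assoc C]
      exact mul_le_mul hb (norm_gradPair_snd_le φ) (norm_nonneg _) (by positivity)
  -- The weighted estimate needs a positive `N`; letting `N` decrease to `‖g‖ + ‖y‖` includes the
  -- case of zero data.
  have lim : Filter.Tendsto (fun N => C * N * ‖q - q'‖ * ‖φ‖)
      (nhdsWithin (‖g‖ + ‖y‖) (Ioi (‖g‖ + ‖y‖))) (nhds (C * (‖g‖ + ‖y‖) * ‖q - q'‖ * ‖φ‖)) :=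
    (Continuous.tendsto (by fun_prop) _).mono_left nhdsWithin_le_nhds
  refine ge_of_tendsto lim ?_
  filter_upwards [self_mem_nhdsWithin] with N hN
  exact key N (lt_of_le_of_lt (by positivity) hN) (le_of_lt hN)

end CoefficientDifference

/-! ### Finite element functions are Lipschitz and belong to `H¹` -/

section Lipschitz

open Topology NNReal

/-- A continuous function on an interval covered by finitely many closed sets, on each of which
the function is Lipschitz. -/
theorem sub_le_of_finite_closed_cover {ι : Type*} [Finite ι] {f : ℝ → ℝ} {a b K : ℝ} (hab : a ≤ b)
    (hf : ContinuousOn f (Icc a b)) (F : ι → Set ℝ) (hF : ∀ i, IsClosed (F i))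
    (hcov : Icc a b ⊆ ⋃ i, F i)
    (hK : ∀ i, ∀ s ∈ F i ∩ Icc a b, ∀ t ∈ F i ∩ Icc a b, |f s - f t| ≤ K * |s - t|) :
    f b - f a ≤ K * (b - a) := by
  have key : Icc a b ⊆ {t | f t - f a ≤ K * (t - a)} := by
    refine IsClosed.Icc_subset_of_forall_exists_gt ?_ (by simp) ?_
    · have h1 : ContinuousOn (fun t => f t - f a - K * (t - a)) (Icc a b) := by fun_prop
      have := h1.preimage_isClosed_of_isClosed isClosed_Icc (isClosed_Iic (a := (0 : ℝ)))
      convert this using 1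
      ext t
      simp only [mem_inter_iff, mem_ofPred_eq, mem_preimage, mem_Iic, sub_nonpos]
      tauto
    · rintro x ⟨hx, hxab⟩ y hy
      have hy : x < y := hy
      have ev : ∀ᶠ t in 𝓝[>] x, ∃ i, t ∈ F i := by
        filter_upwards [Ioo_mem_nhdsGT hxab.2] with t ht
        exact mem_iUnion.1 (hcov ⟨hxab.1.trans ht.1.le, ht.2.le⟩)
      -- Among finitely many sets one accumulates at `x` from the right. Being closed it contains
      -- `x`, and its Lipschitz bound carries the estimate a little further.
      obtain ⟨i, hi⟩ := Filter.frequently_exists.1 ev.frequently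
      have hxi : x ∈ F i := by
        rw [← (hF i).closure_eq, mem_closure_iff_frequently]
        exact hi.filter_mono nhdsWithin_le_nhds
      obtain ⟨t, hti, ht⟩ := (hi.and_eventually
        (Ioo_mem_nhdsGT (lt_min hy hxab.2))).exists
      have ht1 : t < y := ht.2.trans_le (min_le_left _ _)
      have ht2 : t < b := ht.2.trans_le (min_le_right _ _)
      refine ⟨t, ?_, ht.1, ht1.le⟩
      have h := hK i t ⟨hti, hxab.1.trans ht.1.le, ht2.le⟩ x ⟨hxi, hxab.1, hxab.2.le⟩
      rw [abs_of_pos (sub_pos.2 ht.1)] at h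
      have h' := le_abs_self (f t - f x)
      have hx : f x - f a ≤ K * (x - a) := hx
      show f t - f a ≤ K * (t - a)
      linarith
  exact key (right_mem_Icc.2 hab)

/-- Restriction to segments, which stay in the convex set, reduces to the one-dimensional case. -/
theorem lipschitzOnWith_of_finite_closed_cover {E ι : Type*} [NormedAddCommGroup E] [NormedSpace ℝ E]
    [Finite ι] {D : Set E} (hD : Convex ℝ D) {g : E → ℝ} (hg : ContinuousOn g D) (F : ι → Set E)
    (hF : ∀ i, IsClosed (F i)) (hcov : D ⊆ ⋃ i, F i) {K : ℝ≥0} (hK : ∀ i, LipschitzOnWith K g (F i)) :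
    LipschitzOnWith K g D := by
  have key (x : E) (hx : x ∈ D) (y : E) (hy : y ∈ D) : g y - g x ≤ K * ‖y - x‖ := by
    have hmem (t : ℝ) (ht : t ∈ Icc (0 : ℝ) 1) : AffineMap.lineMap x y t ∈ D :=
      hD.lineMap_mem hx hy ht
    have hc : Continuous (fun t : ℝ => (AffineMap.lineMap x y t : E)) := AffineMap.lineMap_continuous
    have h := sub_le_of_finite_closed_cover (f := fun t => g (AffineMap.lineMap x y t))
      (K := K * ‖y - x‖) zero_le_one (hg.comp hc.continuousOn hmem)
      (fun i => (fun t : ℝ => (AffineMap.lineMap x y t : E)) ⁻¹' F i) (fun i => (hF i).preimage hc)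
      (fun t ht => by
        obtain ⟨i, hi⟩ := mem_iUnion.1 (hcov (hmem t ht))
        exact mem_iUnion.2 ⟨i, hi⟩)
      (fun i s hs t ht => by
        have h1 := (hK i).dist_le_mul _ hs.1 _ ht.1
        rw [Real.dist_eq, dist_lineMap_lineMap, Real.dist_eq, dist_comm, dist_eq_norm] at h1
        calc _ ≤ _ := h1
          _ = _ := by ring)
    simpa using h
  refine LipschitzOnWith.of_dist_le_mul fun x hx y hy => ?_
  rw [Real.dist_eq, dist_eq_norm, abs_le]
  have h1 := key x hx y hy
  rw [norm_sub_rev] at h1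
  exact ⟨by linarith, key y hy x hx⟩

theorem contDiff_mvPolynomial_eval (P : MvPolynomial (Fin 2) ℝ) :
    ContDiff ℝ 1 (fun x : Plane => MvPolynomial.eval (fun i => x i) P) := by
  induction P using MvPolynomial.induction_on with
  | C a => simpa using contDiff_const
  | add p q hp hq => simpa using hp.add hq
  | mul_X p i hp =>
    have : ContDiff ℝ 1 (fun x : Plane => x i) := (EuclideanSpace.proj (𝕜 := ℝ) i).contDiff
    simpa using hp.mul this

theorem exists_lipschitzOnWith_of_contDiff {f : Plane → ℝ} (hf : ContDiff ℝ 1 f) {s : Set Plane}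
    (hs : Convex ℝ s) (hc : IsCompact s) : ∃ K : ℝ≥0, LipschitzOnWith K f s := by
  obtain ⟨B, hB⟩ := hc.exists_bound_of_continuousOn (hf.continuous_fderiv one_ne_zero).continuousOn
  refine ⟨B.toNNReal, Convex.lipschitzOnWith_of_nnnorm_fderiv_le (𝕜 := ℝ)
    (fun x _ => hf.differentiable one_ne_zero x) (fun x hx => ?_) hs⟩
  rw [← NNReal.coe_le_coe, coe_nnnorm]
  exact (hB x hx).trans (Real.le_coe_toNNReal B)

theorem exists_lipschitz_of_mem_lagrangeSpace {Ω : Set Plane} (hΩ : Convex ℝ Ω) (𝒯 : Triangulation Ω)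
    {k : ℕ} {w : L2 Ω} (hw : w ∈ lagrangeSpace 𝒯 k) (hm : MeasurableSet Ω) :
    ∃ (K : ℝ≥0) (g : Plane → ℝ), LipschitzWith K g ∧ w =ᵐ[volume.restrict Ω] g := by
  obtain ⟨g, hg, hgP, hwg⟩ := hw
  have : Finite 𝒯.faces := 𝒯.finite_faces.to_subtype
  have hcomp (s : 𝒯.faces) : IsCompact (convexHull ℝ ((s : Finset Plane) : Set Plane)) :=
    (s : Finset Plane).finite_toSet.isCompact_convexHull (𝕜 := ℝ)
  have hL (s : 𝒯.faces) : ∃ K : ℝ≥0, LipschitzOnWith K g (convexHull ℝ ((s : Finset Plane) : Set Plane)) := by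
    obtain ⟨P, -, hP⟩ := hgP s.1 s.2
    obtain ⟨K, hK⟩ := exists_lipschitzOnWith_of_contDiff (contDiff_mvPolynomial_eval P)
      (convex_convexHull ℝ _) (hcomp s)
    refine ⟨K, fun x hx y hy => ?_⟩
    rw [hP x hx, hP y hy]
    exact hK hx hy
  choose K hK using hL
  obtain ⟨B, hB⟩ := (finite_range K).bddAbove
  have hlip : LipschitzOnWith B g (closure Ω) :=
    lipschitzOnWith_of_finite_closed_cover hΩ.closure hg
      (fun s : 𝒯.faces => convexHull ℝ ((s : Finset Plane) : Set Plane))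
      (fun s => (hcomp s).isClosed) (fun x hx => by
        rw [← 𝒯.space_eq, Geometry.SimplicialComplex.mem_space_iff] at hx
        obtain ⟨s, hs, hxs⟩ := hx
        exact mem_iUnion.2 ⟨⟨s, hs⟩, hxs⟩)
      fun s => (hK s).weaken (hB (mem_range_self s))
  obtain ⟨g', hg', he⟩ := hlip.extend_real
  refine ⟨B, g', hg', ?_⟩
  filter_upwards [hwg, ae_restrict_mem hm] with x hx hxΩ
  rw [hx, he (subset_closure hxΩ)]

/-- Lipschitz functions on bounded sets belong to `H¹`. -/
theorem LipschitzWith.weakPair_H1 {Ω : Set Plane} (hb : Bornology.IsBounded Ω) (hm : MeasurableSet Ω)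
    {K : ℝ≥0} {g : Plane → ℝ} (hg : LipschitzWith K g) :
    WeakPair (H1 Ω) g (∇ g) ∧ ∀ x, ‖∇ g x‖ ≤ K := by
  have hfin : IsFiniteMeasure (volume.restrict Ω) := ⟨by
    rw [Measure.restrict_apply_univ]; exact hb.measure_lt_top⟩
  have hgb (x : Plane) : ‖∇ g x‖ ≤ K := by
    rw [gradient, LinearIsometryEquiv.norm_map]
    exact norm_fderiv_le_of_lipschitz ℝ hg
  have m1 : MemLp g 2 (volume.restrict Ω) := by
    obtain ⟨B, hB⟩ := (hb.isCompact_closure).exists_bound_of_continuousOn hg.continuous.continuousOn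
    refine MemLp.of_bound hg.continuous.aestronglyMeasurable B ?_
    filter_upwards [ae_restrict_mem hm] with x hx
    exact hB x (subset_closure hx)
  have hmg : Measurable (∇ g) :=
    (InnerProductSpace.toDual ℝ Plane).symm.continuous.measurable.comp (measurable_fderiv ℝ g)
  have m2 : MemLp (∇ g) 2 (volume.restrict Ω) :=
    MemLp.of_bound hmg.aestronglyMeasurable K (.of_forall hgb)
  refine ⟨(weakPair_iff m1 m2).2 fun φ hφ => ?_, hgb⟩
  have e1 : ∫ x in Ω, (mkPair m1 m2).fst x • ∇ φ x = ∫ x, g x • ∇ φ x := by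
    refine Eq.trans (integral_congr_ae ?_) (setIntegral_eq_integral_of_forall_compl_eq_zero
      (f := fun x => g x • ∇ φ x) fun x hx => ?_)
    · filter_upwards [mkPair_fst m1 m2] with x hx
      rw [hx]
    · rw [hφ.gradient_eq_zero hx, smul_zero]
  have e2 : ∫ x in Ω, φ x • (mkPair m1 m2).snd x = ∫ x, φ x • ∇ g x := by
    refine Eq.trans (integral_congr_ae ?_) (setIntegral_eq_integral_of_forall_compl_eq_zero
      (f := fun x => φ x • ∇ g x) fun x hx => ?_)
    · filter_upwards [mkPair_snd m1 m2] with x hx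
      rw [hx]
    · rw [image_eq_zero_of_notMem_tsupport fun h => hx (hφ.2.2 h), zero_smul]
  rw [e1, e2]
  have i1 : Integrable (fun x => g x • ∇ φ x) :=
    (hg.continuous.smul hφ.continuous_gradient).integrable_of_hasCompactSupport
      (hφ.2.1.of_isClosed_subset (isClosed_tsupport _) (closure_minimal (fun x hx => by
        by_contra h
        exact hx (by
          show g x • ∇ φ x = 0
          rw [IsTestFunction.gradient_eq_zero (Ω := tsupport φ) ⟨hφ.1, hφ.2.1, subset_rfl⟩ h,
            smul_zero])) (isClosed_tsupport _)))
  have i2 : Integrable (fun x => φ x • ∇ g x) := by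
    have h := (hφ.1.continuous.integrable_of_hasCompactSupport hφ.2.1 (μ := volume)).norm.mul_const (K : ℝ)
    refine h.mono' (hφ.1.continuous.aestronglyMeasurable.smul hmg.aestronglyMeasurable)
      (.of_forall fun x => ?_)
    rw [norm_smul]
    exact mul_le_mul_of_nonneg_left (hgb x) (norm_nonneg _)
  obtain ⟨D, hD⟩ := hφ.1.lipschitzWith_of_hasCompactSupport hφ.2.1 (by simp)
  refine ext_inner_right ℝ fun v => ?_
  rw [inner_neg_left, real_inner_comm, ← integral_inner i1, real_inner_comm, ← integral_inner i2]
  -- Integration by parts for Lipschitz functions in the direction `v`; by Rademacher's theorem the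
  -- line derivative is the pairing with the gradient almost everywhere.
  have h := LipschitzWith.integral_lineDeriv_mul_eq (μ := (volume : Measure Plane)) hg hD hφ.2.1 v
  have l1 : ∫ x, inner ℝ v (φ x • ∇ g x) = ∫ x, lineDeriv ℝ g x v * φ x := by
    refine integral_congr_ae ?_
    filter_upwards [hg.ae_differentiableAt (μ := (volume : Measure Plane))] with x hx
    rw [hx.lineDeriv_eq_fderiv, real_inner_smul_right, real_inner_comm, real_inner_gradient, mul_comm]
  have l2 : ∫ x, inner ℝ v (g x • ∇ φ x) = - ∫ x, lineDeriv ℝ φ x (-v) * g x := by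
    rw [← integral_neg]
    refine integral_congr_ae (.of_forall fun x => ?_)
    dsimp only
    rw [(hφ.differentiableAt x).lineDeriv_eq_fderiv, real_inner_smul_right, real_inner_comm,
      real_inner_gradient, map_neg]
    ring
  rw [l1, l2, h]

/-- An inverse inequality on a fixed mesh: each basis function has a bounded gradient, and the
coordinates are continuous in the `L²` norm because the space is finite dimensional. -/
theorem exists_H1_of_mem_lagrangeSpace {Ω : Set Plane} (hΩ : Convex ℝ Ω) (hb : Bornology.IsBounded Ω)
    (hm : MeasurableSet Ω) (𝒯 : Triangulation Ω) (k : ℕ) :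
    ∃ C : ℝ, 0 ≤ C ∧ ∀ w ∈ lagrangeSpace 𝒯 k, ∃ W ∈ H1 Ω, W.fst = w ∧
      ∀ᵐ x ∂volume.restrict Ω, ‖W.snd x‖ ≤ C * ‖w‖ := by
  let e := Module.finBasis ℝ (lagrangeSpace 𝒯 k)
  have hW (i : Fin (Module.finrank ℝ (lagrangeSpace 𝒯 k))) : ∃ K : ℝ, 0 ≤ K ∧ ∃ W ∈ H1 Ω,
      W.fst = (e i).1 ∧ ∀ᵐ x ∂volume.restrict Ω, ‖W.snd x‖ ≤ K := by
    obtain ⟨K, g, hg, hw⟩ := exists_lipschitz_of_mem_lagrangeSpace hΩ 𝒯 (e i).2 hm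
    obtain ⟨⟨W, hW, h1, h2⟩, hK⟩ := hg.weakPair_H1 hb hm
    refine ⟨K, K.2, W, hW, Lp.ext (h1.trans hw.symm), ?_⟩
    filter_upwards [h2] with x hx
    rw [hx]; exact hK x
  choose K hK W hW h1 h2 using hW
  let c (i : Fin (Module.finrank ℝ (lagrangeSpace 𝒯 k))) := (e.coord i).toContinuousLinearMap
  refine ⟨∑ i, ‖c i‖ * K i, Finset.sum_nonneg fun i _ => mul_nonneg (norm_nonneg (c i)) (hK i),
    fun w hw => ⟨∑ i, e.repr ⟨w, hw⟩ i • W i,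
      (H1 Ω).sum_mem fun i _ => (H1 Ω).smul_mem _ (hW i), ?_, ?_⟩⟩
  · have := congrArg Subtype.val (e.sum_repr ⟨w, hw⟩)
    rw [Submodule.coe_sum] at this
    rw [← WithLp.fstL_apply 2 ℝ, map_sum]
    refine Eq.trans (Finset.sum_congr rfl fun i _ => ?_) this
    rw [map_smul, WithLp.fstL_apply, h1]; rfl
  · have hs : (∑ i, e.repr ⟨w, hw⟩ i • W i).snd = ∑ i, e.repr ⟨w, hw⟩ i • (W i).snd := by
      rw [← WithLp.sndL_apply 2 ℝ, map_sum]
      exact Finset.sum_congr rfl fun i _ => by rw [map_smul, WithLp.sndL_apply]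
    rw [hs]
    have h3 : ∀ᵐ x ∂volume.restrict Ω, ∀ i, ‖(W i).snd x‖ ≤ K i := ae_all_iff.2 h2
    have h4 : ∀ᵐ x ∂volume.restrict Ω, ∀ i,
        (e.repr ⟨w, hw⟩ i • (W i).snd : L2Vec Ω) x = e.repr ⟨w, hw⟩ i • (W i).snd x :=
      ae_all_iff.2 fun i => Lp.coeFn_smul _ _
    filter_upwards [h3, h4, Lp.coeFn_finsetSum (Finset.univ)
      (fun i => (e.repr ⟨w, hw⟩ i • (W i).snd : L2Vec Ω))] with x h3 h4 h5
    rw [h5, Finset.sum_apply, Finset.sum_mul]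
    refine (norm_sum_le _ _).trans (Finset.sum_le_sum fun i _ => ?_)
    rw [h4, norm_smul]
    have h6 : ‖e.repr ⟨w, hw⟩ i‖ ≤ ‖c i‖ * ‖w‖ := (c i).le_opNorm ⟨w, hw⟩
    calc _ ≤ ‖c i‖ * ‖w‖ * K i := mul_le_mul h6 (h3 i) (norm_nonneg _) (by positivity)
      _ = _ := by ring

end Lipschitz

/-! ### From weak solutions to the abstract integrated equation -/

section WeakSolutions

variable {Ω : Set Plane}

instance completeSpace_H10 : CompleteSpace ↥(H10 Ω) := isClosed_H10.completeSpace_coe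

/-- The values on `[0, T]`, extended by constants to a function on the line. -/
def extendIcc {T : ℝ} (hT : 0 < T) (v : ℝ → L2 Ω) (t : ℝ) : L2 Ω := v (projIcc 0 T hT.le t)

theorem extendIcc_of_mem {T : ℝ} (hT : 0 < T) (v : ℝ → L2 Ω) {t : ℝ} (ht : t ∈ Icc 0 T) :
    extendIcc hT v t = v t := by rw [extendIcc, projIcc_of_mem _ ht]

theorem continuous_extendIcc {T : ℝ} (hT : 0 < T) {v : ℝ → L2 Ω} (hv : ContinuousOn v (Icc 0 T)) :
    Continuous (extendIcc hT v) :=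
  (continuousOn_iff_continuous_domRestrict.1 hv).comp (continuous_projIcc)

/-- The elliptic form is linear in the solution, so the time integral of the form is the form at the
primitive. The null set of exceptional times disappears in the integral. -/
theorem IsWeakSolution.exists_primitive {T : ℝ} (hT : 0 < T) {q : H1 Ω} {b : Fin 2 → H1 Ω}
    {c : Lp ℝ ⊤ (volume.restrict Ω)} {g : ℝ → L2 Ω} {v₀ : L2 Ω} {v : ℝ → L2 Ω}
    (h : IsWeakSolution T q b c g v₀ v) {A : ↥(H10 Ω) →L[ℝ] ↥(H10 Ω) →L[ℝ] ℝ}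
    (hA : ∀ v φ, A v φ = ellipticForm q b c v.1 φ.1) :
    ∃ Z : ℝ → ↥(H10 Ω), Continuous Z ∧
      (∀ t ∈ Icc 0 T, inclL2 Ω (Z t) = ∫ s in (0 : ℝ)..t, extendIcc hT v s) ∧
      ∀ t ∈ Icc 0 T, ∀ φ, inner ℝ (extendIcc hT v t) (inclL2 Ω φ) + A (Z t) φ
        = inner ℝ v₀ (inclL2 Ω φ) + ∫ s in (0 : ℝ)..t, inner ℝ (g s) (inclL2 Ω φ) := by
  obtain ⟨V, hV, hVm, hw⟩ := h.weak
  -- The projection provides a function with values in `H10` at every time, integrable there, which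
  -- agrees with `V` almost everywhere.
  let P := (H10 Ω).orthogonalProjectionOnto
  let Y : ℝ → ↥(H10 Ω) := (Ioc 0 T).indicator fun t => P (V t)
  have hYi : Integrable Y := by
    refine (integrable_indicator_iff (μ := volume) measurableSet_Ioc).2 ?_
    exact P.integrable_comp (hV.integrable (by norm_num))
  have hYii (a b : ℝ) : IntervalIntegrable Y volume a b := hYi.intervalIntegrable
  have hYV : ∀ᵐ s, s ∈ Ioc 0 T → (Y s).1 = V s ∧ (V s).fst = v s := by
    filter_upwards [(ae_restrict_iff' measurableSet_Ioc).1 hVm] with s hs hsT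
    obtain ⟨h1, h2⟩ := hs hsT
    refine ⟨?_, h2⟩
    show ((Ioc 0 T).indicator (fun t => P (V t)) s).1 = V s
    rw [indicator_of_mem hsT]
    exact Submodule.starProjection_eq_self_iff.2 h1
  have hsub {t : ℝ} (ht : t ∈ Icc 0 T) {s : ℝ} (hs : s ∈ uIoc 0 t) : s ∈ Ioc 0 T := by
    rw [uIoc_of_le ht.1] at hs
    exact ⟨hs.1, hs.2.trans ht.2⟩
  refine ⟨fun t => ∫ s in (0 : ℝ)..t, Y s, intervalIntegral.continuous_primitive hYii 0,
    fun t ht => ?_, fun t ht φ => ?_⟩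
  · rw [← ContinuousLinearMap.intervalIntegral_comp_comm _ (hYii 0 t)]
    refine intervalIntegral.integral_congr_ae ?_
    filter_upwards [hYV] with s hs hst
    obtain ⟨h1, h2⟩ := hs (hsub ht hst)
    rw [inclL2_apply, h1, h2, extendIcc_of_mem hT v (Ioc_subset_Icc_self (hsub ht hst))]
  · have e1 : A (∫ s in (0 : ℝ)..t, Y s) φ = ∫ s in (0 : ℝ)..t, ellipticForm q b c (V s) φ.1 := by
      rw [← ContinuousLinearMap.flip_apply, ← ContinuousLinearMap.intervalIntegral_comp_comm _ (hYii 0 t)]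
      refine intervalIntegral.integral_congr_ae ?_
      filter_upwards [hYV] with s hs hst
      rw [ContinuousLinearMap.flip_apply, hA, (hs (hsub ht hst)).1]
    rw [e1, extendIcc_of_mem hT v ht]
    have := hw φ.1 φ.2 t ht
    simp only [inclL2_apply]
    linarith

theorem IsWeakSolution.integratedSolution {T : ℝ} (hT : 0 < T) {q : H1 Ω} {b : Fin 2 → H1 Ω}
    {c : Lp ℝ ⊤ (volume.restrict Ω)} {f v₀ : L2 Ω} {v : ℝ → L2 Ω}
    (h : IsWeakSolution T q b c (fun _ => f) v₀ v) {A : ↥(H10 Ω) →L[ℝ] ↥(H10 Ω) →L[ℝ] ℝ}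
    (hA : ∀ v φ, A v φ = ellipticForm q b c v.1 φ.1) :
    ∃ Z, IntegratedSolution (inclL2 Ω) A T Z (extendIcc hT v) (fun t => v₀ + t • f) := by
  obtain ⟨Z, hZ, h1, h2⟩ := h.exists_primitive hT hA
  refine ⟨Z, hZ, continuous_extendIcc hT h.continuousOn, by fun_prop, h1, fun t ht φ => ?_⟩
  rw [h2 t ht φ, intervalIntegral.integral_const, inner_add_left, real_inner_smul_left, sub_zero,
    smul_eq_mul]

/-- The feedback on `v` is moved into the form as a zero order term. The feedback on `u` stays on
the right, expressed by the primitive `Z₀`, which is the time-smoothed quantity the abstract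
estimate can differentiate. -/
theorem IsAssimilation.integratedSolution {T : ℝ} (hT : 0 < T) {𝒯 : Triangulation Ω} {k : ℕ} {μ : ℝ}
    {q : H1 Ω} {b : Fin 2 → H1 Ω} {c : Lp ℝ ⊤ (volume.restrict Ω)} {f : L2 Ω} {u v : ℝ → L2 Ω}
    (h : IsAssimilation T 𝒯 k μ q b c f u v) {A : ↥(H10 Ω) →L[ℝ] ↥(H10 Ω) →L[ℝ] ℝ}
    (hA : ∀ v φ, A v φ = ellipticForm q b c v.1 φ.1) (hu : ContinuousOn u (Icc 0 T))
    {Z₀ : ℝ → ↥(H10 Ω)} (hZ₀ : Continuous Z₀)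
    (hZu : ∀ t ∈ Icc 0 T, inclL2 Ω (Z₀ t) = ∫ s in (0 : ℝ)..t, extendIcc hT u s) :
    ∃ Z, IntegratedSolution (inclL2 Ω)
      (A + (loadFunctional (inclL2 Ω)).comp ((μ • meshProj 𝒯 k).comp (inclL2 Ω))) T Z (extendIcc hT v)
      (fun t => t • f + (μ • meshProj 𝒯 k) (inclL2 Ω (Z₀ t))) := by
  obtain ⟨Z, hZ, h1, h2⟩ := IsWeakSolution.exists_primitive hT h hA
  have cu := continuous_extendIcc hT hu
  have cv := continuous_extendIcc hT (IsWeakSolution.continuousOn h)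
  refine ⟨Z, hZ, cv, by fun_prop, h1, fun t ht φ => ?_⟩
  have e1 : ∫ s in (0 : ℝ)..t, inner ℝ (f + μ • meshProj 𝒯 k (u s - v s)) (inclL2 Ω φ)
      = inner ℝ (t • f + (μ • meshProj 𝒯 k) (inclL2 Ω (Z₀ t) - inclL2 Ω (Z t))) (inclL2 Ω φ) := by
    have i1 : IntervalIntegrable (extendIcc hT u) volume 0 t := cu.intervalIntegrable _ _
    have i2 : IntervalIntegrable (extendIcc hT v) volume 0 t := cv.intervalIntegrable _ _
    have e2 : ∫ s in (0 : ℝ)..t, inner ℝ (f + μ • meshProj 𝒯 k (u s - v s)) (inclL2 Ω φ)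
        = ∫ s in (0 : ℝ)..t, (inner ℝ (inclL2 Ω φ) f + (innerSL ℝ (inclL2 Ω φ)).comp (μ • meshProj 𝒯 k)
          (extendIcc hT u s - extendIcc hT v s)) := by
      refine intervalIntegral.integral_congr fun s hs => ?_
      rw [uIcc_of_le ht.1] at hs
      have hs' : s ∈ Icc 0 T := ⟨hs.1, hs.2.trans ht.2⟩
      rw [extendIcc_of_mem hT u hs', extendIcc_of_mem hT v hs', real_inner_comm, inner_add_right]
      rfl
    have i3 : IntervalIntegrable (fun s => (innerSL ℝ (inclL2 Ω φ)).comp (μ • meshProj 𝒯 k)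
          (extendIcc hT u s - extendIcc hT v s)) volume 0 t :=
      Continuous.intervalIntegrable (by fun_prop) _ _
    rw [e2, intervalIntegral.integral_add (by simp) i3, intervalIntegral.integral_const,
      ContinuousLinearMap.intervalIntegral_comp_comm _ (i1.sub i2),
      intervalIntegral.integral_sub i1 i2, ← hZu t ht, ← h1 t ht, inner_add_left,
      real_inner_smul_left, sub_zero, smul_eq_mul, real_inner_comm f]
    congr 1
    rw [real_inner_comm]
    rfl
  have h3 := h2 t ht φ
  rw [inner_zero_left, zero_add, e1, map_sub] at h3
  simp only [add_apply, ContinuousLinearMap.comp_apply, loadFunctional_apply]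
  rw [← add_assoc, h3]
  simp only [inner_add_left, inner_sub_left]
  ring

theorem norm_smul_meshProj_le (𝒯 : Triangulation Ω) (k : ℕ) {μ M : ℝ} (h0 : 0 ≤ μ) (hM : μ ≤ M)
    (h : L2 Ω) : ‖(μ • meshProj 𝒯 k) h‖ ≤ M * ‖h‖ := by
  rw [smul_apply, norm_smul, Real.norm_of_nonneg h0]
  exact mul_le_mul hM (Submodule.norm_starProjection_apply_le _ h) (norm_nonneg _) (h0.trans hM)

theorem inner_meshProj_self_nonneg (𝒯 : Triangulation Ω) (k : ℕ) (h : L2 Ω) :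
    0 ≤ inner ℝ (meshProj 𝒯 k h) h := by
  have := Submodule.starProjection_inner_eq_zero (K := lagrangeSpace 𝒯 k) (𝕜 := ℝ) h
    ((lagrangeSpace 𝒯 k).starProjection h) (Submodule.starProjection_apply_mem _ _)
  rw [inner_sub_left, sub_eq_zero, real_inner_comm] at this
  rw [meshProj, this]
  exact real_inner_self_nonneg

/-- An orthogonal projection is nonnegative, so coercivity is not affected by `μ`; only the
boundedness constant grows, by at most `M`. -/
theorem IsGarding.add_meshProj {A : ↥(H10 Ω) →L[ℝ] ↥(H10 Ω) →L[ℝ] ℝ} {α κ K : ℝ}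
    (h : IsGarding (inclL2 Ω) A α κ K) (𝒯 : Triangulation Ω) (k : ℕ) {μ M : ℝ} (h0 : 0 ≤ μ)
    (hM : μ ≤ M) : IsGarding (inclL2 Ω)
      (A + (loadFunctional (inclL2 Ω)).comp ((μ • meshProj 𝒯 k).comp (inclL2 Ω))) α κ (K + M) where
  bound v φ := by
    simp only [add_apply, ContinuousLinearMap.comp_apply, loadFunctional_apply]
    rw [add_mul, add_mul]
    refine (abs_add_le _ _).trans (add_le_add (h.bound v φ) ((abs_real_inner_le_norm _ _).trans ?_))
    have hM0 := h0.trans hM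
    refine mul_le_mul ((norm_smul_meshProj_le 𝒯 k h0 hM _).trans ?_) (norm_inclL2_le φ)
      (norm_nonneg _) (by positivity)
    exact mul_le_mul_of_nonneg_left (norm_inclL2_le v) hM0
  coercive v := by
    have h1 := h.coercive v
    simp only [add_apply, ContinuousLinearMap.comp_apply, loadFunctional_apply,
      smul_apply, real_inner_smul_left]
    have := mul_nonneg h0 (inner_meshProj_self_nonneg 𝒯 k (inclL2 Ω v))
    linarith

/-- Adding the same zero order term to both forms does not affect the bound on their difference. -/
theorem abs_form_difference_le {p₁ p₂ : H1 Ω} {b : Fin 2 → H1 Ω}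
    {c : Lp ℝ ⊤ (volume.restrict Ω)} {A₁ A₂ : ↥(H10 Ω) →L[ℝ] ↥(H10 Ω) →L[ℝ] ℝ}
    (hA₁ : ∀ v φ, A₁ v φ = ellipticForm p₁ b c v.1 φ.1)
    (hA₂ : ∀ v φ, A₂ v φ = ellipticForm p₂ b c v.1 φ.1) {N M : ℝ} (hN : 0 ≤ N) (hM : 0 ≤ M)
    {P : L2 Ω →L[ℝ] L2 Ω} (hP : ∀ h, ‖P h‖ ≤ M * ‖h‖)
    (hdiff : ∀ y ∈ H10 Ω, ∀ g : L2 Ω,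
      (∀ φ ∈ H10 Ω, ellipticForm p₂ b c y φ = inner ℝ g φ.fst) → ∀ φ : GradPair Ω,
      |ellipticForm p₂ b c y φ - ellipticForm p₁ b c y φ| ≤
        N * (‖g‖ + ‖y‖) * ‖p₂ - p₁‖ * ‖φ‖) (y : ↥(H10 Ω)) (g : L2 Ω)
    (hyg : ∀ φ, (A₂ + (loadFunctional (inclL2 Ω)).comp (P.comp (inclL2 Ω))) y φ
      = inner ℝ g (inclL2 Ω φ)) (φ : ↥(H10 Ω)) :
    |(A₂ + (loadFunctional (inclL2 Ω)).comp (P.comp (inclL2 Ω))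
      - (A₁ + (loadFunctional (inclL2 Ω)).comp (P.comp (inclL2 Ω)))) y φ| ≤
      N * (1 + M) * (‖g‖ + ‖y‖) * ‖p₁ - p₂‖ * ‖φ‖ := by
  -- The zero order term is moved to the load, which remains in `L²`; this accounts for the factor
  -- `1 + M`.
  have e : ∀ φ ∈ H10 Ω, ellipticForm p₂ b c y.1 φ = inner ℝ (g - P (inclL2 Ω y)) φ.fst := by
    intro φ hφ
    have := hyg ⟨φ, hφ⟩
    simp only [add_apply, ContinuousLinearMap.comp_apply, loadFunctional_apply, hA₂,
      inclL2_apply (Ω := Ω) ⟨φ, hφ⟩] at this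
    rw [inner_sub_left, ← this, add_sub_cancel_right]
  have hn : ‖g - P (inclL2 Ω y)‖ ≤ ‖g‖ + M * ‖y‖ := by
    refine (norm_sub_le _ _).trans (add_le_add le_rfl ?_)
    exact (hP _).trans (mul_le_mul_of_nonneg_left (norm_inclL2_le y) hM)
  have h := hdiff y.1 y.2 _ e φ.1
  have e' : (A₂ + (loadFunctional (inclL2 Ω)).comp (P.comp (inclL2 Ω))
      - (A₁ + (loadFunctional (inclL2 Ω)).comp (P.comp (inclL2 Ω)))) y φ
      = ellipticForm p₂ b c y.1 φ.1 - ellipticForm p₁ b c y.1 φ.1 := by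
    rw [← hA₂, ← hA₁]
    simp only [sub_apply, add_apply]
    ring
  rw [e', norm_sub_rev p₁ p₂]
  refine h.trans ?_
  have hyn : ‖y.1‖ = ‖y‖ := rfl
  have hφn : ‖φ.1‖ = ‖φ‖ := rfl
  rw [hyn, hφn, mul_assoc N (1 + M)]
  gcongr
  nlinarith [mul_nonneg hM (norm_nonneg g)]

end WeakSolutions

/-! ### Approximated gradients at the final time -/

section FinalTime

variable {Ω : Set Plane}

theorem memLp_inner_of_bound {v w : L2Vec Ω} {B : ℝ} (hB : 0 ≤ B)
    (hw : ∀ᵐ x ∂volume.restrict Ω, ‖w x‖ ≤ B) (a : ℝ) :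
    MemLp (fun x => a * inner ℝ (v x) (w x)) 2 (volume.restrict Ω) ∧
      l2n (volume.restrict Ω) (fun x => a * inner ℝ (v x) (w x)) ≤ |a| * (‖v‖ * B) := by
  have hb : ∀ᵐ x ∂volume.restrict Ω, ‖inner ℝ (v x) (w x)‖ ≤ ‖B • v x‖ := by
    filter_upwards [hw] with x hx
    rw [norm_smul, Real.norm_of_nonneg hB, mul_comm]
    exact (norm_inner_le_norm _ _).trans (mul_le_mul_of_nonneg_left hx (norm_nonneg _))
  have m1 : MemLp (fun x => B • v x) 2 (volume.restrict Ω) := (Lp.memLp v).const_smul B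
  have m : MemLp (fun x => inner ℝ (v x) (w x)) 2 (volume.restrict Ω) :=
    m1.mono ((Lp.memLp v).1.inner (Lp.memLp w).1) hb
  refine ⟨m.const_mul a, ?_⟩
  refine (l2n_const_smul (μ := volume.restrict Ω) a (fun x => inner ℝ (v x) (w x))).trans_le ?_
  refine mul_le_mul_of_nonneg_left ((l2n_mono m1 hb).trans_eq ?_) (abs_nonneg a)
  rw [l2n_const_smul, abs_of_nonneg hB, ← norm_eq_l2n, mul_comm]

/-- Bounds on the values at the final time yield a bound on the approximated gradients. -/
theorem exists_approxGradient {𝒯 : Triangulation Ω} {k : ℕ} {C : ℝ} (hC : 0 ≤ C)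
    (hlag : ∀ w ∈ lagrangeSpace 𝒯 k, ∃ W ∈ H1 Ω, W.fst = w ∧
      ∀ᵐ x ∂volume.restrict Ω, ‖W.snd x‖ ≤ C * ‖w‖) {μ : ℝ} (hμ : 0 < μ) {u v₁ v₂ : L2 Ω}
    {w v : GradPair Ω} (hw : w ∈ H10 Ω) (hv : v ∈ H10 Ω) (hw1 : w.fst = v₁ - v₂)
    (hv1 : v.fst = v₂) :
    ∃ G₁ G₂ : L2 Ω, IsApproxGradient 𝒯 k μ u v₁ G₁ ∧ IsApproxGradient 𝒯 k μ u v₂ G₂ ∧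
      ‖G₁ - G₂‖ ≤ μ⁻¹ * (C * ‖w‖ * (‖u‖ + 2 * ‖v‖ + ‖w‖)) := by
  have hmem (h : L2 Ω) : meshProj 𝒯 k h ∈ lagrangeSpace 𝒯 k := Submodule.starProjection_apply_mem _ _
  have hle (h : L2 Ω) : ‖meshProj 𝒯 k h‖ ≤ ‖h‖ := Submodule.norm_starProjection_apply_le _ h
  -- `W` represents the projection of `u - v₂` and `D` the one of `v₂ - v₁`, so `W + D` represents
  -- the projection of `u - v₁`.
  obtain ⟨W, hW, W1, W2⟩ := hlag _ (hmem (u - v₂))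
  obtain ⟨D, hD, D1, D2⟩ := hlag _ (hmem (v₂ - v₁))
  have nv : ‖v₂‖ ≤ ‖v‖ := hv1 ▸ norm_gradPair_fst_le v
  have nw : ‖v₂ - v₁‖ ≤ ‖w‖ := by
    rw [norm_sub_rev, ← hw1]; exact norm_gradPair_fst_le w
  have bW : ∀ᵐ x ∂volume.restrict Ω, ‖W.snd x‖ ≤ C * (‖u‖ + ‖v‖) := by
    filter_upwards [W2] with x hx
    refine hx.trans (mul_le_mul_of_nonneg_left ((hle _).trans ((norm_sub_le _ _).trans ?_)) hC)
    linarith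
  have bD : ∀ᵐ x ∂volume.restrict Ω, ‖D.snd x‖ ≤ C * ‖w‖ := by
    filter_upwards [D2] with x hx
    exact hx.trans (mul_le_mul_of_nonneg_left ((hle _).trans nw) hC)
  have bWD : ∀ᵐ x ∂volume.restrict Ω, ‖(W + D).snd x‖ ≤ C * (‖u‖ + ‖v‖ + ‖w‖) := by
    filter_upwards [bW, bD, coeFn_add_snd W D] with x h1 h2 h3
    rw [h3]
    exact (norm_add_le _ _).trans (by linarith)
  have p1 : 0 ≤ C * (‖u‖ + ‖v‖) := by positivity
  have p2 : 0 ≤ C * ‖w‖ := by positivity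
  have p3 : 0 ≤ C * (‖u‖ + ‖v‖ + ‖w‖) := by positivity
  obtain ⟨m1, -⟩ := memLp_inner_of_bound (v := (v + w).snd) p3 bWD μ⁻¹
  obtain ⟨m2, -⟩ := memLp_inner_of_bound (v := v.snd) p1 bW μ⁻¹
  obtain ⟨m3, b3⟩ := memLp_inner_of_bound (v := w.snd) p3 bWD μ⁻¹
  obtain ⟨m4, b4⟩ := memLp_inner_of_bound (v := v.snd) p2 bD μ⁻¹
  refine ⟨m1.toLp _, m2.toLp _, ⟨⟨v + w, H10_le_H1 ((H10 Ω).add_mem hv hw)⟩,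
    ⟨W + D, (H1 Ω).add_mem hW hD⟩, ?_, ?_, m1.coeFn_toLp⟩,
    ⟨⟨v, H10_le_H1 hv⟩, ⟨W, hW⟩, hv1, W1, m2.coeFn_toLp⟩, ?_⟩
  · rw [WithLp.add_fst, hv1, hw1, add_sub_cancel]
  · rw [WithLp.add_fst, W1, D1, ← map_add, sub_add_sub_cancel]
  · rw [← MemLp.toLp_sub, norm_toLp_eq_l2n]
    -- The difference of the products, with `v₁ = v₂ + w`: each term contains one small factor, `∇w`
    -- or `∇D`, and one finite element gradient, which is bounded.
    have e : ((fun x => μ⁻¹ * inner ℝ ((v + w).snd x) ((W + D).snd x))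
        - fun x => μ⁻¹ * inner ℝ (v.snd x) (W.snd x)) =ᵐ[volume.restrict Ω]
        (fun x => μ⁻¹ * inner ℝ (w.snd x) ((W + D).snd x) + μ⁻¹ * inner ℝ (v.snd x) (D.snd x)) := by
      filter_upwards [coeFn_add_snd W D, coeFn_add_snd v w] with x h1 h2
      rw [Pi.sub_apply, h1, h2]
      simp only [inner_add_left, inner_add_right]
      ring
    rw [l2n_congr e]
    refine (l2n_add_le m3 m4).trans ((add_le_add b3 b4).trans ?_)
    rw [abs_of_pos (inv_pos.2 hμ), ← mul_add]
    refine mul_le_mul_of_nonneg_left ?_ (inv_pos.2 hμ).le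
    have n1 := mul_le_mul_of_nonneg_right (norm_gradPair_snd_le w) p3
    have n2 := mul_le_mul_of_nonneg_right (norm_gradPair_snd_le v) p2
    linarith

theorem IsConvexPolygon.isOpen (h : IsConvexPolygon Ω) : IsOpen Ω := by
  obtain ⟨-, S, rfl⟩ := h
  exact isOpen_interior

theorem IsConvexPolygon.convex (h : IsConvexPolygon Ω) : Convex ℝ Ω := by
  obtain ⟨-, S, rfl⟩ := h
  exact (convex_convexHull ℝ _).interior

theorem IsConvexPolygon.isBounded (h : IsConvexPolygon Ω) : Bornology.IsBounded Ω := by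
  obtain ⟨-, S, rfl⟩ := h
  exact ((S.finite_toSet.isCompact_convexHull (𝕜 := ℝ)).isBounded).subset interior_subset

end FinalTime

end

theorem mainTheorem9
    (Ω : Set Plane) (hΩ : IsConvexPolygon Ω)
    (T : ℝ) (hT : 0 < T)
    (q₀ q₁ : ℝ) (hq₀ : 0 < q₀)
    (𝒯 : Triangulation Ω) (k : ℕ) (hk : 1 ≤ k)
    (q : H1 Ω) (hq : q ∈ admissible Ω q₀ q₁)
    (b : Fin 2 → H1 Ω)
    (c : Lp ℝ ⊤ (volume.restrict Ω)) (hc : ∀ᵐ x ∂volume.restrict Ω, 0 ≤ c x)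
    (f u₀ : L2 Ω)
    (u : ℝ → L2 Ω) (hu : IsWeakSolution T q b c (fun _ => f) u₀ u)
    (M R : ℝ) :
    ∃ C : ℝ, 0 < C ∧ ∀ μ : ℝ, 0 < μ → μ ≤ M →
      ∀ qt₁ ∈ admissible Ω q₀ q₁, ∀ qt₂ ∈ admissible Ω q₀ q₁, ‖qt₁‖ ≤ R → ‖qt₂‖ ≤ R →
      ∀ v₁ v₂ : ℝ → L2 Ω,
        IsAssimilation T 𝒯 k μ qt₁ b c f u v₁ → IsAssimilation T 𝒯 k μ qt₂ b c f u v₂ →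
        ∃ G₁ G₂ : L2 Ω,
          IsApproxGradient 𝒯 k μ (u T) (v₁ T) G₁ ∧ IsApproxGradient 𝒯 k μ (u T) (v₂ T) G₂ ∧
          ‖G₁ - G₂‖ ≤ C / (q₀ * μ) * ‖qt₁ - qt₂‖ := by
  have hO := hΩ.isOpen
  have hfin : IsFiniteMeasure (volume.restrict Ω) := ⟨by
    rw [Measure.restrict_apply_univ]; exact hΩ.isBounded.measure_lt_top⟩
  have hQ : 0 ≤ |q₀| + |q₁| := by positivity
  obtain ⟨K, hK, hform⟩ := exists_ellipticForm_bound hO b c hQ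
  obtain ⟨κ, hκ, hgar⟩ := exists_garding hO b c hq₀ q₁
  obtain ⟨N, hN, hdiff⟩ := exists_form_difference_bound hO b c hq₀ q₁
  obtain ⟨L, hL, hlag⟩ := exists_H1_of_mem_lagrangeSpace hΩ.convex hΩ.isBounded
    hO.measurableSet 𝒯 k
  obtain ⟨B, hB⟩ := (isCompact_Icc (a := (0 : ℝ)) (b := T)).exists_bound_of_continuousOn
    hu.continuousOn
  have hB0 : 0 ≤ B := (norm_nonneg _).trans (hB 0 ⟨le_rfl, hT.le⟩)
  have hM0 : 0 ≤ |M| := abs_nonneg M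
  -- The constant depends on the coefficients only through uniform bounds, and on `μ` only through
  -- `|M|`; it is fixed before `μ` and the coefficients are chosen.
  obtain ⟨C, hC, hmain⟩ := exists_lipschitz_bound (inclL2 Ω) norm_inclL2_le (half_pos hq₀) hκ
    (K + |M|) hM0 (by positivity : 0 ≤ ‖f‖ + B) (by positivity : 0 ≤ N * (1 + |M|)) hT
  have form (p : H1 Ω) (hp : p ∈ admissible Ω q₀ q₁) :
      ∃ A : ↥(H10 Ω) →L[ℝ] ↥(H10 Ω) →L[ℝ] ℝ, (∀ v φ, A v φ = ellipticForm p b c v.1 φ.1) ∧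
        IsGarding (inclL2 Ω) A (q₀ / 2) κ K := by
    obtain ⟨A, h1, h2⟩ := hform p (abs_coeff_le hp)
    exact ⟨A, h1, h2, fun v => by rw [h1]; exact hgar p hp v.1 v.2⟩
  obtain ⟨A₀, hA₀, gA₀⟩ := form q hq
  obtain ⟨Z₀, hZ₀⟩ := hu.integratedSolution hT hA₀
  -- The factor `q₀` compensates the one in the denominator of the claim, and the summand `1`
  -- ensures positivity. The radius `R` bounds the one factor `‖w‖` in which the estimate is
  -- quadratic.
  refine ⟨(L * C * (B + 2 * C + C * (2 * |R|)) + 1) * q₀, by positivity, ?_⟩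
  intro μ hμ hμM p₁ hp₁ p₂ hp₂ hR₁ hR₂ v₁ v₂ hv₁ hv₂
  have hμM' : μ ≤ |M| := hμM.trans (le_abs_self M)
  obtain ⟨A₁, hA₁, gA₁⟩ := form p₁ hp₁
  obtain ⟨A₂, hA₂, gA₂⟩ := form p₂ hp₂
  obtain ⟨Z₁, hZ₁⟩ := hv₁.integratedSolution hT hA₁ hu.continuousOn hZ₀.continuous_primitive
    hZ₀.primitive_eq
  obtain ⟨Z₂, hZ₂⟩ := hv₂.integratedSolution hT hA₂ hu.continuousOn hZ₀.continuous_primitive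
    hZ₀.primitive_eq
  have h0T : (0 : ℝ) ∈ Icc 0 T := ⟨le_rfl, hT.le⟩
  have hTT : T ∈ Icc 0 T := ⟨hT.le, le_rfl⟩
  have hd : ‖p₁ - p₂‖ ≤ 2 * |R| :=
    (norm_sub_le _ _).trans (by linarith [le_abs_self R])
  obtain ⟨w, v, hw, hwC, hv, hvC⟩ := hmain A₀ _ _ (μ • meshProj 𝒯 k) f u₀ Z₀ Z₁ Z₂ _ _ _
    ‖p₁ - p₂‖ ⟨fun v φ => (gA₀.bound v φ).trans (by gcongr; linarith), gA₀.coercive⟩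
    (gA₁.add_meshProj 𝒯 k hμ.le hμM') (gA₂.add_meshProj 𝒯 k hμ.le hμM')
    (norm_smul_meshProj_le 𝒯 k hμ.le hμM') (by linarith) hZ₀
    (fun t => (hB _ (Subtype.prop _)).trans (by linarith [norm_nonneg f])) hZ₁
    (by rw [extendIcc_of_mem hT v₁ h0T]; exact IsWeakSolution.initial hv₁) hZ₂
    (by rw [extendIcc_of_mem hT v₂ h0T]; exact IsWeakSolution.initial hv₂) (norm_nonneg _) (abs_form_difference_le hA₁ hA₂ hN hM0
      (norm_smul_meshProj_le 𝒯 k hμ.le hμM') (hdiff p₂ hp₂ p₁ hp₁))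
  rw [extendIcc_of_mem hT v₁ hTT, extendIcc_of_mem hT v₂ hTT] at hw
  rw [extendIcc_of_mem hT v₂ hTT] at hv
  obtain ⟨G₁, G₂, hG₁, hG₂, hG⟩ := exists_approxGradient hL hlag hμ (u := u T) w.2 v.2 hw hv
  refine ⟨G₁, G₂, hG₁, hG₂, hG.trans ?_⟩
  have hw' : ‖w.1‖ ≤ C * ‖p₁ - p₂‖ := hwC
  have hv' : ‖v.1‖ ≤ C := hvC
  have hw2 : ‖w.1‖ ≤ C * (2 * |R|) := hw'.trans (mul_le_mul_of_nonneg_left hd hC.le)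
  have huT : ‖u T‖ ≤ B := hB T hTT
  have e : (L * C * (B + 2 * C + C * (2 * |R|)) + 1) * q₀ / (q₀ * μ) * ‖p₁ - p₂‖
      = μ⁻¹ * ((L * C * (B + 2 * C + C * (2 * |R|)) + 1) * ‖p₁ - p₂‖) := by
    field_simp
  rw [e]
  refine mul_le_mul_of_nonneg_left ?_ (inv_pos.2 hμ).le
  calc L * ‖w.1‖ * (‖u T‖ + 2 * ‖v.1‖ + ‖w.1‖)
      ≤ L * (C * ‖p₁ - p₂‖) * (B + 2 * C + C * (2 * |R|)) := by gcongr
    _ = L * C * (B + 2 * C + C * (2 * |R|)) * ‖p₁ - p₂‖ := by ring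
    _ ≤ _ := by
      gcongr
      linarith
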